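/- **Weak approximation of SGDM by SGD.** *Polynomial growth and test functions.* A map $g$ on $\mathbb R^d$ has polynomial growth if $\|g(x)\|\le k_1(1+\|x\|^{k_2})$ for all $x$ and some constants $k_1,k_2>0$. A test function is a $C^\infty$ function $h:\mathbb R^d\to\mathbb R$ whose derivatives of all orders $\ge 0$ have polynomial growth. *Oracle.* A noisy gradient oracle $\mathcal G_\sigma=(\mathcal L,\Sigma,\mathcal Z_\sigma)$ consists of a differentiable $\mathcal L:\mathbb R^d\to\mathbb R$, a matrix-valued $\Sigma$ on $\mathbb R^d$, and, for each noise scale $\sigma>0$, probability distributions $\mathcal Z_\sigma(\theta)$ on $\mathbb R^d$ (depending measurably on $\theta$) with mean zero and covariance matrix $\Sigma(\theta)$, which does not depend on $\sigma$. It returns $g=\nabla\mathcal L(\theta)+\sigma v$ with $v\sim\mathcal Z_\sigma(\theta)$; write $g\sim\mathcal G_\sigma(\theta)$. Assume: 1. $\nabla\mathcal L$ is Lipschitz and $C^\infty$; $\Sigma^{1/2}$ is bounded, Lipschitz and $C^\infty$; all partial derivatives of $\nabla\mathcal L$ and $\Sigma^{1/2}$ up to and including the third order have polynomial growth. 2.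 For every integer $m\ge1$ there is a constant $C_{2m}$, independent of $\sigma$ and $\theta$, with $(\mathbb E_{v\sim\mathcal Z_\sigma(\theta)}\|v\|^{2m})^{1/(2m)}\le C_{2m}(1+\|\theta\|)$ for all $\sigma>0$ and $\theta\in\mathbb R^d$. *Schedules and trajectories.* Fix $x_0\in\mathbb R^d$, $\alpha\in[0,1)$ and a set $S\subseteq(0,\infty)$ of scales $\eta$. For each $\eta\in S$ let $(\eta_k,\beta_k)_{k\ge0}$ be a schedule (depending on $\eta$) with $\beta_k\in(0,1)$. Assume the family is scaled by $\eta$ with index $\alpha$: there are constants $\eta_{\max},\lambda_{\min},\lambda_{\max}$, independent of $\eta$, with $$0\le\eta_k/\eta<\eta_{\max},\qquad 0<\lambda_{\min}\le(1-\beta_k)/\eta^{\alpha}\le\lambda_{\max}<1\qquad\text{for all }k\text{ and all }\eta\in S.$$ Let $0<\sigma=\sigma(\eta)\le\eta^{-1/2}$. Let $(m^\eta_k,x^\eta_k)$ be the SGDM trajectory $$m_{k+1}=\beta_k m_k+(1-\beta_k)g_k,\qquad x_{k+1}=x_k-\eta_k m_{k+1},\qquad g_k\sim\mathcal G_\sigma(x_k)\text{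 given }(m_0,x_0),\dots,(m_k,x_k),$$ started at the point $x_0$ with a random initial momentum $m_0^\eta$ such that for every integer $n\ge1$ there is a constant $C_n$, independent of $\eta$, with $\mathbb E\|m_0^\eta\|^n\le C_n$. Let $z^\eta_k$ be the SGD trajectory $$z_{k+1}=z_k-\bar\eta_k g'_k,\qquad g'_k\sim\mathcal G_\sigma(z_k)\text{ given }z_0,\dots,z_k,\qquad z_0=x_0,\qquad \bar\eta_k=\sum_{s=k}^{\infty}\eta_s\Big(\prod_{\tau=k+1}^{s}\beta_\tau\Big)(1-\beta_k).$$ **Theorem.** The series defining $\bar\eta_k$ converge, and $x^\eta_k$ is an order-$(1-\alpha)/2$ weak approximation of $z^\eta_k$: there is $\eta_{\mathrm{thr}}>0$ such that for every $T>0$ and every test function $h$ there is a constant $C_{h,T}$, independent of $\eta$, such that for all $\eta\in S$ with $\eta\le\eta_{\mathrm{thr}}$ the expectations below exist and $$\max_{k=0,\dots,\lfloor T/\eta\rfloor}\big|\mathbb E\,h(x^\eta_k)-\mathbb E\,h(z^\eta_k)\big|\le C_{h,T}\,\eta^{(1-\alpha)/2}.$$ In particular, if the schedules are constant, $\eta_k=\eta$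 and $\beta_k=\beta=\beta(\eta)$ for all $k$, then $\bar\eta_k=\eta$, and SGD and SGDM with the same learning rate $\eta$ satisfy the same estimate (with the same order of quantifiers) with the bound $C_{h,T}\sqrt{\eta/(1-\beta)}$ in place of $C_{h,T}\,\eta^{(1-\alpha)/2}$. -/

import Mathlib

open MeasureTheory ProbabilityTheory
open scoped ENNReal MatrixOrder

noncomputable section

/-- `g` has polynomial growth: `‖g x‖ ≤ k₁ (1 + ‖x‖ ^ k₂)` for some constants `k₁, k₂ > 0`. -/
def HasPolynomialGrowth {E F : Type*} [NormedAddCommGroup E] [NormedAddCommGroup F]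
    (g : E → F) : Prop :=
  ∃ k₁ k₂ : ℝ, 0 < k₁ ∧ 0 < k₂ ∧ ∀ x, ‖g x‖ ≤ k₁ * (1 + ‖x‖ ^ k₂)

/-- Test functions: smooth functions all of whose derivatives (of every order `n ≥ 0`) have
polynomial growth. -/
def HasAllOrderPolynomialGrowth {d : ℕ} (h : EuclideanSpace ℝ (Fin d) → ℝ) : Prop :=
  ContDiff ℝ (⊤ : ℕ∞) h ∧ ∀ n : ℕ, HasPolynomialGrowth (iteratedFDeriv ℝ n h)

/-- A noisy gradient oracle with scale parameter on `ℝ^d`. For a scale `σ > 0` and an input `θ` it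
returns `∇ loss θ + σ • v`, where `v` is drawn from the probability distribution `noise σ θ`, which
has mean zero and covariance matrix `cov θ`; the latter does not depend on `σ`.
Nothing is required of `noise σ` for `σ ≤ 0`. -/
structure NGOS (d : ℕ) where
  loss : EuclideanSpace ℝ (Fin d) → ℝ
  cov : EuclideanSpace ℝ (Fin d) → Matrix (Fin d) (Fin d) ℝ
  noise : ℝ → Kernel (EuclideanSpace ℝ (Fin d)) (EuclideanSpace ℝ (Fin d))
  differentiable_loss : Differentiable ℝ loss
  isMarkovKernel_noise : ∀ σ : ℝ, 0 < σ → IsMarkovKernel (noise σ)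
  memLp_noise : ∀ σ : ℝ, 0 < σ → ∀ θ, MemLp id 2 (noise σ θ)
  mean_noise : ∀ σ : ℝ, 0 < σ → ∀ θ, ∫ v, v ∂(noise σ θ) = 0
  cov_noise : ∀ σ : ℝ, 0 < σ → ∀ θ, ∀ i j, ∫ v, v i * v j ∂(noise σ θ) = cov θ i j

namespace NGOS

variable {d : ℕ}

/-- The stochastic gradient returned by the oracle at `θ` when the gradient noise is `v`. -/
def stochGrad (G : NGOS d) (σ : ℝ) (θ v : EuclideanSpace ℝ (Fin d)) : EuclideanSpace ℝ (Fin d) :=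
  gradient G.loss θ + σ • v

/-- The positive semidefinite square root of the covariance matrix, as an operator on Euclidean
space (so that its norm is the spectral norm). -/
def sqrtCov (G : NGOS d) (θ : EuclideanSpace ℝ (Fin d)) :
    EuclideanSpace ℝ (Fin d) →L[ℝ] EuclideanSpace ℝ (Fin d) :=
  Matrix.toEuclideanCLM (𝕜 := ℝ) (CFC.sqrt (G.cov θ))

/-- The regularity conditions on the oracle: it is well-behaved and has bounded moments. -/
structure IsRegular (G : NGOS d) : Prop where
  grad_lipschitz : ∃ K, LipschitzWith K (gradient G.loss)
  grad_smooth : ContDiff ℝ (⊤ : ℕ∞) (gradient G.loss)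
  sqrtCov_bounded : ∃ C : ℝ, ∀ θ, ‖G.sqrtCov θ‖ ≤ C
  sqrtCov_lipschitz : ∃ K, LipschitzWith K G.sqrtCov
  sqrtCov_smooth : ContDiff ℝ (⊤ : ℕ∞) G.sqrtCov
  grad_growth : ∀ n : ℕ, n ≤ 3 → HasPolynomialGrowth (iteratedFDeriv ℝ n (gradient G.loss))
  sqrtCov_growth : ∀ n : ℕ, n ≤ 3 → HasPolynomialGrowth (iteratedFDeriv ℝ n G.sqrtCov)
  /-- `(𝔼 ‖v‖ ^ (2 m)) ^ (1 / (2 m)) ≤ C (1 + ‖θ‖)`, with `C` depending on `m` only. -/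
  bounded_moments : ∀ m : ℕ, 1 ≤ m → ∃ C : ℝ, ∀ σ : ℝ, 0 < σ → ∀ θ,
    eLpNorm id ((2 * m : ℕ) : ℝ≥0∞) (G.noise σ θ) ≤ ENNReal.ofReal (C * (1 + ‖θ‖))

end NGOS

/-- `z` is a trajectory of SGD with oracle `G` at noise scale `σ`, learning rates `lr` and initial
point `z₀`; `v k` is the gradient noise of step `k`, whose conditional law given
`z 0, …, z k` is `G.noise σ (z k)`. -/
structure IsSGD {d : ℕ} (G : NGOS d) (σ : ℝ) (lr : ℕ → ℝ) (z₀ : EuclideanSpace ℝ (Fin d))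
    {Ω : Type*} [MeasurableSpace Ω] (P : Measure Ω)
    (z v : ℕ → Ω → EuclideanSpace ℝ (Fin d)) : Prop where
  init : ∀ ω, z 0 ω = z₀
  step : ∀ k ω, z (k + 1) ω = z k ω - lr k • G.stochGrad σ (z k ω) (v k ω)
  noise : ∀ k, HasCondDistrib (v k) (fun ω (i : Fin (k + 1)) ↦ z i ω)
    ((G.noise σ).comap (fun w ↦ w (Fin.last k)) (by fun_prop)) P

/-- `(m, x)` is a trajectory of SGD with momentum with oracle `G` at noise scale `σ`,
hyperparameters `(lr k, β k)`, initial point `x₀` and (random) initial momentum `m 0`; `v k` is the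
gradient noise of step `k`, whose conditional law given `(m 0, x 0), …, (m k, x k)` is
`G.noise σ (x k)`. -/
structure IsSGDM {d : ℕ} (G : NGOS d) (σ : ℝ) (lr β : ℕ → ℝ) (x₀ : EuclideanSpace ℝ (Fin d))
    {Ω : Type*} [MeasurableSpace Ω] (P : Measure Ω)
    (m x v : ℕ → Ω → EuclideanSpace ℝ (Fin d)) : Prop where
  init : ∀ ω, x 0 ω = x₀
  step_momentum : ∀ k ω,
    m (k + 1) ω = β k • m k ω + (1 - β k) • G.stochGrad σ (x k ω) (v k ω)
  step : ∀ k ω, x (k + 1) ω = x k ω - lr k • m (k + 1) ω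
  noise : ∀ k, HasCondDistrib (v k) (fun ω (i : Fin (k + 1)) ↦ (m i ω, x i ω))
    ((G.noise σ).comap (fun w ↦ (w (Fin.last k)).2) (by fun_prop)) P

/-- A family of hyperparameter schedules `(lr η k, β η k)`, indexed by scales `η ∈ S`, is scaled by
`η` with index `α`. The decay factors of a schedule lie in `(0, 1)`. -/
def IsScaledSchedule (S : Set ℝ) (α : ℝ) (lr β : ℝ → ℕ → ℝ) : Prop :=
  (∀ η ∈ S, ∀ k, β η k ∈ Set.Ioo (0 : ℝ) 1) ∧
  ∃ etaMax lamMin lamMax : ℝ, 0 < lamMin ∧ lamMax < 1 ∧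
    ∀ η ∈ S, ∀ k, (0 ≤ lr η k / η ∧ lr η k / η < etaMax) ∧
      (lamMin ≤ (1 - β η k) / η ^ α ∧ (1 - β η k) / η ^ α ≤ lamMax)

/-- The term with index `s = k + j` of the series that defines the averaged learning rate:
`lr s * (∏ τ ∈ {k+1, …, s}, β τ) * (1 - β k)`. -/
def averagedLRTerm (lr β : ℕ → ℝ) (k j : ℕ) : ℝ :=
  lr (k + j) * (∏ τ ∈ Finset.Ioc k (k + j), β τ) * (1 - β k)

/-- The averaged learning rate, the sum over all `s ≥ k`. -/
def averagedLR (lr β : ℕ → ℝ) (k : ℕ) : ℝ := ∑' j, averagedLRTerm lr β k j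

/-- The initial momenta `m₀ η`, `η ∈ S`, have all moments bounded uniformly in `η`. -/
def HasBoundedMoments {d : ℕ} (S : Set ℝ) {Ω : ℝ → Type*} [∀ η, MeasurableSpace (Ω η)]
    (P : ∀ η, Measure (Ω η)) (m₀ : ∀ η, Ω η → EuclideanSpace ℝ (Fin d)) : Prop :=
  ∀ n : ℕ, 1 ≤ n → ∃ C : ℝ, 0 ≤ C ∧ ∀ η ∈ S,
    Integrable (fun ω ↦ ‖m₀ η ω‖ ^ n) (P η) ∧ ∫ ω, ‖m₀ η ω‖ ^ n ∂(P η) ≤ C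

/-- The families of trajectories `x η` and `y η`, `η ∈ S`, approximate each other weakly at rate
`ρ η`: there is a threshold `thr > 0` such that for every horizon `T` and every test function `h`
there is a constant `C` with `|𝔼 h (x η k) - 𝔼 h (y η k)| ≤ C * ρ η` for all scales `η ≤ thr` in `S`
and all `k = 0, …, ⌊T / η⌋` (and these expectations exist). -/
def IsWeakApproxAtRate {d : ℕ} (ρ : ℝ → ℝ) (S : Set ℝ)
    {Ω : ℝ → Type*} [∀ η, MeasurableSpace (Ω η)] (P : ∀ η, Measure (Ω η))
    (x : ∀ η, ℕ → Ω η → EuclideanSpace ℝ (Fin d))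
    {Ω' : ℝ → Type*} [∀ η, MeasurableSpace (Ω' η)] (P' : ∀ η, Measure (Ω' η))
    (y : ∀ η, ℕ → Ω' η → EuclideanSpace ℝ (Fin d)) : Prop :=
  ∃ thr : ℝ, 0 < thr ∧ ∀ T : ℝ, 0 < T →
    ∀ h : EuclideanSpace ℝ (Fin d) → ℝ, HasAllOrderPolynomialGrowth h →
      ∃ C : ℝ, ∀ η ∈ S, η ≤ thr → ∀ k : ℕ, k ≤ ⌊T / η⌋₊ →
        Integrable (fun ω ↦ h (x η k ω)) (P η) ∧ Integrable (fun ω ↦ h (y η k ω)) (P' η) ∧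
        |∫ ω, h (x η k ω) ∂(P η) - ∫ ω, h (y η k ω) ∂(P' η)| ≤ C * ρ η

/-- Order-`γ` weak approximation. -/
def IsWeakApprox {d : ℕ} (γ : ℝ) (S : Set ℝ)
    {Ω : ℝ → Type*} [∀ η, MeasurableSpace (Ω η)] (P : ∀ η, Measure (Ω η))
    (x : ∀ η, ℕ → Ω η → EuclideanSpace ℝ (Fin d))
    {Ω' : ℝ → Type*} [∀ η, MeasurableSpace (Ω' η)] (P' : ∀ η, Measure (Ω' η))
    (y : ∀ η, ℕ → Ω' η → EuclideanSpace ℝ (Fin d)) : Prop :=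
  IsWeakApproxAtRate (fun η ↦ η ^ γ) S P x P' y

end

/-! Let `a k = tailLR lr β k` be the total learning rate that still acts on the momentum of step
k+1; it satisfies a_k = η_k + β_{k+1} a_{k+1}. For the averaged iterate y_k = x_k - β_k a_k m_k the
momentum cancels, and y_{k+1} = y_k - a_k (1 - β_k) g_k, where a_k (1 - β_k) is exactly the averaged
learning rate. So y is SGD with the learning rates of z, except that the gradient is queried at x_k
(`IsSGDM.perturbedDescent`). Put ρ = η^((1-α)/2). Then a_k = O(ρ²), and the rescaled momentum ρ m_k
has moments bounded uniformly up to time T (`exists_moment_bound_momentum`): noise of variance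
O(η^α) enters per step and is balanced by a contraction of order η^α. Hence x - y is O(ρ) in every
moment.

It remains to compare laws. The noise law is only measurable in θ, so the transition operator of SGD
need not preserve smoothness; only Σ^{1/2} is smooth. Both schemes are therefore compared with a
third chain, `signedStep`, which adds ± a random column of Σ^{1/2}, suitably scaled, to the drift
step. Its increments have the same mean and covariance as those of SGD, so a second order Taylor
expansion gives a one-step discrepancy O(ηρ): the cubic remainder is O(η^{3/2}), and exchanging x
for y in the drift and in the covariance costs O(ηρ) (`exists_abs_integral_step_sub_signedStep_le`).
Telescoping over T/η steps gives O(ρ), and exchanging x for y at the two ends of the time interval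
costs another O(ρ) (`exists_abs_integral_sub_signedEvolution_le`).

Telescoping needs bounds, uniform over T/η steps, on three derivatives of the evolved test function.
`JetBound` measures these derivatives along all smooth curves. A step of the two-point chain maps a
smooth curve to smooth curves, and averaging over the sign removes the terms of order √η, so the
weight of the jet grows only by a factor 1 + Cη per step (`exists_jetBound_signedStep`). -/

/-! ### Elementary inequalities between powers -/

theorem pow_mul_pow_le_add {a b : ℝ} (ha : 0 ≤ a) (hb : 0 ≤ b) (i j : ℕ) :
    a ^ i * b ^ j ≤ a ^ (i + j) + b ^ (i + j) := by
  rcases le_total a b with h | h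
  · calc a ^ i * b ^ j ≤ b ^ i * b ^ j := by gcongr
      _ = b ^ (i + j) := by rw [pow_add]
      _ ≤ _ := le_add_of_nonneg_left (by positivity)
  · calc a ^ i * b ^ j ≤ a ^ i * a ^ j := by gcongr
      _ = a ^ (i + j) := by rw [pow_add]
      _ ≤ _ := le_add_of_nonneg_right (by positivity)

theorem pow_le_one_add_pow {a : ℝ} (ha : 0 ≤ a) {i j : ℕ} (hij : i ≤ j) :
    a ^ i ≤ 1 + a ^ j := by
  rcases le_total a 1 with h | h
  · exact (pow_le_one₀ ha h).trans (le_add_of_nonneg_right (by positivity))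
  · exact (pow_le_pow_right₀ h hij).trans (le_add_of_nonneg_left zero_le_one)

theorem add_pow_le_two_pow {a b : ℝ} (ha : 0 ≤ a) (hb : 0 ≤ b) (n : ℕ) :
    (a + b) ^ n ≤ 2 ^ n * (a ^ n + b ^ n) := by
  rcases le_total a b with h | h
  · calc (a + b) ^ n ≤ (2 * b) ^ n := by gcongr; linarith
      _ = 2 ^ n * b ^ n := mul_pow _ _ _
      _ ≤ _ := by gcongr; exact le_add_of_nonneg_left (by positivity)
  · calc (a + b) ^ n ≤ (2 * a) ^ n := by gcongr; linarith
      _ = 2 ^ n * a ^ n := mul_pow _ _ _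
      _ ≤ _ := by gcongr; exact le_add_of_nonneg_right (by positivity)

theorem one_add_add_pow_le {a b : ℝ} (ha : 0 ≤ a) (hb : 0 ≤ b) (p : ℕ) :
    (1 + a + b) ^ p ≤ 4 ^ p * (1 + a ^ p + b ^ p) := by
  calc (1 + a + b) ^ p ≤ 2 ^ p * ((1 + a) ^ p + b ^ p) :=
        add_pow_le_two_pow (by positivity) hb p
    _ ≤ 2 ^ p * (2 ^ p * (1 ^ p + a ^ p) + 2 ^ p * b ^ p) := by
      gcongr
      · exact add_pow_le_two_pow zero_le_one ha p
      · exact le_mul_of_one_le_left (by positivity) (one_le_pow₀ one_le_two)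
    _ = _ := by
      rw [one_pow, ← mul_add, ← mul_assoc, ← mul_pow]
      norm_num

/-- Weighted Young inequality with an arbitrarily small constant on the leading term. -/
theorem exists_pow_mul_le_small {κ : ℝ} (hκ : 0 < κ) (n : ℕ) :
    ∃ K : ℝ, 0 ≤ K ∧ ∀ a b : ℝ, 0 ≤ a → 0 ≤ b →
      a ^ n * b ≤ κ * a ^ (n + 1) + K * b ^ (n + 1) := by
  refine ⟨(κ ^ n)⁻¹, by positivity, fun a b ha hb ↦ ?_⟩
  rcases le_total b (κ * a) with h | h
  · calc a ^ n * b ≤ a ^ n * (κ * a) := by gcongr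
      _ = κ * a ^ (n + 1) := by ring
      _ ≤ _ := le_add_of_nonneg_right (by positivity)
  · calc a ^ n * b = (κ ^ n)⁻¹ * ((κ * a) ^ n * b) := by rw [mul_pow]; field_simp
      _ ≤ (κ ^ n)⁻¹ * (b ^ n * b) := by gcongr
      _ = (κ ^ n)⁻¹ * b ^ (n + 1) := by ring
      _ ≤ _ := le_add_of_nonneg_left (by positivity)

/-- Keeps a factor `b` next to the highest power of `a`. In the momentum recursion that term is
later absorbed by the contraction, which a bare `a ^ (n + 2)` with a large constant would not allow.
-/
theorem pow_mul_sq_le_pow_succ_mul_add {a b : ℝ} (ha : 0 ≤ a) (hb : 0 ≤ b) (n : ℕ) :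
    a ^ n * b ^ 2 ≤ a ^ (n + 1) * b + b ^ (n + 2) := by
  rcases le_total b a with h | h
  · calc a ^ n * b ^ 2 = a ^ n * b * b := by ring
      _ ≤ a ^ n * a * b := by gcongr
      _ = a ^ (n + 1) * b := by ring
      _ ≤ _ := le_add_of_nonneg_right (by positivity)
  · calc a ^ n * b ^ 2 ≤ b ^ n * b ^ 2 := by gcongr
      _ = b ^ (n + 2) := by ring
      _ ≤ _ := le_add_of_nonneg_left (by positivity)

/-! ### Even powers of the norm under a small drift and a centered increment -/

section InnerProductSpace

variable {E : Type*} [NormedAddCommGroup E] [InnerProductSpace ℝ E]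

/-- First order expansion of an even power of the norm, with a remainder of second order. -/
theorem exists_norm_add_pow_le (n : ℕ) : ∃ K : ℝ, 0 ≤ K ∧ ∀ a d : E,
    ‖a + d‖ ^ (2 * (n + 1)) ≤ ‖a‖ ^ (2 * (n + 1))
      + 2 * (n + 1) * ‖a‖ ^ (2 * n) * inner ℝ a d
      + K * (‖a‖ ^ (2 * n) * ‖d‖ ^ 2 + ‖d‖ ^ (2 * (n + 1))) := by
  induction n with
  | zero =>
    refine ⟨1, zero_le_one, fun a d ↦ ?_⟩
    have := norm_add_sq_real a d
    norm_num
    nlinarith [sq_nonneg ‖d‖]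
  | succ n ih =>
    obtain ⟨K, hK, h⟩ := ih
    refine ⟨K * 12 + 8 * (n + 1) + 1, by positivity, fun a d ↦ ?_⟩
    have e := norm_add_sq_real a d
    have hs := abs_real_inner_le_norm a d
    have h1 := h a d
    have hA : 0 ≤ ‖a‖ := norm_nonneg a
    have hD : 0 ≤ ‖d‖ := norm_nonneg d
    have p1 := pow_mul_pow_le_add hA hD (2 * n) 2
    have p2 := pow_mul_pow_le_add hD hA (2 * n) 2
    -- Multiply the case `n` by ‖a + d‖² = A² + 2s + D². The linear terms add up to 2(n+2) A^(2n+2)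
    -- s. The rest is quadratic in `d`: the old remainder contributes 12 K, the products of the old
    -- linear term with 2s and D² contribute 8 (n+1), and A^(2n+2) D² contributes 1.
    have key := mul_le_mul_of_nonneg_right h1 (sq_nonneg ‖a + d‖)
    have l1 : ‖a + d‖ ^ (2 * (n + 1)) * ‖a + d‖ ^ 2 = ‖a + d‖ ^ (2 * (n + 1 + 1)) := by ring
    rw [l1, e] at key
    refine key.trans ?_
    have t1 : ∀ x : ℝ, x ^ (2 * (n + 1)) = x ^ (2 * n) * x ^ 2 := fun x ↦ by ring
    have t2 : ∀ x : ℝ, x ^ (2 * (n + 1 + 1)) = x ^ (2 * n) * x ^ 4 := fun x ↦ by ring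
    have t3 : ∀ x : ℝ, x ^ (2 * n + 2) = x ^ (2 * n) * x ^ 2 := fun x ↦ by ring
    rw [t1, t1, t2, t2]
    rw [t3, t3] at p1 p2
    push_cast
    have hu : 0 ≤ ‖a‖ ^ (2 * n) := by positivity
    have hw : 0 ≤ ‖d‖ ^ (2 * n) := by positivity
    generalize ‖a‖ ^ (2 * n) = u at *
    generalize ‖d‖ ^ (2 * n) = w at *
    generalize ‖a‖ = A at *
    generalize ‖d‖ = D at *
    generalize inner ℝ a d = s at *
    have hs1 := (abs_le.1 hs).1
    have hs2 := (abs_le.1 hs).2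
    have hN : (0 : ℝ) ≤ n := n.cast_nonneg
    have hs3 : s ≤ A ^ 2 + D ^ 2 := by nlinarith [sq_nonneg (A - D)]
    have hs4 : s ^ 2 ≤ A ^ 2 * D ^ 2 := by
      rw [← mul_pow]; exact sq_le_sq.2 (by rwa [abs_of_nonneg (mul_nonneg hA hD)])
    have a1 := mul_le_mul_of_nonneg_left hs4 hu
    have a2 := mul_le_mul_of_nonneg_left hs3 (mul_nonneg hu (sq_nonneg D))
    have a3 := mul_le_mul_of_nonneg_right p1 (sq_nonneg D)
    have a4 := mul_le_mul_of_nonneg_right p2 (sq_nonneg D)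
    have a6 : 0 ≤ u * A ^ 2 * D ^ 2 := by positivity
    have a7 : 0 ≤ w * D ^ 4 := by positivity
    have a8 : u * D ^ 2 * s ≤ 2 * (u * A ^ 2 * D ^ 2 + w * D ^ 4) := by linarith
    have a9 : (u * D ^ 2 + w * D ^ 2) * (A ^ 2 + 2 * s + D ^ 2) ≤
        12 * (u * A ^ 2 * D ^ 2 + w * D ^ 4) := by
      calc _ ≤ (u * D ^ 2 + w * D ^ 2) * (A ^ 2 + 2 * (A ^ 2 + D ^ 2) + D ^ 2) := by gcongr
        _ ≤ _ := by linarith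
    have b1 := mul_le_mul_of_nonneg_left a1 (by positivity : (0 : ℝ) ≤ 4 * (n + 1))
    have b2 := mul_le_mul_of_nonneg_left a8 (by positivity : (0 : ℝ) ≤ 2 * (n + 1))
    have b3 := mul_le_mul_of_nonneg_left a9 hK
    have b4 : 0 ≤ (n + 1) * (w * D ^ 4) := by positivity
    have b5 : 0 ≤ (n + 1) * (u * A ^ 2 * D ^ 2) := by positivity
    linarith

/-- Expansion of an even power of the norm of `a + c + e` for a small drift `c`. -/
theorem exists_norm_add_add_pow_le (n : ℕ) : ∃ K : ℝ, 0 ≤ K ∧ ∀ (ε B : ℝ) (a c e : E),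
    0 ≤ ε → ε ≤ 1 → 0 ≤ B → ‖c‖ ≤ ε * B →
    ‖a + c + e‖ ^ (2 * (n + 1)) ≤ ‖a‖ ^ (2 * (n + 1))
      + 2 * (n + 1) * ‖a‖ ^ (2 * n) * inner ℝ a e
      + ε * (K * (‖a‖ ^ (2 * n + 1) * B + B ^ (2 * (n + 1))))
      + K * (‖a‖ ^ (2 * n) * ‖e‖ ^ 2 + ‖e‖ ^ (2 * (n + 1))) := by
  obtain ⟨K, hK, h⟩ := exists_norm_add_pow_le (E := E) n
  refine ⟨2 * (n + 1) + K * (2 + 2 ^ (2 * (n + 1))), by positivity,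
    fun ε B a c e hε hε1 hB hc ↦ ?_⟩
  have h1 := h a (c + e)
  rw [← add_assoc] at h1
  refine h1.trans ?_
  have hA : 0 ≤ ‖a‖ := norm_nonneg a
  have hcB : ‖c‖ ≤ B := hc.trans (mul_le_of_le_one_left hB hε1)
  have hcpow : ∀ j : ℕ, ‖c‖ ^ (j + 1) ≤ ε * B ^ (j + 1) := fun j ↦ by
    calc ‖c‖ ^ (j + 1) = ‖c‖ ^ j * ‖c‖ := pow_succ _ _
      _ ≤ B ^ j * (ε * B) := by gcongr
      _ = _ := by ring
  have e1 : inner ℝ a (c + e) ≤ ‖a‖ * (ε * B) + inner ℝ a e := by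
    rw [inner_add_right]
    gcongr
    exact (real_inner_le_norm a c).trans (by gcongr)
  have e2 : ‖c + e‖ ^ 2 ≤ 2 * (ε * B ^ 2 + ‖e‖ ^ 2) := by
    have := norm_add_le c e
    have h3 := hcpow 1
    norm_num at h3
    nlinarith [sq_nonneg (‖c‖ - ‖e‖), norm_nonneg (c + e)]
  have e3 : ‖c + e‖ ^ (2 * (n + 1)) ≤
      2 ^ (2 * (n + 1)) * (ε * B ^ (2 * (n + 1)) + ‖e‖ ^ (2 * (n + 1))) := by
    calc _ ≤ (‖c‖ + ‖e‖) ^ (2 * (n + 1)) := by gcongr; exact norm_add_le c e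
      _ ≤ 2 ^ (2 * (n + 1)) * (‖c‖ ^ (2 * (n + 1)) + ‖e‖ ^ (2 * (n + 1))) :=
        add_pow_le_two_pow (norm_nonneg _) (norm_nonneg _) _
      _ ≤ _ := by gcongr; exact hcpow (2 * n + 1)
  have e4 := pow_mul_sq_le_pow_succ_mul_add hA hB (2 * n)
  calc ‖a‖ ^ (2 * (n + 1)) + 2 * (n + 1) * ‖a‖ ^ (2 * n) * inner ℝ a (c + e)
        + K * (‖a‖ ^ (2 * n) * ‖c + e‖ ^ 2 + ‖c + e‖ ^ (2 * (n + 1)))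
      ≤ ‖a‖ ^ (2 * (n + 1)) + 2 * (n + 1) * ‖a‖ ^ (2 * n) * (‖a‖ * (ε * B) + inner ℝ a e)
        + K * (‖a‖ ^ (2 * n) * (2 * (ε * B ^ 2 + ‖e‖ ^ 2))
          + 2 ^ (2 * (n + 1)) * (ε * B ^ (2 * (n + 1)) + ‖e‖ ^ (2 * (n + 1)))) := by gcongr
    _ = ‖a‖ ^ (2 * (n + 1)) + 2 * (n + 1) * ‖a‖ ^ (2 * n) * inner ℝ a e
        + ε * (2 * (n + 1) * (‖a‖ ^ (2 * n + 1) * B)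
          + K * (2 * (‖a‖ ^ (2 * n) * B ^ 2) + 2 ^ (2 * (n + 1)) * B ^ (2 * (n + 1))))
        + K * (2 * (‖a‖ ^ (2 * n) * ‖e‖ ^ 2) + 2 ^ (2 * (n + 1)) * ‖e‖ ^ (2 * (n + 1))) := by
      ring
    _ ≤ _ := by
      have ht : (0 : ℝ) ≤ 2 ^ (2 * (n + 1)) := by positivity
      rw [show 2 * n + 2 = 2 * (n + 1) by ring] at e4
      generalize (2 : ℝ) ^ (2 * (n + 1)) = t at *
      have w1 : 0 ≤ ‖a‖ ^ (2 * n + 1) * B := by positivity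
      have w2 : 0 ≤ ‖a‖ ^ (2 * n) * ‖e‖ ^ 2 := by positivity
      have w3 : 0 ≤ ‖e‖ ^ (2 * (n + 1)) := by positivity
      have w4 : 0 ≤ B ^ (2 * (n + 1)) := by positivity
      generalize ‖a‖ ^ (2 * n + 1) * B = x1 at *
      generalize ‖a‖ ^ (2 * n) * ‖e‖ ^ 2 = x2 at *
      generalize ‖e‖ ^ (2 * (n + 1)) = x3 at *
      generalize B ^ (2 * (n + 1)) = x4 at *
      have hN : (0 : ℝ) ≤ 2 * (n + 1) := by positivity
      generalize (2 : ℝ) * (n + 1) = N at *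
      have y1 : N * x1 + K * (2 * (‖a‖ ^ (2 * n) * B ^ 2) + t * x4) ≤
          (N + K * (2 + t)) * (x1 + x4) := by
        calc _ ≤ N * x1 + K * (2 * (x1 + x4) + t * x4) := by gcongr
          _ ≤ N * x1 + K * (2 * (x1 + x4) + t * x4) + (N * x4 + K * t * x1) :=
            le_add_of_nonneg_right (by positivity)
          _ = _ := by ring
      have y2 : K * (2 * x2 + t * x3) ≤ (N + K * (2 + t)) * (x2 + x3) := by
        calc _ ≤ K * (2 * x2 + t * x3) + (N * (x2 + x3) + K * (t * x2 + 2 * x3)) :=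
            le_add_of_nonneg_right (by positivity)
          _ = _ := by ring
      gcongr

/-- The part linear in `e` cancels between the two signs. Hence a fluctuation `e` of size √ε, like a
drift `c` of size ε, changes the sum only by O(ε). -/
theorem exists_norm_pow_add_sub_le (n : ℕ) : ∃ K : ℝ, 0 ≤ K ∧ ∀ (ε B : ℝ) (a c e : E),
    0 ≤ ε → ε ≤ 1 → 0 ≤ B → ‖c‖ ≤ ε * B → ‖e‖ ^ 2 ≤ ε * B ^ 2 →
    ‖a + c + e‖ ^ (2 * (n + 1)) + ‖a + c - e‖ ^ (2 * (n + 1)) ≤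
      2 * (‖a‖ ^ (2 * (n + 1)) + ε * (K * (‖a‖ ^ (2 * (n + 1)) + B ^ (2 * (n + 1))))) := by
  obtain ⟨K, hK, h⟩ := exists_norm_add_add_pow_le (E := E) n
  refine ⟨4 * K, by positivity, fun ε B a c e hε hε1 hB hc he ↦ ?_⟩
  have h1 := h ε B a c e hε hε1 hB hc
  have h2 := h ε B a c (-e) hε hε1 hB hc
  rw [inner_neg_right, norm_neg, ← sub_eq_add_neg] at h2
  have hA : 0 ≤ ‖a‖ := norm_nonneg a
  have e1 : ‖a‖ ^ (2 * n + 1) * B ≤ ‖a‖ ^ (2 * (n + 1)) + B ^ (2 * (n + 1)) := by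
    simpa [mul_add, add_assoc] using pow_mul_pow_le_add hA hB (2 * n + 1) 1
  have e2 : ‖a‖ ^ (2 * n) * ‖e‖ ^ 2 ≤ ε * (‖a‖ ^ (2 * (n + 1)) + B ^ (2 * (n + 1))) := by
    calc _ ≤ ‖a‖ ^ (2 * n) * (ε * B ^ 2) := by gcongr
      _ = ε * (‖a‖ ^ (2 * n) * B ^ 2) := by ring
      _ ≤ _ := by gcongr; exact pow_mul_pow_le_add hA hB (2 * n) 2
  have e3 : ‖e‖ ^ (2 * (n + 1)) ≤ ε * B ^ (2 * (n + 1)) := by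
    calc ‖e‖ ^ (2 * (n + 1)) = (‖e‖ ^ 2) ^ n * ‖e‖ ^ 2 := by ring
      _ ≤ (B ^ 2) ^ n * (ε * B ^ 2) := by
        gcongr ?_ ^ n * ?_
        exact he.trans (mul_le_of_le_one_left (by positivity) hε1)
      _ = _ := by ring
  have f1 := mul_le_mul_of_nonneg_left e1 (mul_nonneg hε hK)
  have f2 := mul_le_mul_of_nonneg_left e2 hK
  have f3 := mul_le_mul_of_nonneg_left e3 hK
  have f4 : 0 ≤ ε * K * ‖a‖ ^ (2 * (n + 1)) := by positivity
  linarith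

/-- Growth of an even moment under a random increment `c + e` with centered part `e`. -/
theorem exists_integral_norm_pow_le [CompleteSpace E] (n : ℕ) : ∃ K : ℝ, 0 ≤ K ∧
    ∀ {V : Type*} [MeasurableSpace V] (ν : Measure V) [IsProbabilityMeasure ν]
      (ε B : ℝ) (a c : E) (e : V → E),
    0 ≤ ε → ε ≤ 1 → 0 ≤ B → ‖c‖ ≤ ε * B → AEStronglyMeasurable e ν →
    Integrable (fun v ↦ ‖e v‖ ^ (2 * (n + 1))) ν → ∫ v, e v ∂ν = 0 →
    ∫ v, ‖e v‖ ^ 2 ∂ν ≤ ε * B ^ 2 →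
    ∫ v, ‖e v‖ ^ (2 * (n + 1)) ∂ν ≤ ε * B ^ (2 * (n + 1)) →
    Integrable (fun v ↦ ‖a + c + e v‖ ^ (2 * (n + 1))) ν ∧
    ∫ v, ‖a + c + e v‖ ^ (2 * (n + 1)) ∂ν ≤ ‖a‖ ^ (2 * (n + 1))
      + ε * (K * (‖a‖ ^ (2 * n + 1) * B + B ^ (2 * (n + 1)))) := by
  obtain ⟨K, hK, h⟩ := exists_norm_add_add_pow_le (E := E) n
  refine ⟨3 * K, by positivity,
    fun {V} _ ν _ ε B a c e hε hε1 hB hc hem hint h0 h2 h2n ↦ ?_⟩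
  have hA : 0 ≤ ‖a‖ := norm_nonneg a
  have i2 : Integrable (fun v ↦ ‖e v‖ ^ 2) ν := by
    refine ((integrable_const (1 : ℝ)).add hint).mono' (by fun_prop) (.of_forall fun v ↦ ?_)
    rw [Real.norm_of_nonneg (by positivity)]
    exact pow_le_one_add_pow (norm_nonneg _) (by omega)
  have i1 : Integrable e ν := by
    refine ((integrable_const (1 : ℝ)).add hint).mono' hem (.of_forall fun v ↦ ?_)
    simpa using pow_le_one_add_pow (norm_nonneg (e v)) (i := 1) (j := 2 * (n + 1)) (by omega)
  have iin : Integrable (fun v ↦ inner ℝ a (e v)) ν := i1.const_inner a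
  have hb : Integrable (fun v ↦ ‖a‖ ^ (2 * (n + 1))
      + 2 * (n + 1) * ‖a‖ ^ (2 * n) * inner ℝ a (e v)
      + ε * (K * (‖a‖ ^ (2 * n + 1) * B + B ^ (2 * (n + 1))))
      + K * (‖a‖ ^ (2 * n) * ‖e v‖ ^ 2 + ‖e v‖ ^ (2 * (n + 1)))) ν := by
    fun_prop
  have hp := fun v ↦ h ε B a c (e v) hε hε1 hB hc
  have hi : Integrable (fun v ↦ ‖a + c + e v‖ ^ (2 * (n + 1))) ν := by
    refine hb.mono' (by fun_prop) (.of_forall fun v ↦ ?_)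
    rw [Real.norm_of_nonneg (by positivity)]
    exact hp v
  refine ⟨hi, (integral_mono hi hb hp).trans ?_⟩
  rw [integral_add (by fun_prop) (by fun_prop), integral_add (by fun_prop) (by fun_prop),
    integral_add (by fun_prop) (by fun_prop)]
  simp only [integral_const_mul]
  -- The linear term integrates to zero because `e` is centered; this replaces the cancellation
  -- between two signs.
  rw [integral_add (f := fun v ↦ ‖a‖ ^ (2 * n) * ‖e v‖ ^ 2) (i2.const_mul _) hint,
    integral_const_mul, integral_inner i1, h0]
  simp only [integral_const, inner_zero_right, mul_zero, add_zero, probReal_univ, one_smul]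
  have e4 := pow_mul_sq_le_pow_succ_mul_add hA hB (2 * n)
  rw [show 2 * n + 2 = 2 * (n + 1) by ring] at e4
  have f1 := mul_le_mul_of_nonneg_left h2 (mul_nonneg hK (pow_nonneg hA (2 * n)))
  have f2 := mul_le_mul_of_nonneg_left h2n hK
  have f3 := mul_le_mul_of_nonneg_left e4 (mul_nonneg hε hK)
  have f4 : 0 ≤ ε * K * (‖a‖ ^ (2 * n + 1) * B) := by positivity
  linarith

end InnerProductSpace

/-! ### Derivatives along smooth curves -/

section Curve

variable {E F : Type*} [NormedAddCommGroup E] [NormedSpace ℝ E]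
  [NormedAddCommGroup F] [NormedSpace ℝ F]

theorem iteratedDeriv_succ_comp {f : E → F} {γ : ℝ → E} (hf : ContDiff ℝ (⊤ : ℕ∞) f)
    (hγ : ContDiff ℝ (⊤ : ℕ∞) γ) (n : ℕ) :
    iteratedDeriv (n + 1) (fun t ↦ f (γ t)) =
      iteratedDeriv n (fun t ↦ fderiv ℝ f (γ t) (deriv γ t)) := by
  rw [iteratedDeriv_succ']
  congr 1
  ext t
  exact fderiv_comp_deriv t (hf.differentiable (by simp)).differentiableAt
    (hγ.differentiable (by simp)).differentiableAt

theorem ContDiff.fderiv_top {f : E → F} (hf : ContDiff ℝ (⊤ : ℕ∞) f) :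
    ContDiff ℝ (⊤ : ℕ∞) (fderiv ℝ f) :=
  hf.fderiv_right (m := (⊤ : ℕ∞)) (by simp)

theorem ContDiff.deriv_top {γ : ℝ → E} (hγ : ContDiff ℝ (⊤ : ℕ∞) γ) :
    ContDiff ℝ (⊤ : ℕ∞) (deriv γ) := by
  have := hγ.iterate_deriv 1
  simpa using this

/-- After one differentiation the Leibniz rule applies to the product of `fderiv ℝ f ∘ γ` and `deriv
γ`. Using this recursively, with `fderiv ℝ f` in place of `f`, yields the chain rules of orders two
and three without Faà di Bruno's formula. -/
theorem norm_iteratedDeriv_succ_comp_le {f : E → F} {γ : ℝ → E} (hf : ContDiff ℝ (⊤ : ℕ∞) f)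
    (hγ : ContDiff ℝ (⊤ : ℕ∞) γ) (n : ℕ) (t : ℝ) :
    ‖iteratedDeriv (n + 1) (fun t ↦ f (γ t)) t‖ ≤ ∑ i ∈ Finset.range (n + 1),
      (n.choose i : ℝ) * ‖iteratedDeriv i (fun t ↦ fderiv ℝ f (γ t)) t‖
        * ‖iteratedDeriv (n - i + 1) γ t‖ := by
  rw [iteratedDeriv_succ_comp hf hγ]
  have h1 : ContDiff ℝ (⊤ : ℕ∞) (fun t ↦ fderiv ℝ f (γ t)) := hf.fderiv_top.comp hγ
  have h := norm_iteratedFDeriv_clm_apply (𝕜 := ℝ) h1 hγ.deriv_top t (n := n)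
    (by exact_mod_cast le_top)
  simpa only [norm_iteratedFDeriv_eq_norm_iteratedDeriv, ← iteratedDeriv_succ'] using h

theorem norm_iteratedDeriv_one_comp_le {f : E → F} {γ : ℝ → E} (hf : ContDiff ℝ (⊤ : ℕ∞) f)
    (hγ : ContDiff ℝ (⊤ : ℕ∞) γ) (t : ℝ) :
    ‖iteratedDeriv 1 (fun t ↦ f (γ t)) t‖ ≤
      ‖iteratedFDeriv ℝ 1 f (γ t)‖ * ‖iteratedDeriv 1 γ t‖ := by
  have h := norm_iteratedDeriv_succ_comp_le hf hγ 0 t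
  simpa [← norm_iteratedFDeriv_one] using h

theorem norm_iteratedDeriv_two_comp_le {f : E → F} {γ : ℝ → E} (hf : ContDiff ℝ (⊤ : ℕ∞) f)
    (hγ : ContDiff ℝ (⊤ : ℕ∞) γ) (t : ℝ) :
    ‖iteratedDeriv 2 (fun t ↦ f (γ t)) t‖ ≤
      ‖iteratedFDeriv ℝ 1 f (γ t)‖ * ‖iteratedDeriv 2 γ t‖ +
      ‖iteratedFDeriv ℝ 2 f (γ t)‖ * ‖iteratedDeriv 1 γ t‖ ^ 2 := by
  have h := norm_iteratedDeriv_succ_comp_le hf hγ 1 t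
  have h1 := norm_iteratedDeriv_one_comp_le hf.fderiv_top hγ t
  rw [norm_iteratedFDeriv_fderiv] at h1
  simp only [Finset.sum_range_succ, Finset.sum_range_zero, iteratedDeriv_zero] at h
  rw [norm_iteratedFDeriv_one]
  norm_num at h h1 ⊢
  refine h.trans ?_
  rw [pow_two, ← mul_assoc]
  gcongr

theorem norm_iteratedDeriv_three_comp_le {f : E → F} {γ : ℝ → E} (hf : ContDiff ℝ (⊤ : ℕ∞) f)
    (hγ : ContDiff ℝ (⊤ : ℕ∞) γ) (t : ℝ) :
    ‖iteratedDeriv 3 (fun t ↦ f (γ t)) t‖ ≤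
      ‖iteratedFDeriv ℝ 1 f (γ t)‖ * ‖iteratedDeriv 3 γ t‖ +
      3 * ‖iteratedFDeriv ℝ 2 f (γ t)‖ * ‖iteratedDeriv 1 γ t‖ * ‖iteratedDeriv 2 γ t‖ +
      ‖iteratedFDeriv ℝ 3 f (γ t)‖ * ‖iteratedDeriv 1 γ t‖ ^ 3 := by
  have h := norm_iteratedDeriv_succ_comp_le hf hγ 2 t
  have h1 := norm_iteratedDeriv_one_comp_le hf.fderiv_top hγ t
  have h2 := norm_iteratedDeriv_two_comp_le hf.fderiv_top hγ t
  rw [norm_iteratedFDeriv_fderiv] at h1 h2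
  rw [norm_iteratedFDeriv_fderiv] at h2
  simp only [Finset.sum_range_succ, Finset.sum_range_zero, iteratedDeriv_zero] at h
  rw [norm_iteratedFDeriv_one]
  norm_num [Nat.choose] at h ⊢
  refine h.trans ?_
  have e1 := mul_le_mul_of_nonneg_right h1 (norm_nonneg (iteratedDeriv 2 γ t))
  have e2 := mul_le_mul_of_nonneg_right h2 (norm_nonneg (iteratedDeriv 1 γ t))
  norm_num at e1 e2
  linarith

end Curve

/-! ### Propagation of derivative bounds under averaging operators -/

section Jet

variable {E : Type*} [NormedAddCommGroup E] [InnerProductSpace ℝ E]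

/-- A weight measuring the size of the third order jet of the curve `γ` at time `t`. -/
noncomputable def jetWeight (N : ℕ) (γ : ℝ → E) (t : ℝ) : ℝ :=
  1 + ‖γ t‖ ^ (2 * (N + 1)) + ‖iteratedDeriv 1 γ t‖ ^ 24 + ‖iteratedDeriv 2 γ t‖ ^ 6
    + ‖iteratedDeriv 3 γ t‖ ^ 2

/-- The function `u` is smooth, and its derivatives up to order three along every smooth curve are
controlled by the jet of the curve. -/
structure JetBound (N : ℕ) (M : ℝ) (u : E → ℝ) : Prop where
  smooth : ContDiff ℝ (⊤ : ℕ∞) u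
  bound : ∀ γ : ℝ → E, ContDiff ℝ (⊤ : ℕ∞) γ → ∀ t, ∀ j ≤ 3,
    |iteratedDeriv j (fun t ↦ u (γ t)) t| ≤ M * jetWeight N γ t

/-- A smooth vector field with bounded first derivative and second and third derivatives of
polynomial growth of order `k`. -/
structure RegularField (L : ℝ) (k : ℕ) (f : E → E) : Prop where
  smooth : ContDiff ℝ (⊤ : ℕ∞) f
  growth : ∀ x, ‖f x‖ ≤ L * (1 + ‖x‖)
  bound_one : ∀ x, ‖iteratedFDeriv ℝ 1 f x‖ ≤ L
  bound_two : ∀ x, ‖iteratedFDeriv ℝ 2 f x‖ ≤ L * (1 + ‖x‖ ^ k)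
  bound_three : ∀ x, ‖iteratedFDeriv ℝ 3 f x‖ ≤ L * (1 + ‖x‖ ^ k)

/-- The transition operator of the chain moving from `y` to `y - lr • b y ± τ • s i y`, with `i`
and the sign chosen uniformly at random. -/
noncomputable def signedStep {ι : Type*} [Fintype ι] (b : E → E) (s : ι → E → E) (lr τ : ℝ)
    (u : E → ℝ) (y : E) : ℝ :=
  (∑ i, (u (y - lr • b y + τ • s i y) + u (y - lr • b y - τ • s i y))) / (2 * Fintype.card ι)

theorem one_le_jetWeight (N : ℕ) (γ : ℝ → E) (t : ℝ) : 1 ≤ jetWeight N γ t := by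
  have : 0 ≤ ‖γ t‖ ^ (2 * (N + 1)) + ‖iteratedDeriv 1 γ t‖ ^ 24 + ‖iteratedDeriv 2 γ t‖ ^ 6
    + ‖iteratedDeriv 3 γ t‖ ^ 2 := by positivity
  unfold jetWeight
  linarith

/-- Bounds on the jet of the image of a curve under a regular vector field. -/
structure JetControl (B₀ B₁ B₂ B₃ : ℝ) (f : E → E) (γ : ℝ → E) (t : ℝ) : Prop where
  zero : ‖f (γ t)‖ ≤ B₀
  one : ‖iteratedDeriv 1 (fun t ↦ f (γ t)) t‖ ≤ B₁
  two : ‖iteratedDeriv 2 (fun t ↦ f (γ t)) t‖ ≤ B₂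
  three : ‖iteratedDeriv 3 (fun t ↦ f (γ t)) t‖ ≤ B₃

/-- This explains the exponents of `jetWeight`. Let G = 1 + X^k. The second derivative of an image
curve contains G P², and (G P²)^6 is at most G^12 + P^24. The third contains G P Q and G P³, whose
squares are at most G^6 + P^6 + Q^6 and G^4 + P^12. The power G^12 fits under X^(2(N+1)) because 6k
≤ N+1. -/
theorem exists_pow_le_weight (L : ℝ) (hL : 0 ≤ L) (k N : ℕ) (hk : 6 * k ≤ N + 1) :
    ∃ C : ℝ, 0 ≤ C ∧ ∀ X P Q R : ℝ, 0 ≤ X → 0 ≤ P → 0 ≤ Q → 0 ≤ R →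
      (L * (1 + X)) ^ (2 * (N + 1)) ≤ C * (1 + X ^ (2 * (N + 1)) + P ^ 24 + Q ^ 6 + R ^ 2) ∧
      (L * P) ^ 24 ≤ C * (1 + X ^ (2 * (N + 1)) + P ^ 24 + Q ^ 6 + R ^ 2) ∧
      (L * Q + L * (1 + X ^ k) * P ^ 2) ^ 6 ≤
        C * (1 + X ^ (2 * (N + 1)) + P ^ 24 + Q ^ 6 + R ^ 2) ∧
      (L * R + 3 * (L * (1 + X ^ k)) * P * Q + L * (1 + X ^ k) * P ^ 3) ^ 2 ≤
        C * (1 + X ^ (2 * (N + 1)) + P ^ 24 + Q ^ 6 + R ^ 2) := by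
  refine ⟨L ^ (2 * (N + 1)) * 2 ^ (2 * (N + 1)) + L ^ 24 + L ^ 6 * 2 ^ 20 + L ^ 2 * 2 ^ 20,
    by positivity, fun X P Q R hX hP hQ hR ↦ ?_⟩
  have hW1 : 0 ≤ X ^ (2 * (N + 1)) := by positivity
  have hW2 : 0 ≤ P ^ 24 := by positivity
  have hW3 : 0 ≤ Q ^ 6 := by positivity
  have hW4 : 0 ≤ R ^ 2 := by positivity
  have hG : (1 + X ^ k) ^ 12 ≤ 2 ^ 12 * (2 + X ^ (2 * (N + 1))) := by
    calc (1 + X ^ k) ^ 12 ≤ 2 ^ 12 * (1 ^ 12 + (X ^ k) ^ 12) :=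
          add_pow_le_two_pow zero_le_one (by positivity) 12
      _ = 2 ^ 12 * (1 + X ^ (k * 12)) := by rw [← pow_mul, one_pow]
      _ ≤ 2 ^ 12 * (1 + (1 + X ^ (2 * (N + 1)))) := by
        gcongr; exact pow_le_one_add_pow hX (by omega)
      _ = _ := by ring
  have hG1 : 1 ≤ 1 + X ^ k := le_add_of_nonneg_right (by positivity)
  have hX1 : (1 + X) ^ (2 * (N + 1)) ≤ 2 ^ (2 * (N + 1)) * (1 + X ^ (2 * (N + 1))) := by
    simpa using add_pow_le_two_pow zero_le_one hX (2 * (N + 1))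
  generalize X ^ (2 * (N + 1)) = x at *
  generalize 1 + X ^ k = G at *
  have hG6 : G ^ 6 ≤ G ^ 12 := pow_le_pow_right₀ hG1 (by norm_num)
  have hG4 : G ^ 4 ≤ G ^ 12 := pow_le_pow_right₀ hG1 (by norm_num)
  have hP6 : P ^ 6 ≤ 1 + P ^ 24 := pow_le_one_add_pow hP (by norm_num)
  have hP12 : P ^ 12 ≤ 1 + P ^ 24 := pow_le_one_add_pow hP (by norm_num)
  set W := 1 + x + P ^ 24 + Q ^ 6 + R ^ 2 with hW
  have hW0 : 0 ≤ W := by positivity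
  have c1 : (1 + X) ^ (2 * (N + 1)) ≤ 2 ^ (2 * (N + 1)) * W :=
    hX1.trans (by gcongr; linarith)
  have c3 : (Q + G * P ^ 2) ^ 6 ≤ 2 ^ 20 * W := by
    calc (Q + G * P ^ 2) ^ 6 ≤ 2 ^ 6 * (Q ^ 6 + (G * P ^ 2) ^ 6) :=
          add_pow_le_two_pow hQ (by positivity) 6
      _ = 2 ^ 6 * (Q ^ 6 + G ^ 6 * P ^ 12) := by ring
      _ ≤ 2 ^ 6 * (Q ^ 6 + (G ^ 12 + P ^ 24)) := by
        gcongr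
        nlinarith [sq_nonneg (G ^ 6 - P ^ 12), sq_nonneg (G ^ 6), sq_nonneg (P ^ 12)]
      _ ≤ 2 ^ 20 * W := by linarith
  have c4 : (R + 3 * G * P * Q + G * P ^ 3) ^ 2 ≤ 2 ^ 20 * W := by
    have a1 : (G * P * Q) ^ 2 ≤ G ^ 6 + P ^ 6 + Q ^ 6 := by
      have h1 : (G * P * Q) ^ 2 = G ^ 2 * P ^ 2 * Q ^ 2 := by ring
      have h2 : ∀ a b c : ℝ, 0 ≤ a → 0 ≤ b → 0 ≤ c → a * b * c ≤ a ^ 3 + b ^ 3 + c ^ 3 := by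
        intro a b c ha hb hc
        nlinarith [mul_nonneg ha (sq_nonneg (b - c)), mul_nonneg hb (sq_nonneg (a - c)),
          mul_nonneg hc (sq_nonneg (a - b)), mul_nonneg (add_nonneg ha hb) (sq_nonneg (a - b)),
          mul_nonneg (add_nonneg ha hc) (sq_nonneg (a - c)),
          mul_nonneg (add_nonneg hb hc) (sq_nonneg (b - c)), pow_nonneg ha 3, pow_nonneg hb 3,
          pow_nonneg hc 3]
      have h3 := h2 (G ^ 2) (P ^ 2) (Q ^ 2) (by positivity) (by positivity) (by positivity)
      rw [h1]
      calc _ ≤ _ := h3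
        _ = _ := by ring
    have a2 : (G * P ^ 3) ^ 2 ≤ G ^ 4 + P ^ 12 := by
      have h1 : (G * P ^ 3) ^ 2 = G ^ 2 * P ^ 6 := by ring
      rw [h1]
      nlinarith [sq_nonneg (G ^ 2 - P ^ 6), sq_nonneg (G ^ 2), sq_nonneg (P ^ 6)]
    have a3 : (R + 3 * G * P * Q + G * P ^ 3) ^ 2 ≤
        3 * (R ^ 2 + 9 * (G * P * Q) ^ 2 + (G * P ^ 3) ^ 2) := by
      nlinarith [sq_nonneg (R - 3 * (G * P * Q)), sq_nonneg (R - G * P ^ 3),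
        sq_nonneg (3 * (G * P * Q) - G * P ^ 3)]
    linarith
  have b1 : 0 ≤ L ^ (2 * (N + 1)) * 2 ^ (2 * (N + 1)) * W := by positivity
  have b2 : 0 ≤ L ^ 24 * W := by positivity
  have b3 : 0 ≤ L ^ 6 * 2 ^ 20 * W := by positivity
  have b4 : 0 ≤ L ^ 2 * 2 ^ 20 * W := by positivity
  refine ⟨?_, ?_, ?_, ?_⟩
  · rw [mul_pow]
    have := mul_le_mul_of_nonneg_left c1 (by positivity : 0 ≤ L ^ (2 * (N + 1)))
    linarith
  · rw [mul_pow]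
    have := mul_le_mul_of_nonneg_left (by linarith : P ^ 24 ≤ W) (by positivity : 0 ≤ L ^ 24)
    linarith
  · have := mul_le_mul_of_nonneg_left c3 (by positivity : 0 ≤ L ^ 6)
    rw [← mul_pow] at this
    have e : L * Q + L * G * P ^ 2 = L * (Q + G * P ^ 2) := by ring
    rw [e]
    linarith
  · have := mul_le_mul_of_nonneg_left c4 (by positivity : 0 ≤ L ^ 2)
    rw [← mul_pow] at this
    have e : L * R + 3 * (L * G) * P * Q + L * G * P ^ 3 =
      L * (R + 3 * G * P * Q + G * P ^ 3) := by ring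
    rw [e]
    linarith

theorem RegularField.jetControl {L : ℝ} {k : ℕ} {f : E → E} (hf : RegularField L k f)
    {γ : ℝ → E} (hγ : ContDiff ℝ (⊤ : ℕ∞) γ) (t : ℝ) :
    JetControl (L * (1 + ‖γ t‖)) (L * ‖iteratedDeriv 1 γ t‖)
      (L * ‖iteratedDeriv 2 γ t‖ + L * (1 + ‖γ t‖ ^ k) * ‖iteratedDeriv 1 γ t‖ ^ 2)
      (L * ‖iteratedDeriv 3 γ t‖
        + 3 * (L * (1 + ‖γ t‖ ^ k)) * ‖iteratedDeriv 1 γ t‖ * ‖iteratedDeriv 2 γ t‖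
        + L * (1 + ‖γ t‖ ^ k) * ‖iteratedDeriv 1 γ t‖ ^ 3) f γ t where
  zero := hf.growth _
  one := (norm_iteratedDeriv_one_comp_le hf.smooth hγ t).trans (by gcongr; exact hf.bound_one _)
  two := (norm_iteratedDeriv_two_comp_le hf.smooth hγ t).trans
    (by gcongr; exacts [hf.bound_one _, hf.bound_two _])
  three := (norm_iteratedDeriv_three_comp_le hf.smooth hγ t).trans
    (by gcongr; exacts [hf.bound_one _, hf.bound_two _, hf.bound_three _])

theorem iteratedDeriv_step {b s γ : ℝ → E} (hγ : ContDiff ℝ (⊤ : ℕ∞) γ)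
    (hb : ContDiff ℝ (⊤ : ℕ∞) b) (hs : ContDiff ℝ (⊤ : ℕ∞) s) (lr τ : ℝ) (n : ℕ) (t : ℝ) :
    iteratedDeriv n (fun t ↦ γ t - lr • b t + τ • s t) t =
      iteratedDeriv n γ t + -(lr • iteratedDeriv n b t) + τ • iteratedDeriv n s t := by
  have hn : (n : WithTop ℕ∞) ≤ ((⊤ : ℕ∞) : WithTop ℕ∞) := by exact_mod_cast le_top
  have h1 := (hγ.of_le hn).contDiffAt (x := t)
  have h2 := (hb.of_le hn).contDiffAt (x := t)
  have h3 := (hs.of_le hn).contDiffAt (x := t)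
  have e : (fun t ↦ γ t - lr • b t + τ • s t) = (γ - lr • b) + τ • s := rfl
  have h4 : ContDiffAt ℝ n (lr • b) t := h2.const_smul lr
  have h5 : ContDiffAt ℝ n (τ • s) t := h3.const_smul τ
  have h6 : ContDiffAt ℝ n (γ - lr • b) t := h1.sub h4
  rw [e, iteratedDeriv_add h6 h5, iteratedDeriv_sub h1 h4, iteratedDeriv_const_smul h2,
    iteratedDeriv_const_smul h3, sub_eq_add_neg]

/-- The jet weight grows at most by a factor `1 + C η` under one symmetric step. -/
theorem exists_jetWeight_step_le (L Λ : ℝ) (hL : 0 ≤ L) (hΛ : 0 ≤ Λ) (k N : ℕ)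
    (hk : 6 * k ≤ N + 1) : ∃ C : ℝ, 0 ≤ C ∧ ∀ (b s : E → E) (η lr τ : ℝ),
    RegularField L k b → RegularField L k s → 0 ≤ η → η ≤ 1 → |lr| ≤ Λ * η →
    τ ^ 2 ≤ Λ ^ 2 * η → ∀ γ : ℝ → E, ContDiff ℝ (⊤ : ℕ∞) γ → ∀ t,
      jetWeight N (fun t ↦ γ t - lr • b (γ t) + τ • s (γ t)) t +
        jetWeight N (fun t ↦ γ t - lr • b (γ t) - τ • s (γ t)) t ≤
      2 * ((1 + C * η) * jetWeight N γ t) := by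
  obtain ⟨C, hC, hCW⟩ := exists_pow_le_weight (Λ * L) (by positivity) k N hk
  -- The four exponents 2(N+1), 24, 6, 2 of the weight are 2(n+1) with n = N, 11, 2, 0.
  obtain ⟨K₀, hK₀, h₀⟩ := exists_norm_pow_add_sub_le (E := E) N
  obtain ⟨K₁, hK₁, h₁⟩ := exists_norm_pow_add_sub_le (E := E) 11
  obtain ⟨K₂, hK₂, h₂⟩ := exists_norm_pow_add_sub_le (E := E) 2
  obtain ⟨K₃, hK₃, h₃⟩ := exists_norm_pow_add_sub_le (E := E) 0
  refine ⟨(K₀ + K₁ + K₂ + K₃) * (1 + C), by positivity,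
    fun b s η lr τ hb hs hη hη1 hlr hτ γ hγ t ↦ ?_⟩
  have hbγ := hb.smooth.comp hγ
  have hsγ := hs.smooth.comp hγ
  have e1 : ∀ n, iteratedDeriv n (fun t ↦ γ t - lr • b (γ t) + τ • s (γ t)) t = _ :=
    fun n ↦ iteratedDeriv_step hγ hbγ hsγ lr τ n t
  have e2 : ∀ n, iteratedDeriv n (fun t ↦ γ t - lr • b (γ t) - τ • s (γ t)) t =
      iteratedDeriv n γ t + -(lr • iteratedDeriv n (fun t ↦ b (γ t)) t)
        - τ • iteratedDeriv n (fun t ↦ s (γ t)) t := fun n ↦ by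
    have := iteratedDeriv_step hγ hbγ hsγ lr (-τ) n t
    simpa only [neg_smul, ← sub_eq_add_neg, Function.comp_def] using this
  have cb := hb.jetControl hγ t
  have cs := hs.jetControl hγ t
  have hc : ∀ (v : E) (B : ℝ), ‖v‖ ≤ B → ‖-(lr • v)‖ ≤ η * (Λ * B) := fun v B hv ↦ by
    rw [norm_neg, norm_smul, Real.norm_eq_abs]
    calc |lr| * ‖v‖ ≤ Λ * η * B := by gcongr
      _ = _ := by ring
  have he : ∀ (v : E) (B : ℝ), ‖v‖ ≤ B → ‖τ • v‖ ^ 2 ≤ η * (Λ * B) ^ 2 := fun v B hv ↦ by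
    rw [norm_smul, mul_pow, Real.norm_eq_abs, sq_abs]
    calc τ ^ 2 * ‖v‖ ^ 2 ≤ Λ ^ 2 * η * B ^ 2 := by gcongr
      _ = _ := by ring
  obtain ⟨w0, w1, w2, w3⟩ := hCW ‖γ t‖ ‖iteratedDeriv 1 γ t‖ ‖iteratedDeriv 2 γ t‖
    ‖iteratedDeriv 3 γ t‖ (norm_nonneg _) (norm_nonneg _) (norm_nonneg _) (norm_nonneg _)
  have g0 := h₀ η _ (γ t) _ _ hη hη1 (mul_nonneg hΛ ((norm_nonneg _).trans cb.zero))
    (hc _ _ cb.zero) (he _ _ cs.zero)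
  have g1 := h₁ η _ (iteratedDeriv 1 γ t) _ _ hη hη1 (mul_nonneg hΛ ((norm_nonneg _).trans cb.one))
    (hc _ _ cb.one) (he _ _ cs.one)
  have g2 := h₂ η _ (iteratedDeriv 2 γ t) _ _ hη hη1 (mul_nonneg hΛ ((norm_nonneg _).trans cb.two))
    (hc _ _ cb.two) (he _ _ cs.two)
  have g3 := h₃ η _ (iteratedDeriv 3 γ t) _ _ hη hη1
    (mul_nonneg hΛ ((norm_nonneg _).trans cb.three)) (hc _ _ cb.three) (he _ _ cs.three)
  simp only [jetWeight, e1, e2]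
  simp only [Function.comp_def]
  rw [← sub_eq_add_neg] at g0
  norm_num only at g1 g2 g3
  have f0 : (Λ * (L * (1 + ‖γ t‖))) ^ (2 * (N + 1)) ≤ C * jetWeight N γ t := by
    rw [← mul_assoc]; exact w0
  have f1 : (Λ * (L * ‖iteratedDeriv 1 γ t‖)) ^ 24 ≤ C * jetWeight N γ t := by
    rw [← mul_assoc]; exact w1
  have f2 : (Λ * (L * ‖iteratedDeriv 2 γ t‖
      + L * (1 + ‖γ t‖ ^ k) * ‖iteratedDeriv 1 γ t‖ ^ 2)) ^ 6 ≤ C * jetWeight N γ t := by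
    refine le_of_eq_of_le ?_ w2
    ring
  have f3 : (Λ * (L * ‖iteratedDeriv 3 γ t‖
        + 3 * (L * (1 + ‖γ t‖ ^ k)) * ‖iteratedDeriv 1 γ t‖ * ‖iteratedDeriv 2 γ t‖
        + L * (1 + ‖γ t‖ ^ k) * ‖iteratedDeriv 1 γ t‖ ^ 3)) ^ 2 ≤ C * jetWeight N γ t := by
    refine le_of_eq_of_le ?_ w3
    ring
  have hW := one_le_jetWeight N γ t
  have k0 : ‖γ t‖ ^ (2 * (N + 1)) ≤ jetWeight N γ t := by
    unfold jetWeight; rw [← sub_nonneg]; ring_nf; positivity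
  have k1 : ‖iteratedDeriv 1 γ t‖ ^ 24 ≤ jetWeight N γ t := by
    unfold jetWeight; rw [← sub_nonneg]; ring_nf; positivity
  have k2 : ‖iteratedDeriv 2 γ t‖ ^ 6 ≤ jetWeight N γ t := by
    unfold jetWeight; rw [← sub_nonneg]; ring_nf; positivity
  have k3 : ‖iteratedDeriv 3 γ t‖ ^ 2 ≤ jetWeight N γ t := by
    unfold jetWeight; rw [← sub_nonneg]; ring_nf; positivity
  have m0 := mul_le_mul_of_nonneg_left (add_le_add k0 f0) (mul_nonneg hη hK₀)
  have m1 := mul_le_mul_of_nonneg_left (add_le_add k1 f1) (mul_nonneg hη hK₁)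
  have m2 := mul_le_mul_of_nonneg_left (add_le_add k2 f2) (mul_nonneg hη hK₂)
  have m3 := mul_le_mul_of_nonneg_left (add_le_add k3 f3) (mul_nonneg hη hK₃)
  have hdef : jetWeight N γ t = 1 + ‖γ t‖ ^ (2 * (N + 1)) + ‖iteratedDeriv 1 γ t‖ ^ 24
    + ‖iteratedDeriv 2 γ t‖ ^ 6 + ‖iteratedDeriv 3 γ t‖ ^ 2 := rfl
  simp only [← hdef]
  linarith

/-- Bounds on derivatives along curves are preserved by a symmetric averaging step, up to a factor
`1 + C η`. -/
theorem exists_jetBound_signedStep (L Λ : ℝ) (hL : 0 ≤ L) (hΛ : 0 ≤ Λ) (k N : ℕ)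
    (hk : 6 * k ≤ N + 1) : ∃ C : ℝ, 0 ≤ C ∧ ∀ {ι : Type*} [Fintype ι] [Nonempty ι]
    (b : E → E) (s : ι → E → E) (η lr τ M : ℝ) (u : E → ℝ),
    RegularField L k b → (∀ i, RegularField L k (s i)) → 0 ≤ η → η ≤ 1 → |lr| ≤ Λ * η →
    τ ^ 2 ≤ Λ ^ 2 * η → 0 ≤ M → JetBound N M u →
      JetBound N (M * (1 + C * η)) (signedStep b s lr τ u) := by
  obtain ⟨C, hC, h⟩ := exists_jetWeight_step_le (E := E) L Λ hL hΛ k N hk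
  refine ⟨C, hC, fun {ι} _ _ b s η lr τ M u hb hs hη hη1 hlr hτ hM hu ↦ ⟨?_, ?_⟩⟩
  · have hb' := hb.smooth
    have hs' := fun i ↦ (hs i).smooth
    have hu' := hu.smooth
    unfold signedStep
    fun_prop
  · intro γ hγ t j hj
    have hp : ∀ i, ContDiff ℝ (⊤ : ℕ∞) (fun t ↦ γ t - lr • b (γ t) + τ • s i (γ t)) := fun i ↦
      (hγ.sub ((hb.smooth.comp hγ).const_smul lr)).add (((hs i).smooth.comp hγ).const_smul τ)
    have hm : ∀ i, ContDiff ℝ (⊤ : ℕ∞) (fun t ↦ γ t - lr • b (γ t) - τ • s i (γ t)) := fun i ↦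
      (hγ.sub ((hb.smooth.comp hγ).const_smul lr)).sub (((hs i).smooth.comp hγ).const_smul τ)
    have hj' : (j : WithTop ℕ∞) ≤ ((⊤ : ℕ∞) : WithTop ℕ∞) := by exact_mod_cast le_top
    have hcard : (0 : ℝ) < 2 * Fintype.card ι := by positivity
    have up : ∀ i, ContDiffAt ℝ j (fun t ↦ u (γ t - lr • b (γ t) + τ • s i (γ t))) t :=
      fun i ↦ ((hu.smooth.comp (hp i)).of_le hj').contDiffAt (x := t)
    have um : ∀ i, ContDiffAt ℝ j (fun t ↦ u (γ t - lr • b (γ t) - τ • s i (γ t))) t :=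
      fun i ↦ ((hu.smooth.comp (hm i)).of_le hj').contDiffAt (x := t)
    have e : iteratedDeriv j (fun t ↦ signedStep b s lr τ u (γ t)) t =
        (∑ i, (iteratedDeriv j (fun t ↦ u (γ t - lr • b (γ t) + τ • s i (γ t))) t +
          iteratedDeriv j (fun t ↦ u (γ t - lr • b (γ t) - τ • s i (γ t))) t)) /
            (2 * Fintype.card ι) := by
      unfold signedStep
      rw [iteratedDeriv_div_const, iteratedDeriv_fun_sum fun i _ ↦ (up i).add (um i)]
      congr 1
      exact Finset.sum_congr rfl fun i _ ↦ iteratedDeriv_add (up i) (um i)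
    rw [e, abs_div, abs_of_pos hcard, div_le_iff₀ hcard]
    calc _ ≤ ∑ i : ι, M * (2 * ((1 + C * η) * jetWeight N γ t)) := by
          refine (Finset.abs_sum_le_sum_abs _ _).trans (Finset.sum_le_sum fun i _ ↦ ?_)
          refine (abs_add_le _ _).trans ?_
          refine (add_le_add (hu.bound _ (hp i) t j hj) (hu.bound _ (hm i) t j hj)).trans ?_
          rw [← mul_add]
          gcongr
          exact h b (s i) η lr τ hb (hs i) hη hη1 hlr hτ γ hγ t
      _ = _ := by
        rw [Finset.sum_const, Finset.card_univ, nsmul_eq_mul]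
        ring

end Jet

/-! ### Pointwise derivative bounds and Taylor expansion from bounds along curves -/

section JetConsequences

variable {E : Type*} [NormedAddCommGroup E] [InnerProductSpace ℝ E]

theorem iteratedDeriv_one_line {u : E → ℝ} (hu : ContDiff ℝ (⊤ : ℕ∞) u) (y e : E) (t : ℝ) :
    iteratedDeriv 1 (fun t : ℝ ↦ u (y + t • e)) t = fderiv ℝ u (y + t • e) e := by
  have hline : HasDerivAt (fun t : ℝ ↦ y + t • e) e t := by
    simpa using ((hasDerivAt_id t).smul_const e).const_add y
  rw [iteratedDeriv_one]
  exact ((hu.differentiable (by simp) _).hasFDerivAt.comp_hasDerivAt t hline).deriv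

theorem iteratedDeriv_two_line {u : E → ℝ} (hu : ContDiff ℝ (⊤ : ℕ∞) u) (y e : E) (t : ℝ) :
    iteratedDeriv 2 (fun t : ℝ ↦ u (y + t • e)) t =
      fderiv ℝ (fderiv ℝ u) (y + t • e) e e := by
  have hline : HasDerivAt (fun t : ℝ ↦ y + t • e) e t := by
    simpa using ((hasDerivAt_id t).smul_const e).const_add y
  have h1 : iteratedDeriv 1 (fun t : ℝ ↦ u (y + t • e)) =
      fun t ↦ fderiv ℝ u (y + t • e) e := funext fun t ↦ iteratedDeriv_one_line hu y e t
  rw [iteratedDeriv_succ, h1]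
  have h2 := (hu.fderiv_top.differentiable (by simp) (y + t • e)).hasFDerivAt.comp_hasDerivAt
    t hline
  exact (h2.clm_apply (hasDerivAt_const t e)).deriv.trans (by simp)

theorem ContDiff.fderiv_fderiv_comm {u : E → ℝ} (hu : ContDiff ℝ (⊤ : ℕ∞) u) (y v w : E) :
    fderiv ℝ (fderiv ℝ u) y v w = fderiv ℝ (fderiv ℝ u) y w v :=
  ((contDiff_infty.1 hu 2).contDiffAt.isSymmSndFDerivAt (by simp)).eq v w

theorem jetWeight_const (N : ℕ) (y : E) (t : ℝ) :
    jetWeight N (fun _ ↦ y) t = 1 + ‖y‖ ^ (2 * (N + 1)) := by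
  simp [jetWeight, iteratedDeriv_const]

theorem jetWeight_line (N : ℕ) (y : E) {e : E} (he : ‖e‖ = 1) (t : ℝ) :
    jetWeight N (fun t ↦ y + t • e) t = 2 + ‖y + t • e‖ ^ (2 * (N + 1)) := by
  have h1 : deriv (fun t : ℝ ↦ y + t • e) = fun _ ↦ e := by
    ext t
    have : HasDerivAt (fun t : ℝ ↦ y + t • e) e t := by
      simpa using ((hasDerivAt_id t).smul_const e).const_add y
    exact this.deriv
  have h2 : ∀ n, iteratedDeriv (n + 2) (fun t : ℝ ↦ y + t • e) t = 0 := fun n ↦ by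
    rw [iteratedDeriv_succ', h1, iteratedDeriv_const]
    simp
  rw [jetWeight, h2 0, h2 1, iteratedDeriv_one, h1, he]
  norm_num
  ring

theorem exists_eq_norm_smul_unit {v : E} (hv : v ≠ 0) : ∃ e : E, ‖e‖ = 1 ∧ v = ‖v‖ • e := by
  have : ‖v‖ ≠ 0 := norm_ne_zero_iff.2 hv
  exact ⟨‖v‖⁻¹ • v, by simp [norm_smul, this], by simp [smul_smul, this]⟩

namespace JetBound

variable {N : ℕ} {M : ℝ} {u : E → ℝ}

theorem abs_le (h : JetBound N M u) (y : E) : |u y| ≤ M * (1 + ‖y‖ ^ (2 * (N + 1))) := by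
  have := h.bound (fun _ ↦ y) contDiff_const 0 0 (by norm_num)
  simpa [jetWeight_const] using this

theorem abs_iteratedDeriv_line_le (h : JetBound N M u) (y : E) {e : E} (he : ‖e‖ = 1) (t : ℝ)
    {j : ℕ} (hj : j ≤ 3) : |iteratedDeriv j (fun t : ℝ ↦ u (y + t • e)) t| ≤
      M * (2 + ‖y + t • e‖ ^ (2 * (N + 1))) := by
  have := h.bound (fun t ↦ y + t • e) (by fun_prop) t j hj
  rwa [jetWeight_line N y he] at this

theorem nonneg (h : JetBound N M u) : 0 ≤ M := by
  have := (abs_nonneg _).trans (h.abs_le 0)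
  simpa using this

/-- The weight contains the 24th power of the velocity, so the bound along curves is not homogeneous
in `v`. It is applied to a line of unit speed, and the factor `‖v‖` is restored by linearity. -/
theorem abs_fderiv_le (h : JetBound N M u) (y v : E) :
    |fderiv ℝ u y v| ≤ 2 * M * (1 + ‖y‖ ^ (2 * (N + 1))) * ‖v‖ := by
  have hM := h.nonneg
  rcases eq_or_ne v 0 with rfl | hv
  · simp
  obtain ⟨e, he, hve⟩ := exists_eq_norm_smul_unit hv
  have h1 := h.abs_iteratedDeriv_line_le y he 0 (j := 1) (by norm_num)
  rw [iteratedDeriv_one_line h.smooth, zero_smul, add_zero] at h1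
  rw [hve, map_smul, smul_eq_mul, abs_mul, abs_norm, norm_smul, he, norm_norm, mul_one, mul_comm]
  gcongr
  refine h1.trans ?_
  nlinarith [mul_nonneg hM (pow_nonneg (norm_nonneg y) (2 * (N + 1)))]

theorem abs_fderiv_fderiv_le (h : JetBound N M u) (y v : E) :
    |fderiv ℝ (fderiv ℝ u) y v v| ≤ 2 * M * (1 + ‖y‖ ^ (2 * (N + 1))) * ‖v‖ ^ 2 := by
  have hM := h.nonneg
  rcases eq_or_ne v 0 with rfl | hv
  · simp
  obtain ⟨e, he, hve⟩ := exists_eq_norm_smul_unit hv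
  have h1 := h.abs_iteratedDeriv_line_le y he 0 (j := 2) (by norm_num)
  rw [iteratedDeriv_two_line h.smooth, zero_smul, add_zero] at h1
  have e1 : fderiv ℝ (fderiv ℝ u) y v v = ‖v‖ ^ 2 * fderiv ℝ (fderiv ℝ u) y e e := by
    conv_lhs => rw [hve]
    simp only [map_smul, smul_apply, smul_eq_mul]
    ring
  rw [e1, abs_mul, abs_of_nonneg (by positivity : 0 ≤ ‖v‖ ^ 2), mul_comm]
  gcongr
  refine h1.trans ?_
  nlinarith [mul_nonneg hM (pow_nonneg (norm_nonneg y) (2 * (N + 1)))]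

/-- Lines only see the diagonal of the second derivative; polarization with unit vectors, together
with the parallelogram law, recovers the off-diagonal values with the same constant. -/
theorem abs_fderiv_fderiv_apply_le (h : JetBound N M u) (y v w : E) :
    |fderiv ℝ (fderiv ℝ u) y v w| ≤ 2 * M * (1 + ‖y‖ ^ (2 * (N + 1))) * (‖v‖ * ‖w‖) := by
  rcases eq_or_ne v 0 with rfl | hv
  · simp
  rcases eq_or_ne w 0 with rfl | hw
  · simp
  obtain ⟨e, he, hve⟩ := exists_eq_norm_smul_unit hv
  obtain ⟨f, hf, hwf⟩ := exists_eq_norm_smul_unit hw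
  have e1 : fderiv ℝ (fderiv ℝ u) y v w = ‖v‖ * ‖w‖ * fderiv ℝ (fderiv ℝ u) y e f := by
    conv_lhs => rw [hve, hwf]
    simp only [map_smul, smul_apply, smul_eq_mul]
    ring
  have e2 : 4 * fderiv ℝ (fderiv ℝ u) y e f = fderiv ℝ (fderiv ℝ u) y (e + f) (e + f)
      - fderiv ℝ (fderiv ℝ u) y (e - f) (e - f) := by
    simp only [map_add, map_sub, add_apply, sub_apply]
    rw [h.smooth.fderiv_fderiv_comm y f e]
    ring
  have e3 := parallelogram_law_with_norm ℝ e f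
  rw [he, hf] at e3
  have h1 := _root_.abs_le.1 (h.abs_fderiv_fderiv_le y (e + f))
  have h2 := _root_.abs_le.1 (h.abs_fderiv_fderiv_le y (e - f))
  have e4 : 2 * M * (1 + ‖y‖ ^ (2 * (N + 1))) * ‖e + f‖ ^ 2
      + 2 * M * (1 + ‖y‖ ^ (2 * (N + 1))) * ‖e - f‖ ^ 2 =
      4 * (2 * M * (1 + ‖y‖ ^ (2 * (N + 1)))) := by
    rw [← mul_add, e3]; ring
  have h3 : |fderiv ℝ (fderiv ℝ u) y e f| ≤ 2 * M * (1 + ‖y‖ ^ (2 * (N + 1))) := by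
    rw [_root_.abs_le]
    constructor <;> linarith
  rw [e1, abs_mul, abs_of_nonneg (by positivity : 0 ≤ ‖v‖ * ‖w‖), mul_comm]
  gcongr

/-- For a symmetric form, B(v,v) - B(w,w) = B(v - w, v + w). This turns the Lipschitz bound on
Σ^{1/2} into closeness of the covariance terms. -/
theorem abs_fderiv_fderiv_sub_le (h : JetBound N M u) (y v w : E) :
    |fderiv ℝ (fderiv ℝ u) y v v - fderiv ℝ (fderiv ℝ u) y w w| ≤
      2 * M * (1 + ‖y‖ ^ (2 * (N + 1))) * (‖v - w‖ * ‖v + w‖) := by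
  have e : fderiv ℝ (fderiv ℝ u) y v v - fderiv ℝ (fderiv ℝ u) y w w =
      fderiv ℝ (fderiv ℝ u) y (v - w) (v + w) := by
    simp only [map_add, map_sub, sub_apply]
    rw [h.smooth.fderiv_fderiv_comm y w v]
    ring
  rw [e]
  exact h.abs_fderiv_fderiv_apply_le y _ _

/-- Second order Taylor expansion with a cubic remainder of polynomial growth. -/
theorem abs_taylor_le (h : JetBound N M u) (y v : E) :
    |u (y + v) - (u y + fderiv ℝ u y v + fderiv ℝ (fderiv ℝ u) y v v / 2)| ≤
      M * (2 + (‖y‖ + ‖v‖) ^ (2 * (N + 1))) * ‖v‖ ^ 3 := by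
  have hM := h.nonneg
  rcases eq_or_ne v 0 with rfl | hv
  · simp
  obtain ⟨e, he, hve⟩ := exists_eq_norm_smul_unit hv
  have hpos : 0 < ‖v‖ := norm_pos_iff.2 hv
  set r := ‖v‖ with hr
  set g : ℝ → ℝ := fun t ↦ u (y + t • e) with hg
  have hgs : ContDiff ℝ (⊤ : ℕ∞) g := h.smooth.comp (by fun_prop)
  obtain ⟨ξ, hξ, hT⟩ := taylor_mean_remainder_lagrange_iteratedDeriv (f := g) (n := 2) hpos.ne
    ((contDiff_infty.1 hgs 3).of_le (by norm_num)).contDiffOn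
  rw [Set.uIoo_of_lt hpos] at hξ
  have hu := uniqueDiffOn_Icc hpos
  have hw : ∀ n : ℕ, iteratedDerivWithin n g (Set.uIcc 0 r) 0 = iteratedDeriv n g 0 := fun n ↦ by
    rw [Set.uIcc_of_le hpos.le]
    exact iteratedDerivWithin_eq_iteratedDeriv hu
      (hgs.of_le (by exact_mod_cast le_top)).contDiffAt (Set.left_mem_Icc.2 hpos.le)
  rw [taylorWithinEval_succ, taylorWithinEval_succ, taylor_within_zero_eval, hw, hw] at hT
  have h1 : iteratedDeriv 1 g 0 = fderiv ℝ u y e := by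
    simpa using iteratedDeriv_one_line h.smooth y e 0
  have h2 : iteratedDeriv 2 g 0 = fderiv ℝ (fderiv ℝ u) y e e := by
    simpa using iteratedDeriv_two_line h.smooth y e 0
  norm_num [h1, h2] at hT
  have hb := h.abs_iteratedDeriv_line_le y he ξ (j := 3) le_rfl
  have e0 : g 0 = u y := by simp [hg]
  have er : g r = u (y + v) := by simp only [hg]; rw [← hve]
  have e1 : fderiv ℝ u y v = r * fderiv ℝ u y e := by
    conv_lhs => rw [hve]
    simp
  have e2 : fderiv ℝ (fderiv ℝ u) y v v = r ^ 2 * fderiv ℝ (fderiv ℝ u) y e e := by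
    conv_lhs => rw [hve]
    simp only [map_smul, smul_apply, smul_eq_mul]
    ring
  have e3 : u (y + v) - (u y + fderiv ℝ u y v + fderiv ℝ (fderiv ℝ u) y v v / 2) =
      iteratedDeriv 3 g ξ * r ^ 3 / 6 := by
    rw [e1, e2, ← er, ← e0]
    linarith
  have hn : ‖y + ξ • e‖ ≤ ‖y‖ + r := by
    refine (norm_add_le _ _).trans ?_
    rw [norm_smul, he, mul_one, Real.norm_of_nonneg hξ.1.le]
    gcongr
    exact hξ.2.le
  rw [e3, abs_div, abs_mul, abs_of_nonneg (by positivity : 0 ≤ r ^ 3)]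
  have h6 : |(6 : ℝ)| = 6 := by norm_num
  rw [h6]
  calc |iteratedDeriv 3 g ξ| * r ^ 3 / 6 ≤ |iteratedDeriv 3 g ξ| * r ^ 3 := by
        apply div_le_self (by positivity) (by norm_num)
    _ ≤ M * (2 + (‖y‖ + r) ^ (2 * (N + 1))) * r ^ 3 := by
      gcongr
      exact hb.trans (by gcongr)

end JetBound

end JetConsequences

/-! ### Weak error of one step -/

section OneStep

variable {E : Type*} [NormedAddCommGroup E] [InnerProductSpace ℝ E] [CompleteSpace E]
  [MeasurableSpace E] [BorelSpace E] [SecondCountableTopology E]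

/-- Weak second order Taylor expansion of one step of a stochastic gradient scheme. -/
theorem exists_abs_integral_step_sub_le (Λ : ℝ) (hΛ : 0 ≤ Λ) (N : ℕ) :
    ∃ K : ℝ, 0 ≤ K ∧ ∀ (ν : Measure E) [IsProbabilityMeasure ν] (b y : E) (lr σ r D M : ℝ)
      (u : E → ℝ), JetBound N M u → 0 ≤ r → r ≤ 1 → |lr| ≤ Λ * r ^ 2 → |lr * σ| ≤ Λ * r →
      ‖b‖ ≤ D → ∫ v, v ∂ν = 0 → Integrable (fun v ↦ ‖v‖ ^ (2 * (N + 3))) ν →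
      ∫ v, ‖v‖ ^ (2 * (N + 3)) ∂ν ≤ D ^ (2 * (N + 3)) →
      |∫ v, u (y - lr • (b + σ • v)) ∂ν - (u y - lr * fderiv ℝ u y b
        + (lr ^ 2 * fderiv ℝ (fderiv ℝ u) y b b
          + (lr * σ) ^ 2 * ∫ v, fderiv ℝ (fderiv ℝ u) y v v ∂ν) / 2)| ≤
        K * M * r ^ 3 * (1 + ‖y‖ + D) ^ (2 * (N + 3)) := by
  refine ⟨3 * Λ ^ 3 * (2 ^ (2 * (N + 3)) * (2 * (1 + Λ) ^ (2 * (N + 3)))), by positivity,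
    fun ν _ b y lr σ r D M u hu hr hr1 hlr hlrσ hb h0 hint hD ↦ ?_⟩
  have hM := hu.nonneg
  have hD0 : 0 ≤ D := (norm_nonneg _).trans hb
  have i1 : Integrable (fun v : E ↦ v) ν := by
    refine ((integrable_const (1 : ℝ)).add hint).mono' (by fun_prop) (.of_forall fun v ↦ ?_)
    simpa using pow_le_one_add_pow (norm_nonneg v) (i := 1) (j := 2 * (N + 3)) (by omega)
  have i2 : Integrable (fun v : E ↦ ‖v‖ ^ 2) ν := by
    refine ((integrable_const (1 : ℝ)).add hint).mono' (by fun_prop) (.of_forall fun v ↦ ?_)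
    rw [Real.norm_of_nonneg (by positivity)]
    exact pow_le_one_add_pow (norm_nonneg v) (by omega)
  have iB : Integrable (fun v : E ↦ fderiv ℝ (fderiv ℝ u) y v v) ν := by
    refine (i2.const_mul (2 * M * (1 + ‖y‖ ^ (2 * (N + 1))))).mono'
      (Continuous.aestronglyMeasurable (by fun_prop)) (.of_forall fun v ↦ ?_)
    exact hu.abs_fderiv_fderiv_le y v
  have iL : ∀ ℓ : E →L[ℝ] ℝ, Integrable (fun v : E ↦ ℓ v) ν := fun ℓ ↦ ℓ.integrable_comp i1
  have eL : ∀ ℓ : E →L[ℝ] ℝ, ∫ v, ℓ v ∂ν = 0 := fun ℓ ↦ by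
    rw [ContinuousLinearMap.integral_comp_comm _ i1, h0, map_zero]
  set R : E → ℝ := fun v ↦ 3 * M * Λ ^ 3 * r ^ 3 * (2 ^ (2 * (N + 3)) *
    ((1 + ‖y‖ + (1 + Λ) * D) ^ (2 * (N + 3)) + (1 + Λ) ^ (2 * (N + 3)) * ‖v‖ ^ (2 * (N + 3))))
    with hR
  -- The full second order Taylor polynomial. Its two terms linear in `v`, including the mixed term
  -- from the second derivative, have mean zero.
  set p : E → ℝ := fun v ↦ u y - lr * fderiv ℝ u y b - lr * σ * fderiv ℝ u y v
    + (lr ^ 2 * fderiv ℝ (fderiv ℝ u) y b b + 2 * (lr * (lr * σ)) * fderiv ℝ (fderiv ℝ u) y b v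
      + (lr * σ) ^ 2 * fderiv ℝ (fderiv ℝ u) y v v) / 2 with hp
  have iR : Integrable R ν := by
    simp only [hR]
    fun_prop
  have ip : Integrable p ν := by
    have a1 := iL (fderiv ℝ u y)
    have a2 := iL (fderiv ℝ (fderiv ℝ u) y b)
    simp only [hp]
    fun_prop
  have ep : ∫ v, p v ∂ν = u y - lr * fderiv ℝ u y b + (lr ^ 2 * fderiv ℝ (fderiv ℝ u) y b b
          + (lr * σ) ^ 2 * ∫ v, fderiv ℝ (fderiv ℝ u) y v v ∂ν) / 2 := by
    have a1 := iL (fderiv ℝ u y)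
    have a2 := iL (fderiv ℝ (fderiv ℝ u) y b)
    simp only [hp]
    rw [integral_add (by fun_prop) (by fun_prop), integral_sub (by fun_prop) (by fun_prop),
      integral_div, integral_add (by fun_prop) (by fun_prop),
      integral_add (by fun_prop) (by fun_prop), integral_const_mul, integral_const_mul,
      integral_const_mul, eL, eL]
    simp [integral_const_mul]
  have hpt : ∀ v, |u (y - lr • (b + σ • v)) - p v| ≤ R v := fun v ↦ by
    have hT := hu.abs_taylor_le y (-(lr • (b + σ • v)))
    have e1 : u y + fderiv ℝ u y (-(lr • (b + σ • v)))
        + fderiv ℝ (fderiv ℝ u) y (-(lr • (b + σ • v))) (-(lr • (b + σ • v))) / 2 = p v := by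
      simp only [hp, map_neg, map_smul, map_add, neg_apply, smul_apply, add_apply, smul_eq_mul]
      rw [hu.smooth.fderiv_fderiv_comm y v b]
      ring
    rw [e1, ← sub_eq_add_neg, norm_neg] at hT
    refine hT.trans ?_
    have hn : ‖lr • (b + σ • v)‖ ≤ Λ * r * (D + ‖v‖) := by
      rw [smul_add, smul_smul]
      refine (norm_add_le _ _).trans ?_
      rw [norm_smul, norm_smul, Real.norm_eq_abs, Real.norm_eq_abs, mul_add]
      have : Λ * r ^ 2 ≤ Λ * r := by
        gcongr
        nlinarith
      gcongr
      exact hlr.trans this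
    have hH1 : 1 ≤ 1 + ‖y‖ + (1 + Λ) * (D + ‖v‖) := by
      rw [add_assoc]
      exact le_add_of_nonneg_right (by positivity)
    have hn2 : ‖y‖ + ‖lr • (b + σ • v)‖ ≤ 1 + ‖y‖ + (1 + Λ) * (D + ‖v‖) := by
      have : Λ * r * (D + ‖v‖) ≤ (1 + Λ) * (D + ‖v‖) := by
        gcongr
        nlinarith
      linarith
    have hn3 : D + ‖v‖ ≤ 1 + ‖y‖ + (1 + Λ) * (D + ‖v‖) := by
      have : 0 ≤ Λ * (D + ‖v‖) := by positivity
      linarith [norm_nonneg y]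
    set H := 1 + ‖y‖ + (1 + Λ) * (D + ‖v‖) with hH
    have hH0 : 0 ≤ H := zero_le_one.trans hH1
    calc M * (2 + (‖y‖ + ‖lr • (b + σ • v)‖) ^ (2 * (N + 1))) * ‖lr • (b + σ • v)‖ ^ 3
        ≤ M * (2 * H ^ (2 * (N + 1)) + H ^ (2 * (N + 1))) * (Λ * r * H) ^ 3 := by
          have : (2 : ℝ) ≤ 2 * H ^ (2 * (N + 1)) := by
            linarith [one_le_pow₀ hH1 (n := 2 * (N + 1))]
          have : ‖lr • (b + σ • v)‖ ≤ Λ * r * H := hn.trans (by gcongr)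
          gcongr
      _ = 3 * M * Λ ^ 3 * r ^ 3 * H ^ (2 * N + 5) := by ring
      -- The growth of `u` gives the power 2N+2 and the cubic remainder three more; the sum is
      -- rounded up to an even number, since only even moments are controlled. This is the origin of
      -- `N + 3`.
      _ ≤ 3 * M * Λ ^ 3 * r ^ 3 * H ^ (2 * (N + 3)) := by
          gcongr ?_ * ?_
          exact pow_le_pow_right₀ hH1 (by omega)
      _ ≤ R v := by
          simp only [hR]
          gcongr ?_ * ?_
          have : H = (1 + ‖y‖ + (1 + Λ) * D) + (1 + Λ) * ‖v‖ := by rw [hH]; ring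
          rw [this, ← mul_pow]
          exact add_pow_le_two_pow (by positivity) (by positivity) _
  have iu : Integrable (fun v ↦ u (y - lr • (b + σ • v))) ν := by
    have hc := hu.smooth.continuous
    refine (ip.norm.add iR).mono' (Continuous.aestronglyMeasurable (by fun_prop))
      (.of_forall fun v ↦ ?_)
    have h1 := hpt v
    have h2 := abs_sub_abs_le_abs_sub (u (y - lr • (b + σ • v))) (p v)
    simp only [Pi.add_apply, Real.norm_eq_abs]
    linarith
  rw [← ep, ← integral_sub iu ip]
  refine (abs_integral_le_integral_abs).trans
    ((integral_mono (iu.sub ip).abs iR hpt).trans ?_)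
  simp only [hR]
  rw [integral_const_mul, integral_const_mul, integral_add (by fun_prop) (by fun_prop),
    integral_const_mul]
  simp only [integral_const, probReal_univ, one_smul]
  have f1 : (1 + ‖y‖ + (1 + Λ) * D) ^ (2 * (N + 3)) ≤
      (1 + Λ) ^ (2 * (N + 3)) * (1 + ‖y‖ + D) ^ (2 * (N + 3)) := by
    rw [← mul_pow]
    gcongr
    nlinarith [norm_nonneg y, mul_nonneg hΛ (norm_nonneg y)]
  have f2 : D ^ (2 * (N + 3)) ≤ (1 + ‖y‖ + D) ^ (2 * (N + 3)) := by
    gcongr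
    linarith [norm_nonneg y]
  calc _ ≤ 3 * M * Λ ^ 3 * r ^ 3 * (2 ^ (2 * (N + 3)) *
        ((1 + Λ) ^ (2 * (N + 3)) * (1 + ‖y‖ + D) ^ (2 * (N + 3)) +
          (1 + Λ) ^ (2 * (N + 3)) * (1 + ‖y‖ + D) ^ (2 * (N + 3)))) := by
        gcongr
        exact hD.trans f2
    _ = _ := by ring

/-- The uniform distribution on the vectors `± √(card ι) • a i`. -/
noncomputable def signedLaw {ι : Type*} [Fintype ι] (a : ι → E) : Measure E :=
  ((2 * Fintype.card ι : ℝ≥0∞))⁻¹ • ∑ i, (Measure.dirac (√(Fintype.card ι) • a i) +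
    Measure.dirac (-(√(Fintype.card ι) • a i)))

/-! ### Moments of the symmetric two-point law -/

section SignedLaw

variable {ι : Type*} [Fintype ι] (a : ι → E)

theorem integrable_signedLaw [Nonempty ι] (f : E → ℝ) : Integrable f (signedLaw a) := by
  unfold signedLaw
  refine Integrable.smul_measure ?_ (by simp)
  rw [integrable_finsetSum_measure]
  exact fun i _ ↦ (integrable_dirac (by simp)).add_measure (integrable_dirac (by simp))

theorem integral_signedLaw {F : Type*} [NormedAddCommGroup F] [NormedSpace ℝ F] [CompleteSpace F]
    (f : E → F) : ∫ v, f v ∂(signedLaw a) = (2 * Fintype.card ι : ℝ)⁻¹ •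
      ∑ i, (f (√(Fintype.card ι) • a i) + f (-(√(Fintype.card ι) • a i))) := by
  unfold signedLaw
  rw [integral_smul_measure, integral_finsetSum_measure
    (fun i _ ↦ (integrable_dirac (by simp)).add_measure (integrable_dirac (by simp)))]
  congr 1
  · simp
  · refine Finset.sum_congr rfl fun i _ ↦ ?_
    rw [integral_add_measure (integrable_dirac (by simp)) (integrable_dirac (by simp)),
      integral_dirac, integral_dirac]

instance [Nonempty ι] : IsProbabilityMeasure (signedLaw a) := by
  constructor
  have h1 : ((2 * Fintype.card ι : ℝ≥0∞)) ≠ 0 := by simp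
  have h2 : ((2 * Fintype.card ι : ℝ≥0∞)) ≠ ⊤ := by finiteness
  simp only [signedLaw, Measure.smul_apply, Measure.coe_finsetSum, Finset.sum_apply,
    Measure.add_apply, measure_univ, Finset.sum_const, Finset.card_univ, smul_eq_mul, nsmul_eq_mul]
  rw [one_add_one_eq_two, mul_comm (Fintype.card ι : ℝ≥0∞) 2]
  exact ENNReal.inv_mul_cancel h1 h2

theorem integral_id_signedLaw : ∫ v, v ∂(signedLaw a) = 0 := by
  rw [integral_signedLaw]
  simp

/-- The factor √(card ι) in the atoms compensates for choosing the direction uniformly, so the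
covariance is the plain sum of the `a i ⊗ a i`. -/
theorem integral_bilin_signedLaw [Nonempty ι] (B : E →L[ℝ] E →L[ℝ] ℝ) :
    ∫ v, B v v ∂(signedLaw a) = ∑ i, B (a i) (a i) := by
  have hc : (Fintype.card ι : ℝ) ≠ 0 := by simp
  have hs : √(Fintype.card ι : ℝ) * √(Fintype.card ι : ℝ) = Fintype.card ι :=
    Real.mul_self_sqrt (by positivity)
  rw [integral_signedLaw, smul_eq_mul, Finset.mul_sum]
  refine Finset.sum_congr rfl fun i _ ↦ ?_
  simp only [map_neg, map_smul, neg_apply, smul_apply, smul_eq_mul, mul_neg, neg_neg]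
  rw [← mul_assoc, hs]
  field_simp
  ring

theorem integral_norm_pow_signedLaw_le [Nonempty ι] {L : ℝ} (ha : ∀ i, ‖a i‖ ≤ L) (n : ℕ) :
    ∫ v, ‖v‖ ^ n ∂(signedLaw a) ≤ (√(Fintype.card ι) * L) ^ n := by
  have hc : (Fintype.card ι : ℝ) ≠ 0 := by simp
  rw [integral_signedLaw, smul_eq_mul]
  calc _ ≤ (2 * Fintype.card ι : ℝ)⁻¹ * ∑ i : ι, 2 * (√(Fintype.card ι) * L) ^ n := by
        gcongr with i
        rw [norm_neg, ← two_mul, norm_smul, Real.norm_of_nonneg (Real.sqrt_nonneg _)]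
        gcongr
        exact ha i
    _ = _ := by
      rw [Finset.sum_const, Finset.card_univ, nsmul_eq_mul]
      field_simp

theorem signedStep_eq_integral (b : E → E) (s : ι → E → E) (lr σ : ℝ) (u : E → ℝ) (y : E) :
    signedStep b s lr (lr * σ * √(Fintype.card ι)) u y =
      ∫ v, u (y - lr • (b y + σ • v)) ∂(signedLaw fun i ↦ s i y) := by
  rw [integral_signedLaw, signedStep, div_eq_inv_mul, smul_eq_mul]
  congr 1
  refine Finset.sum_congr rfl fun i _ ↦ ?_
  rw [add_comm]
  congr 2 <;> simp only [smul_add, smul_neg, smul_smul, mul_assoc] <;> abel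

end SignedLaw

end OneStep

section OneStep

variable {E : Type*} [NormedAddCommGroup E] [InnerProductSpace ℝ E]

theorem abs_sub_le_of_near_expansions {I J a₁ a₂ b₁ b₂ c e₁ e₂ q₁ q₂ q₃ q₄ q₅ : ℝ}
    (h₁ : |I - (c - a₁ + (b₁ + e₁) / 2)| ≤ q₁) (h₂ : |J - (c - a₂ + (b₂ + e₂) / 2)| ≤ q₂)
    (h₃ : |a₁ - a₂| ≤ q₃) (h₄ : |b₁| ≤ q₄) (h₅ : |b₂| ≤ q₄) (h₆ : |e₁ - e₂| ≤ q₅) :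
    |I - J| ≤ q₁ + q₂ + (q₃ + q₄ + q₅) := by
  rw [abs_le] at *
  constructor <;> linarith

/-- The drift and covariance terms are compared through the differences of size `δ`. The terms
quadratic in the drift already carry lr² = O(r⁴), so each is bounded separately. -/
theorem JetBound.abs_expansion_sub_le {ι : Type*} [Fintype ι] {N : ℕ} {M : ℝ} {u : E → ℝ}
    (hu : JetBound N M u) {b₁ b₂ y : E} {s₁ s₂ : ι → E} {lr σ r Λ δ D L I J c q₁ q₂ : ℝ}
    (hΛ : 0 ≤ Λ) (hδ : 0 ≤ δ) (hlr : |lr| ≤ Λ * r ^ 2) (hlrσ : |lr * σ| ≤ Λ * r)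
    (hb : ‖b₁ - b₂‖ ≤ δ) (hb₁ : ‖b₁‖ ≤ D) (hb₂ : ‖b₂‖ ≤ D) (hs : ∀ i, ‖s₁ i - s₂ i‖ ≤ δ)
    (hs₁ : ∀ i, ‖s₁ i‖ ≤ L) (hs₂ : ∀ i, ‖s₂ i‖ ≤ L)
    (hI : |I - (c - lr * fderiv ℝ u y b₁ + (lr ^ 2 * fderiv ℝ (fderiv ℝ u) y b₁ b₁
      + (lr * σ) ^ 2 * ∑ i, fderiv ℝ (fderiv ℝ u) y (s₁ i) (s₁ i)) / 2)| ≤ q₁)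
    (hJ : |J - (c - lr * fderiv ℝ u y b₂ + (lr ^ 2 * fderiv ℝ (fderiv ℝ u) y b₂ b₂
      + (lr * σ) ^ 2 * ∑ i, fderiv ℝ (fderiv ℝ u) y (s₂ i) (s₂ i)) / 2)| ≤ q₂) :
    |I - J| ≤ q₁ + q₂ + 2 * M * (1 + ‖y‖ ^ (2 * (N + 1))) * (Λ * r ^ 2 * δ
      + Λ ^ 2 * r ^ 4 * D ^ 2 + Λ ^ 2 * r ^ 2 * (Fintype.card ι * (δ * (L + L)))) := by
  have hM := hu.nonneg
  set W := 2 * M * (1 + ‖y‖ ^ (2 * (N + 1))) with hW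
  have hW0 : 0 ≤ W := by positivity
  have c1 : |lr * fderiv ℝ u y b₁ - lr * fderiv ℝ u y b₂| ≤ Λ * r ^ 2 * (W * δ) := by
    rw [← mul_sub, abs_mul, ← map_sub]
    gcongr
    exact (hu.abs_fderiv_le y _).trans (by gcongr)
  have hlr2 : lr ^ 2 ≤ Λ ^ 2 * r ^ 4 := by
    rw [← sq_abs]
    calc |lr| ^ 2 ≤ (Λ * r ^ 2) ^ 2 := by gcongr
      _ = _ := by ring
  have hlrσ2 : (lr * σ) ^ 2 ≤ Λ ^ 2 * r ^ 2 := by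
    rw [← sq_abs, ← mul_pow]
    gcongr
  have c2 : ∀ b : E, ‖b‖ ≤ D → |lr ^ 2 * fderiv ℝ (fderiv ℝ u) y b b| ≤
      Λ ^ 2 * r ^ 4 * (W * D ^ 2) := fun b hb ↦ by
    rw [abs_mul, abs_of_nonneg (sq_nonneg lr)]
    gcongr
    exact (hu.abs_fderiv_fderiv_le y _).trans (by gcongr)
  have c4 : |(lr * σ) ^ 2 * ∑ i, fderiv ℝ (fderiv ℝ u) y (s₁ i) (s₁ i)
      - (lr * σ) ^ 2 * ∑ i, fderiv ℝ (fderiv ℝ u) y (s₂ i) (s₂ i)| ≤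
      Λ ^ 2 * r ^ 2 * (Fintype.card ι * (W * (δ * (L + L)))) := by
    rw [← mul_sub, abs_mul, abs_of_nonneg (sq_nonneg (lr * σ)), ← Finset.sum_sub_distrib]
    gcongr
    refine (Finset.abs_sum_le_sum_abs _ _).trans ?_
    calc _ ≤ ∑ i : ι, W * (δ * (L + L)) := by
          refine Finset.sum_le_sum fun i _ ↦ (hu.abs_fderiv_fderiv_sub_le y _ _).trans ?_
          gcongr
          · exact hs i
          · exact (norm_add_le _ _).trans (add_le_add (hs₁ i) (hs₂ i))
      _ = _ := by rw [Finset.sum_const, Finset.card_univ, nsmul_eq_mul]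
  refine (abs_sub_le_of_near_expansions hI hJ c1 (c2 _ hb₁) (c2 _ hb₂) c4).trans (le_of_eq ?_)
  ring

variable [CompleteSpace E] [MeasurableSpace E] [BorelSpace E] [SecondCountableTopology E]

/-- Weak error of one step in which the gradient is queried at a point `x` near `y`, compared with
the symmetric two-point scheme with matching first two moments. -/
theorem exists_abs_integral_step_sub_signedStep_le (L Λ A κ : ℝ) (hL : 0 ≤ L) (hΛ : 0 ≤ Λ)
    (hA : 0 ≤ A) (hκ : 0 ≤ κ) (N m : ℕ) : ∃ K : ℝ, 0 ≤ K ∧ ∀ {ι : Type*} [Fintype ι] [Nonempty ι]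
      (b : E → E) (s : ι → E → E), Fintype.card ι ≤ m →
      (∀ x, ‖b x‖ ≤ L * (1 + ‖x‖)) → (∀ x y, ‖b x - b y‖ ≤ L * ‖x - y‖) →
      (∀ i x, ‖s i x‖ ≤ L) → (∀ i x y, ‖s i x - s i y‖ ≤ L * ‖x - y‖) →
      ∀ (ν : Measure E) [IsProbabilityMeasure ν] (x y n : E) (lr σ r ρ M : ℝ) (u : E → ℝ),
      JetBound N M u → 0 ≤ r → r ≤ ρ → ρ ≤ 1 → |lr| ≤ Λ * r ^ 2 → |lr * σ| ≤ Λ * r →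
      ‖x - y‖ ≤ κ * (ρ * ‖n‖) → ∫ v, v ∂ν = 0 →
      (∀ B : E →L[ℝ] E →L[ℝ] ℝ, ∫ v, B v v ∂ν = ∑ i, B (s i x) (s i x)) →
      Integrable (fun v ↦ ‖v‖ ^ (2 * (N + 3))) ν →
      ∫ v, ‖v‖ ^ (2 * (N + 3)) ∂ν ≤ (A * (1 + ‖x‖)) ^ (2 * (N + 3)) →
      |∫ v, u (y - lr • (b x + σ • v)) ∂ν
        - signedStep b s lr (lr * σ * √(Fintype.card ι)) u y| ≤
        K * M * r ^ 2 * ρ * (1 + ‖y‖ + ‖n‖) ^ (2 * (N + 3)) := by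
  obtain ⟨K, hK, h⟩ := exists_abs_integral_step_sub_le (E := E) Λ hΛ N
  refine ⟨K * (2 + κ + (L + A) * (1 + κ)) ^ (2 * (N + 3)) + K * (2 + (L + √m * L)) ^ (2 * (N + 3))
    + (Λ * (4 * (L * κ)) + Λ ^ 2 * (4 * (L * (1 + κ)) ^ 2)
      + Λ ^ 2 * (m * (4 * (2 * L ^ 2 * κ)))), by positivity, ?_⟩
  intro ι _ _ b s hm hb hbL hs hsL ν _ x y n lr σ r ρ M u hu hr hrρ hρ hlr hlrσ hxy h0 hB hint hA'
  generalize hT₁ : (2 + κ + (L + A) * (1 + κ)) ^ (2 * (N + 3)) = T₁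
  generalize hT₂ : (2 + (L + √m * L)) ^ (2 * (N + 3)) = T₂
  have hT₁0 : 0 ≤ T₁ := by rw [← hT₁]; positivity
  have hT₂0 : 0 ≤ T₂ := by rw [← hT₂]; positivity
  have hM := hu.nonneg
  have hr1 := hrρ.trans hρ
  have hρ0 := hr.trans hrρ
  set Z := 1 + ‖y‖ + ‖n‖ with hZ
  have hZ1 : 1 ≤ Z := by rw [hZ, add_assoc]; exact le_add_of_nonneg_right (by positivity)
  have hZ0 : 0 ≤ Z := zero_le_one.trans hZ1
  have hyZ : 1 + ‖y‖ ≤ Z := le_add_of_nonneg_right (norm_nonneg n)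
  have hnZ : ‖n‖ ≤ Z := le_add_of_nonneg_left (by positivity)
  have hxZ : 1 + ‖x‖ ≤ (1 + κ) * Z := by
    have h1 : ‖x‖ ≤ ‖y‖ + ‖x - y‖ := by
      simpa [add_comm] using norm_le_norm_add_norm_sub' x y
    have h2 : κ * (ρ * ‖n‖) ≤ κ * ‖n‖ := by
      gcongr
      exact mul_le_of_le_one_left (norm_nonneg _) hρ
    have h3 : κ * ‖n‖ ≤ κ * Z := by gcongr
    linarith
  have hxyZ : ‖x - y‖ ≤ κ * ρ * Z := hxy.trans (by rw [mul_assoc]; gcongr)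
  have hm' : (Fintype.card ι : ℝ) ≤ m := by exact_mod_cast hm
  -- Both averages are expanded at `y`: one with the drift and covariance found at `x`, the other
  -- with those at `y`. The two polynomials therefore differ only in these coefficients.
  have t1 := h ν (b x) y lr σ r ((L + A) * (1 + ‖x‖)) M u hu hr hr1 hlr hlrσ
    ((hb x).trans (by gcongr; linarith)) h0 hint (hA'.trans (by gcongr; linarith))
  have t2 := h (signedLaw fun i ↦ s i y) (b y) y lr σ r ((L + √m * L) * (1 + ‖y‖)) M u hu hr hr1
    hlr hlrσ ((hb y).trans (by gcongr; exact le_add_of_nonneg_right (by positivity)))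
    (integral_id_signedLaw _) (integrable_signedLaw _ _)
    ((integral_norm_pow_signedLaw_le _ (fun i ↦ hs i y) _).trans (by
      gcongr ?_ ^ _
      calc √(Fintype.card ι) * L ≤ √m * L := by gcongr
        _ ≤ (L + √m * L) * 1 := by linarith
        _ ≤ _ := by gcongr; exact le_add_of_nonneg_right (norm_nonneg _)))
  rw [← signedStep_eq_integral, integral_bilin_signedLaw] at t2
  rw [hB] at t1
  have b1 : (1 + ‖y‖ + (L + A) * (1 + ‖x‖)) ^ (2 * (N + 3)) ≤
      T₁ * Z ^ (2 * (N + 3)) := by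
    rw [← hT₁, ← mul_pow]
    gcongr
    calc 1 + ‖y‖ + (L + A) * (1 + ‖x‖) ≤ Z + (L + A) * ((1 + κ) * Z) := by gcongr
      _ ≤ Z + (L + A) * ((1 + κ) * Z) + (1 + κ) * Z := le_add_of_nonneg_right (by positivity)
      _ = _ := by ring
  have b2 : (1 + ‖y‖ + (L + √m * L) * (1 + ‖y‖)) ^ (2 * (N + 3)) ≤
      T₂ * Z ^ (2 * (N + 3)) := by
    rw [← hT₂, ← mul_pow]
    gcongr
    calc 1 + ‖y‖ + (L + √m * L) * (1 + ‖y‖) ≤ Z + (L + √m * L) * Z := by gcongr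
      _ ≤ Z + (L + √m * L) * Z + Z := le_add_of_nonneg_right (by positivity)
      _ = _ := by ring
  have hr3 : r ^ 3 ≤ r ^ 2 * ρ := by
    rw [pow_succ]
    gcongr
  set W := 2 * M * (1 + ‖y‖ ^ (2 * (N + 1))) with hW
  have hW0 : 0 ≤ W := by positivity
  have hWZ : W ≤ 4 * M * Z ^ (2 * (N + 1)) := by
    have e1 : ‖y‖ ^ (2 * (N + 1)) ≤ Z ^ (2 * (N + 1)) := by
      gcongr
      linarith
    have e2 := one_le_pow₀ hZ1 (n := 2 * (N + 1))
    calc W ≤ 2 * M * (Z ^ (2 * (N + 1)) + Z ^ (2 * (N + 1))) := by rw [hW]; gcongr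
      _ = _ := by ring
  have hbyD : ‖b y‖ ≤ L * ((1 + κ) * Z) := by
    refine (hb y).trans ?_
    gcongr
    exact hyZ.trans (le_mul_of_one_le_left hZ0 (by linarith))
  refine (hu.abs_expansion_sub_le (δ := L * (κ * ρ * Z)) hΛ (by positivity) hlr hlrσ
    ((hbL x y).trans (by gcongr)) ((hb x).trans (by gcongr)) hbyD
    (fun i ↦ (hsL i x y).trans (by gcongr)) (fun i ↦ hs i x) (fun i ↦ hs i y) t1 t2).trans ?_
  have g1 : K * M * r ^ 3 * (1 + ‖y‖ + (L + A) * (1 + ‖x‖)) ^ (2 * (N + 3)) ≤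
      (K * T₁) * (M * r ^ 2 * ρ * Z ^ (2 * (N + 3))) := by
    calc _ ≤ K * M * (r ^ 2 * ρ) *
          (T₁ * Z ^ (2 * (N + 3))) := by gcongr
      _ = _ := by ring
  have g2 : K * M * r ^ 3 * (1 + ‖y‖ + (L + √m * L) * (1 + ‖y‖)) ^ (2 * (N + 3)) ≤
      (K * T₂) * (M * r ^ 2 * ρ * Z ^ (2 * (N + 3))) := by
    calc _ ≤ K * M * (r ^ 2 * ρ) *
          (T₂ * Z ^ (2 * (N + 3))) := by gcongr
      _ = _ := by ring
  have hZa : Z ^ (2 * (N + 1)) * Z ≤ Z ^ (2 * (N + 3)) := by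
    rw [← pow_succ]
    exact pow_le_pow_right₀ hZ1 (by omega)
  have hZb : Z ^ (2 * (N + 1)) * Z ^ 2 ≤ Z ^ (2 * (N + 3)) := by
    rw [← pow_add]
    exact pow_le_pow_right₀ hZ1 (by omega)
  have hr4 : r ^ 4 ≤ r ^ 2 * ρ := by
    calc r ^ 4 = r ^ 2 * (r * r) := by ring
      _ ≤ r ^ 2 * (ρ * 1) := by gcongr
      _ = _ := by ring
  have hZa : Z ^ (2 * (N + 1)) * Z ≤ Z ^ (2 * (N + 3)) := by
    rw [← pow_succ]
    exact pow_le_pow_right₀ hZ1 (by omega)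
  have hZb : Z ^ (2 * (N + 1)) * Z ^ 2 ≤ Z ^ (2 * (N + 3)) := by
    rw [← pow_add]
    exact pow_le_pow_right₀ hZ1 (by omega)
  have hr4 : r ^ 4 ≤ r ^ 2 * ρ := by
    calc r ^ 4 = r ^ 2 * (r * r) := by ring
      _ ≤ r ^ 2 * (ρ * 1) := by gcongr
      _ = _ := by ring
  have g3 : W * (Λ * r ^ 2 * (L * (κ * ρ * Z)) + Λ ^ 2 * r ^ 4 * (L * ((1 + κ) * Z)) ^ 2
      + Λ ^ 2 * r ^ 2 * (Fintype.card ι * (L * (κ * ρ * Z) * (L + L)))) ≤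
      (Λ * (4 * (L * κ)) + Λ ^ 2 * (4 * (L * (1 + κ)) ^ 2) + Λ ^ 2 * (m * (4 * (2 * L ^ 2 * κ))))
        * (M * r ^ 2 * ρ * Z ^ (2 * (N + 3))) := by
    calc _ ≤ 4 * M * Z ^ (2 * (N + 1)) * (Λ * r ^ 2 * (L * (κ * ρ * Z))
          + Λ ^ 2 * (r ^ 2 * ρ) * (L * ((1 + κ) * Z)) ^ 2
          + Λ ^ 2 * r ^ 2 * (m * (L * (κ * ρ * Z) * (L + L)))) := by gcongr
      _ = (Λ * (4 * (L * κ)) + Λ ^ 2 * (m * (4 * (2 * L ^ 2 * κ))))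
            * (M * r ^ 2 * ρ * (Z ^ (2 * (N + 1)) * Z))
          + Λ ^ 2 * (4 * (L * (1 + κ)) ^ 2) * (M * r ^ 2 * ρ * (Z ^ (2 * (N + 1)) * Z ^ 2)) := by
        generalize Z ^ (2 * (N + 1)) = Y
        ring
      _ ≤ (Λ * (4 * (L * κ)) + Λ ^ 2 * (m * (4 * (2 * L ^ 2 * κ))))
            * (M * r ^ 2 * ρ * Z ^ (2 * (N + 3)))
          + Λ ^ 2 * (4 * (L * (1 + κ)) ^ 2) * (M * r ^ 2 * ρ * Z ^ (2 * (N + 3))) := by gcongr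
      _ = _ := by ring
  calc _ ≤ _ := add_le_add (add_le_add g1 g2) g3
    _ = _ := by
      generalize Z ^ (2 * (N + 3)) = Y
      ring

end OneStep

/-! ### Conditional expectations of one step -/

section CondDistrib

variable {Ω 𝓢 V : Type*} [MeasurableSpace Ω] [MeasurableSpace 𝓢] [MeasurableSpace V]
  {P : Measure Ω} [IsProbabilityMeasure P] {κ : Kernel 𝓢 V} [IsMarkovKernel κ]
  {v : Ω → V} {S : Ω → 𝓢}

/-- As `F` is nonnegative, its integrability follows from that of the conditional bound `g`. This
lets the moment recursions propagate integrability from each step to the next. -/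
theorem ProbabilityTheory.HasCondDistrib.integrable_and_integral_le (h : HasCondDistrib v S κ P)
    {F : 𝓢 × V → ℝ} (hF : Measurable F) (hF0 : ∀ p, 0 ≤ F p) {g : 𝓢 → ℝ}
    (hint : ∀ s, Integrable (fun e ↦ F (s, e)) (κ s)) (hle : ∀ s, ∫ e, F (s, e) ∂(κ s) ≤ g s)
    (hg : Integrable (fun ω ↦ g (S ω)) P) :
    Integrable (fun ω ↦ F (S ω, v ω)) P ∧ ∫ ω, F (S ω, v ω) ∂P ≤ ∫ ω, g (S ω) ∂P := by
  have hS : AEMeasurable S P := h.aemeasurable_fst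
  have hp : AEMeasurable (fun ω ↦ (S ω, v ω)) P := h.aemeasurable
  have : IsProbabilityMeasure (P.map S) := Measure.isProbabilityMeasure_map hS
  have hin : StronglyMeasurable fun s ↦ ∫ e, F (s, e) ∂(κ s) :=
    hF.stronglyMeasurable.integral_kernel_prod_right'
  have hin' : Integrable (fun ω ↦ ∫ e, F (S ω, e) ∂(κ (S ω))) P := by
    refine hg.mono' (hin.measurable.comp_aemeasurable hS).aestronglyMeasurable
      (.of_forall fun ω ↦ ?_)
    rw [Real.norm_of_nonneg (integral_nonneg fun _ ↦ hF0 _)]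
    exact hle _
  have hF1 : Integrable F (P.map S ⊗ₘ κ) := by
    rw [Measure.integrable_compProd_iff hF.aestronglyMeasurable]
    refine ⟨.of_forall hint, ?_⟩
    simp only [Real.norm_of_nonneg (hF0 _)]
    rw [integrable_map_measure hin.aestronglyMeasurable hS]
    exact hin'
  have hF2 : Integrable (fun ω ↦ F (S ω, v ω)) P := by
    have := hF1
    rw [← h.map_eq, integrable_map_measure hF.aestronglyMeasurable hp] at this
    exact this
  refine ⟨hF2, ?_⟩
  calc ∫ ω, F (S ω, v ω) ∂P = ∫ p, F p ∂(P.map fun ω ↦ (S ω, v ω)) :=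
        (integral_map hp hF.aestronglyMeasurable).symm
    _ = ∫ s, ∫ e, F (s, e) ∂(κ s) ∂(P.map S) := by
      rw [h.map_eq, Measure.integral_compProd hF1]
    _ = ∫ ω, ∫ e, F (S ω, e) ∂(κ (S ω)) ∂P := integral_map hS hin.aestronglyMeasurable
    _ ≤ _ := integral_mono hin' hg fun ω ↦ hle _

/-- Disintegration for integrands without a sign, as they occur in the weak error; integrability is
then an input. -/
theorem ProbabilityTheory.HasCondDistrib.integrable_and_integral_eq (h : HasCondDistrib v S κ P)
    {F : 𝓢 × V → ℝ} (hF : Measurable F) (hint : Integrable (fun ω ↦ F (S ω, v ω)) P) :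
    Integrable (fun ω ↦ ∫ e, F (S ω, e) ∂(κ (S ω))) P ∧
    ∫ ω, F (S ω, v ω) ∂P = ∫ ω, ∫ e, F (S ω, e) ∂(κ (S ω)) ∂P := by
  have hS : AEMeasurable S P := h.aemeasurable_fst
  have hp : AEMeasurable (fun ω ↦ (S ω, v ω)) P := h.aemeasurable
  have : IsProbabilityMeasure (P.map S) := Measure.isProbabilityMeasure_map hS
  have hin : StronglyMeasurable fun s ↦ ∫ e, F (s, e) ∂(κ s) :=
    hF.stronglyMeasurable.integral_kernel_prod_right'
  have hF1 : Integrable F (P.map S ⊗ₘ κ) := by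
    rw [← h.map_eq, integrable_map_measure hF.aestronglyMeasurable hp]
    exact hint
  constructor
  · have h1 : Integrable (fun s ↦ ∫ e, F (s, e) ∂(κ s)) (P.map S) := by
      have h2 := hF1
      rw [Measure.compProd] at h2
      simpa using h2.integral_compProd
    rw [integrable_map_measure hin.aestronglyMeasurable hS] at h1
    exact h1
  · calc ∫ ω, F (S ω, v ω) ∂P = ∫ p, F p ∂(P.map fun ω ↦ (S ω, v ω)) :=
        (integral_map hp hF.aestronglyMeasurable).symm
      _ = ∫ s, ∫ e, F (s, e) ∂(κ s) ∂(P.map S) := by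
        rw [h.map_eq, Measure.integral_compProd hF1]
      _ = _ := integral_map hS hin.aestronglyMeasurable

end CondDistrib

/-! ### Moment recursions for perturbed gradient descent -/

theorem one_add_norm_pow_le {E : Type*} [NormedAddCommGroup E] {x y n : E} {c : ℝ}
    (h : ‖x - y‖ ≤ c * ‖n‖) (p : ℕ) :
    (1 + ‖x‖) ^ p ≤ 4 ^ p * (1 + ‖y‖ ^ p + (c * ‖n‖) ^ p) := by
  have hc : 0 ≤ c * ‖n‖ := (norm_nonneg _).trans h
  refine (pow_le_pow_left₀ (by positivity) ?_ p).trans (one_add_add_pow_le (norm_nonneg y) hc p)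
  have : ‖x‖ ≤ ‖y‖ + ‖x - y‖ := by
    simpa [add_comm] using norm_le_norm_add_norm_sub' x y
  linarith

section Moments

variable {E : Type*} [NormedAddCommGroup E] [InnerProductSpace ℝ E] [CompleteSpace E]
  [MeasurableSpace E] [BorelSpace E] [SecondCountableTopology E]

/-- A centered noise kernel all of whose even moments grow at most linearly. -/
structure CenteredNoise (A : ℕ → ℝ) (κ : Kernel E E) : Prop where
  mean : ∀ x, ∫ v, v ∂(κ x) = 0
  integrable : ∀ m, 1 ≤ m → ∀ x, Integrable (fun v ↦ ‖v‖ ^ (2 * m)) (κ x)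
  moment : ∀ m, 1 ≤ m → ∀ x, ∫ v, ‖v‖ ^ (2 * m) ∂(κ x) ≤ (A m * (1 + ‖x‖)) ^ (2 * m)

/-- Serves two time scales: with ε = η for the averaged iterate, and with ε of the order of 1 - β
for the momentum. In both cases the noise coefficient `θ` is only O(√ε), which suffices because the
noise is centered. -/
theorem exists_integral_noisy_step_le (L Λ : ℝ) (hL : 0 ≤ L) (hΛ : 0 ≤ Λ) (A : ℕ → ℝ)
    (hA : ∀ m, 0 ≤ A m) (n : ℕ) : ∃ K : ℝ, 0 ≤ K ∧ ∀ (b : E → E) (κ : Kernel E E)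
      [IsMarkovKernel κ], CenteredNoise A κ → (∀ x, ‖b x‖ ≤ L * (1 + ‖x‖)) →
      ∀ (x a : E) (ε γ θ : ℝ), 0 ≤ ε → ε ≤ 1 → |γ| ≤ Λ * ε → θ ^ 2 ≤ Λ ^ 2 * ε →
      Integrable (fun v ↦ ‖a + γ • b x + θ • v‖ ^ (2 * (n + 1))) (κ x) ∧
      ∫ v, ‖a + γ • b x + θ • v‖ ^ (2 * (n + 1)) ∂(κ x) ≤ ‖a‖ ^ (2 * (n + 1))
        + ε * (K * (‖a‖ ^ (2 * n + 1) * (1 + ‖x‖) + (1 + ‖x‖) ^ (2 * (n + 1)))) := by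
  obtain ⟨K, hK, h⟩ := exists_integral_norm_pow_le (E := E) n
  set D := Λ * (L + A 1 + A (n + 1)) with hD
  have hA1 := hA 1
  have hA2 := hA (n + 1)
  have hD0 : 0 ≤ D := by positivity
  refine ⟨K * (D + D ^ (2 * (n + 1))), by positivity,
    fun b κ _ hκ hb x a ε γ θ hε hε1 hγ hθ ↦ ?_⟩
  have hx : 0 ≤ 1 + ‖x‖ := by positivity
  have m1 := hκ.moment 1 le_rfl x
  have m2 := hκ.moment (n + 1) (by omega) x
  have e1 : ‖γ • b x‖ ≤ ε * (D * (1 + ‖x‖)) := by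
    rw [norm_smul, Real.norm_eq_abs]
    calc |γ| * ‖b x‖ ≤ Λ * ε * (L * (1 + ‖x‖)) := by gcongr; exact hb x
      _ ≤ Λ * ε * (L * (1 + ‖x‖)) + Λ * ε * ((A 1 + A (n + 1)) * (1 + ‖x‖)) :=
        le_add_of_nonneg_right (by positivity)
      _ = _ := by rw [hD]; ring
  have f1 : Λ * (A 1 * (1 + ‖x‖)) ≤ D * (1 + ‖x‖) := by
    rw [← mul_assoc, hD]
    gcongr
    linarith
  have f2 : Λ * (A (n + 1) * (1 + ‖x‖)) ≤ D * (1 + ‖x‖) := by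
    rw [← mul_assoc, hD]
    gcongr
    linarith
  have e2 : ∫ v, ‖θ • v‖ ^ 2 ∂(κ x) ≤ ε * (D * (1 + ‖x‖)) ^ 2 := by
    simp only [norm_smul, mul_pow, Real.norm_eq_abs, sq_abs]
    rw [integral_const_mul]
    calc _ ≤ Λ ^ 2 * ε * (A 1 * (1 + ‖x‖)) ^ 2 := by gcongr
      _ = ε * (Λ * (A 1 * (1 + ‖x‖))) ^ 2 := by ring
      _ ≤ ε * (D * (1 + ‖x‖)) ^ 2 := by gcongr
      _ = _ := by ring
  have e3 : ∫ v, ‖θ • v‖ ^ (2 * (n + 1)) ∂(κ x) ≤ ε * (D * (1 + ‖x‖)) ^ (2 * (n + 1)) := by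
    simp only [norm_smul, mul_pow, Real.norm_eq_abs]
    rw [integral_const_mul]
    calc _ ≤ (Λ ^ (2 * (n + 1)) * ε) * (A (n + 1) * (1 + ‖x‖)) ^ (2 * (n + 1)) := by
          gcongr
          calc |θ| ^ (2 * (n + 1)) = (θ ^ 2) ^ (n + 1) := by rw [pow_mul, sq_abs]
            _ ≤ (Λ ^ 2 * ε) ^ (n + 1) := by gcongr
            _ = Λ ^ (2 * (n + 1)) * ε ^ (n + 1) := by rw [mul_pow, ← pow_mul]
            _ ≤ Λ ^ (2 * (n + 1)) * ε := by
              gcongr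
              exact pow_le_of_le_one hε hε1 (by omega)
      _ = ε * (Λ * (A (n + 1) * (1 + ‖x‖))) ^ (2 * (n + 1)) := by rw [mul_pow Λ]; ring
      _ ≤ ε * (D * (1 + ‖x‖)) ^ (2 * (n + 1)) := by gcongr
      _ = _ := by rw [mul_pow]
  have i3 : Integrable (fun v : E ↦ ‖θ • v‖ ^ (2 * (n + 1))) (κ x) := by
    simp only [norm_smul, mul_pow]
    exact (hκ.integrable (n + 1) (by omega) x).const_mul _
  obtain ⟨g1, g2⟩ := h (κ x) ε (D * (1 + ‖x‖)) a (γ • b x) (fun v ↦ θ • v) hε hε1 (by positivity)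
    e1 (Continuous.aestronglyMeasurable (by fun_prop)) i3
    (by rw [integral_smul, hκ.mean x, smul_zero]) e2 e3
  refine ⟨g1, g2.trans ?_⟩
  gcongr ‖a‖ ^ (2 * (n + 1)) + ε * ?_
  rw [mul_assoc K]
  gcongr K * ?_
  rw [mul_pow D]
  have w1 : 0 ≤ ‖a‖ ^ (2 * n + 1) * (1 + ‖x‖) := by positivity
  have w2 : 0 ≤ (1 + ‖x‖) ^ (2 * (n + 1)) := by positivity
  have w3 : 0 ≤ D ^ (2 * (n + 1)) := by positivity
  generalize D ^ (2 * (n + 1)) = D' at *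
  generalize (1 + ‖x‖) ^ (2 * (n + 1)) = X' at *
  nlinarith [mul_nonneg w3 w1, mul_nonneg hD0 w2]

/-- Gradient descent for `y` in which the noisy gradient is queried at a nearby point `x`. The
process `n` controls the distance between `x` and `y`. -/
structure PerturbedDescent (b : E → E) (κ : Kernel E E) (σ : ℝ) (lr : ℕ → ℝ) (c : ℝ) {Ω : Type*}
    [MeasurableSpace Ω] (P : Measure Ω) (x y n v : ℕ → Ω → E) : Prop where
  step : ∀ k ω, y (k + 1) ω = y k ω - lr k • (b (x k ω) + σ • v k ω)
  near : ∀ k ω, ‖x k ω - y k ω‖ ≤ c * ‖n k ω‖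
  cond : ∀ k, HasCondDistrib (v k) (fun ω ↦ (x k ω, y k ω, n k ω))
    (κ.comap (fun s : E × E × E ↦ s.1) (by fun_prop)) P

/-- Recursion for the even moments of perturbed gradient descent. -/
theorem exists_moment_descent_le (L Λ c : ℝ) (hL : 0 ≤ L) (hΛ : 0 ≤ Λ) (hc : 0 ≤ c) (A : ℕ → ℝ)
    (hA : ∀ m, 0 ≤ A m) (n : ℕ) : ∃ K : ℝ, 0 ≤ K ∧ ∀ (b : E → E) (κ : Kernel E E)
      [IsMarkovKernel κ], CenteredNoise A κ → Continuous b → (∀ x, ‖b x‖ ≤ L * (1 + ‖x‖)) →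
      ∀ {Ω : Type*} [MeasurableSpace Ω] (P : Measure Ω) [IsProbabilityMeasure P]
      (x y N v : ℕ → Ω → E) (σ η ρ : ℝ) (lr : ℕ → ℝ) (k : ℕ),
      PerturbedDescent b κ σ lr (c * ρ) P x y N v → 0 ≤ η → η ≤ 1 → 0 ≤ ρ → ρ ≤ 1 →
      |lr k| ≤ Λ * η → (lr k * σ) ^ 2 ≤ Λ ^ 2 * η →
      Integrable (fun ω ↦ ‖y k ω‖ ^ (2 * (n + 1))) P →
      Integrable (fun ω ↦ ‖N k ω‖ ^ (2 * (n + 1))) P →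
      Integrable (fun ω ↦ ‖y (k + 1) ω‖ ^ (2 * (n + 1))) P ∧
      ∫ ω, ‖y (k + 1) ω‖ ^ (2 * (n + 1)) ∂P ≤ ∫ ω, ‖y k ω‖ ^ (2 * (n + 1)) ∂P
        + η * (K * (1 + ∫ ω, ‖y k ω‖ ^ (2 * (n + 1)) ∂P
          + ρ ^ 2 * ∫ ω, ‖N k ω‖ ^ (2 * (n + 1)) ∂P)) := by
  obtain ⟨K, hK, h⟩ := exists_integral_noisy_step_le (E := E) L Λ hL hΛ A hA n
  refine ⟨K * (1 + 2 * (4 ^ (2 * (n + 1)) * (1 + c ^ (2 * (n + 1))))), by positivity, ?_⟩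
  intro b κ _ hκ hbc hb Ω _ P _ x y N v σ η ρ lr k hD hη hη1 hρ hρ1 hlr hlrσ iy iN
  set F : (E × E × E) × E → ℝ := fun p ↦
    ‖p.1.2.1 + (-lr k) • b p.1.1 + (-(lr k * σ)) • p.2‖ ^ (2 * (n + 1)) with hF
  have hFm : Measurable F := by
    simp only [hF]
    exact Continuous.measurable (by fun_prop)
  have hlr' : |-lr k| ≤ Λ * η := by rwa [abs_neg]
  have hlrσ' : (-(lr k * σ)) ^ 2 ≤ Λ ^ 2 * η := by rwa [neg_sq]
  have hs : ∀ ω, F ((x k ω, y k ω, N k ω), v k ω) = ‖y (k + 1) ω‖ ^ (2 * (n + 1)) := fun ω ↦ by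
    simp only [hF]
    rw [hD.step]
    congr 2
    simp only [smul_add, neg_smul, smul_smul]
    abel
  set g : E × E × E → ℝ := fun s ↦ ‖s.2.1‖ ^ (2 * (n + 1))
        + η * (K * (‖s.2.1‖ ^ (2 * n + 1) * (1 + ‖s.1‖) + (1 + ‖s.1‖) ^ (2 * (n + 1)))) with hg
  have hgle : ∀ ω, g (x k ω, y k ω, N k ω) ≤ ‖y k ω‖ ^ (2 * (n + 1)) + η *
      (K * (1 + 2 * (4 ^ (2 * (n + 1)) * (1 + c ^ (2 * (n + 1))))) * (1 + ‖y k ω‖ ^ (2 * (n + 1))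
        + ρ ^ 2 * ‖N k ω‖ ^ (2 * (n + 1)))) := fun ω ↦ by
    simp only [hg]
    rw [mul_assoc K]
    gcongr ‖y k ω‖ ^ (2 * (n + 1)) + η * (K * ?_)
    have h1 := one_add_norm_pow_le (hD.near k ω) (2 * (n + 1))
    have h2 : ‖y k ω‖ ^ (2 * n + 1) * (1 + ‖x k ω‖) ≤
        ‖y k ω‖ ^ (2 * (n + 1)) + (1 + ‖x k ω‖) ^ (2 * (n + 1)) := by
      simpa [mul_add, add_assoc] using
        pow_mul_pow_le_add (norm_nonneg (y k ω)) (by positivity : 0 ≤ 1 + ‖x k ω‖) (2 * n + 1) 1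
    have h3 : (c * ρ * ‖N k ω‖) ^ (2 * (n + 1)) ≤
        c ^ (2 * (n + 1)) * (ρ ^ 2 * ‖N k ω‖ ^ (2 * (n + 1))) := by
      rw [mul_pow, mul_pow, mul_assoc]
      gcongr ?_ * (?_ * ?_)
      exact pow_le_pow_of_le_one hρ hρ1 (by omega)
    have w1 : 0 ≤ ‖y k ω‖ ^ (2 * (n + 1)) := by positivity
    have w2 : 0 ≤ ρ ^ 2 * ‖N k ω‖ ^ (2 * (n + 1)) := by positivity
    have w3 : 0 ≤ c ^ (2 * (n + 1)) := by positivity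
    have h4 : (1 + ‖x k ω‖) ^ (2 * (n + 1)) ≤ 4 ^ (2 * (n + 1)) * (1 + c ^ (2 * (n + 1))) *
        (1 + ‖y k ω‖ ^ (2 * (n + 1)) + ρ ^ 2 * ‖N k ω‖ ^ (2 * (n + 1))) := by
      refine h1.trans ?_
      rw [mul_assoc ((4 : ℝ) ^ (2 * (n + 1)))]
      gcongr 4 ^ (2 * (n + 1)) * ?_
      nlinarith [mul_nonneg w3 w1]
    nlinarith
  have ib : Integrable (fun ω ↦ ‖y k ω‖ ^ (2 * (n + 1)) + η *
      (K * (1 + 2 * (4 ^ (2 * (n + 1)) * (1 + c ^ (2 * (n + 1))))) * (1 + ‖y k ω‖ ^ (2 * (n + 1))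
        + ρ ^ 2 * ‖N k ω‖ ^ (2 * (n + 1))))) P := by fun_prop
  have hgm : Measurable g := by
    simp only [hg]
    exact Continuous.measurable (by fun_prop)
  have ig : Integrable (fun ω ↦ g (x k ω, y k ω, N k ω)) P := by
    refine ib.mono' (hgm.comp_aemeasurable (hD.cond k).aemeasurable_fst).aestronglyMeasurable
      (.of_forall fun ω ↦ ?_)
    rw [Real.norm_of_nonneg (by simp only [hg]; positivity)]
    exact hgle ω
  have hmain := (hD.cond k).integrable_and_integral_le hFm (fun p ↦ by simp only [hF]; positivity)
    (g := g) (fun s ↦ (h b κ hκ hb s.1 s.2.1 η _ _ hη hη1 hlr' hlrσ').1)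
    (fun s ↦ (h b κ hκ hb s.1 s.2.1 η _ _ hη hη1 hlr' hlrσ').2) ig
  simp only [hs] at hmain
  refine ⟨hmain.1, hmain.2.trans ((integral_mono ig ib hgle).trans (le_of_eq ?_))⟩
  rw [integral_add iy (by fun_prop), integral_const_mul, integral_const_mul,
    integral_add (by fun_prop) (by fun_prop), integral_add (by fun_prop) iy, integral_const_mul]
  simp

end Moments

/-! ### Moment bounds uniform in the scale -/

section Moments

variable {E : Type*} [NormedAddCommGroup E] [InnerProductSpace ℝ E] [CompleteSpace E]
  [MeasurableSpace E] [BorelSpace E] [SecondCountableTopology E]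

/-- Recursion for the even moments of the rescaled momentum. -/
theorem exists_moment_momentum_le (L l c : ℝ) (hL : 0 ≤ L) (hl : 0 < l) (hc : 0 ≤ c) (A : ℕ → ℝ)
    (hA : ∀ m, 0 ≤ A m) (n : ℕ) : ∃ K : ℝ, 0 ≤ K ∧ ∀ (b : E → E) (κ : Kernel E E)
      [IsMarkovKernel κ], CenteredNoise A κ → Continuous b → (∀ x, ‖b x‖ ≤ L * (1 + ‖x‖)) →
      ∀ {Ω : Type*} [MeasurableSpace Ω] (P : Measure Ω) [IsProbabilityMeasure P]
      (x y N v : ℕ → Ω → E) (σ η ε ρ β : ℝ) (lr : ℕ → ℝ) (k : ℕ),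
      PerturbedDescent b κ σ lr (c * ρ) P x y N v →
      (∀ ω, N (k + 1) ω = β • N k ω + (ρ * (1 - β)) • (b (x k ω) + σ • v k ω)) →
      0 ≤ η → 0 ≤ ε → ε ≤ 1 → 0 ≤ ρ → ρ ≤ 1 → ε * ρ ^ 2 = η → σ ^ 2 * η ≤ 1 →
      0 ≤ β → l * ε ≤ 1 - β → 1 - β ≤ ε →
      Integrable (fun ω ↦ ‖y k ω‖ ^ (2 * (n + 1))) P →
      Integrable (fun ω ↦ ‖N k ω‖ ^ (2 * (n + 1))) P →
      Integrable (fun ω ↦ ‖N (k + 1) ω‖ ^ (2 * (n + 1))) P ∧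
      ∫ ω, ‖N (k + 1) ω‖ ^ (2 * (n + 1)) ∂P ≤
        (1 - l / 2 * ε + K * η) * ∫ ω, ‖N k ω‖ ^ (2 * (n + 1)) ∂P
          + K * ε * (1 + ∫ ω, ‖y k ω‖ ^ (2 * (n + 1)) ∂P) := by
  obtain ⟨K₀, hK₀, h⟩ := exists_integral_noisy_step_le (E := E) L 1 hL zero_le_one A hA n
  -- With this constant the cross term uses up at most half of the contraction rate `l * ε`.
  obtain ⟨K₁, hK₁, hY⟩ := exists_pow_mul_le_small (κ := l / (2 * (K₀ + 1))) (by positivity)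
    (2 * n + 1)
  refine ⟨K₀ * (K₁ + 1) * (4 ^ (2 * (n + 1)) * (1 + c ^ (2 * (n + 1)))), by positivity, ?_⟩
  intro b κ _ hκ hbc hb Ω _ P _ x y N v σ η ε ρ β lr k hD hN hη hε hε1 hρ hρ1 hερ hσ hβ hβl hβε
    iy iN
  have hβ1 : β ≤ 1 := by linarith [mul_nonneg hl.le hε]
  set F : (E × E × E) × E → ℝ := fun p ↦
    ‖β • p.1.2.2 + (ρ * (1 - β)) • b p.1.1 + (ρ * (1 - β) * σ) • p.2‖ ^ (2 * (n + 1)) with hF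
  have hFm : Measurable F := by
    simp only [hF]
    exact Continuous.measurable (by fun_prop)
  have hγ : |ρ * (1 - β)| ≤ 1 * ε := by
    rw [one_mul, abs_of_nonneg (mul_nonneg hρ (by linarith))]
    calc ρ * (1 - β) ≤ 1 * ε := by gcongr
      _ = ε := one_mul ε
  -- The reason for rescaling the momentum by `ρ`: as ε ρ² = η and σ² η ≤ 1, the noise injected in
  -- one step has size O(√ε), which a contraction at rate ε can balance.
  have hθ : (ρ * (1 - β) * σ) ^ 2 ≤ 1 ^ 2 * ε := by
    have h1 : (1 - β) ^ 2 ≤ ε ^ 2 := pow_le_pow_left₀ (by linarith) hβε 2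
    calc (ρ * (1 - β) * σ) ^ 2 = (1 - β) ^ 2 * (ρ ^ 2 * σ ^ 2) := by ring
      _ ≤ ε ^ 2 * (ρ ^ 2 * σ ^ 2) := by gcongr
      _ = ε * (σ ^ 2 * (ε * ρ ^ 2)) := by ring
      _ ≤ ε * 1 := by rw [hερ]; gcongr
      _ = _ := by ring
  have hs : ∀ ω, F ((x k ω, y k ω, N k ω), v k ω) = ‖N (k + 1) ω‖ ^ (2 * (n + 1)) := fun ω ↦ by
    simp only [hF]
    rw [hN, smul_add, smul_smul, add_assoc]
  set g : E × E × E → ℝ := fun s ↦ ‖β • s.2.2‖ ^ (2 * (n + 1)) + ε * (K₀ *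
    (‖β • s.2.2‖ ^ (2 * n + 1) * (1 + ‖s.1‖) + (1 + ‖s.1‖) ^ (2 * (n + 1)))) with hg
  set K := K₀ * (K₁ + 1) * (4 ^ (2 * (n + 1)) * (1 + c ^ (2 * (n + 1)))) with hK
  have hgle : ∀ ω, g (x k ω, y k ω, N k ω) ≤
      (1 - l / 2 * ε + K * η) * ‖N k ω‖ ^ (2 * (n + 1))
        + K * ε * (1 + ‖y k ω‖ ^ (2 * (n + 1))) := fun ω ↦ by
    simp only [hg]
    have h1 := one_add_norm_pow_le (hD.near k ω) (2 * (n + 1))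
    have h2 := hY ‖β • N k ω‖ (1 + ‖x k ω‖) (norm_nonneg _) (by positivity)
    have h3 : ε * (c * ρ * ‖N k ω‖) ^ (2 * (n + 1)) ≤
        c ^ (2 * (n + 1)) * (η * ‖N k ω‖ ^ (2 * (n + 1))) := by
      rw [mul_pow, mul_pow, ← hερ]
      have := pow_le_pow_of_le_one hρ hρ1 (show 2 ≤ 2 * (n + 1) by omega)
      calc _ = c ^ (2 * (n + 1)) * (ε * ρ ^ (2 * (n + 1)) * ‖N k ω‖ ^ (2 * (n + 1))) := by ring
        _ ≤ _ := by gcongr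
    have h4 : ‖β • N k ω‖ ^ (2 * (n + 1)) ≤ β * ‖N k ω‖ ^ (2 * (n + 1)) := by
      rw [norm_smul, mul_pow, Real.norm_of_nonneg hβ]
      gcongr
      exact pow_le_of_le_one hβ hβ1 (by omega)
    have h5 : ‖β • N k ω‖ ^ (2 * (n + 1)) ≤ ‖N k ω‖ ^ (2 * (n + 1)) :=
      h4.trans (mul_le_of_le_one_left (by positivity) hβ1)
    have h6 : K₀ * (l / (2 * (K₀ + 1))) ≤ l / 2 := by
      rw [mul_div_assoc', div_le_div_iff₀ (by positivity) (by positivity)]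
      nlinarith
    rw [show 2 * n + 1 + 1 = 2 * (n + 1) by ring] at h2
    have u1 : 0 ≤ ‖y k ω‖ ^ (2 * (n + 1)) := by positivity
    have u2 : 0 ≤ ‖N k ω‖ ^ (2 * (n + 1)) := by positivity
    have u3 : 0 ≤ c ^ (2 * (n + 1)) := by positivity
    have u4 : (0 : ℝ) ≤ 4 ^ (2 * (n + 1)) := by positivity
    generalize ‖y k ω‖ ^ (2 * (n + 1)) = Y at *
    generalize (c * ρ * ‖N k ω‖) ^ (2 * (n + 1)) = D at *
    generalize ‖N k ω‖ ^ (2 * (n + 1)) = Z at *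
    generalize c ^ (2 * (n + 1)) = C at *
    generalize (4 : ℝ) ^ (2 * (n + 1)) = q at *
    generalize ‖β • N k ω‖ ^ (2 * (n + 1)) = B at *
    generalize ‖β • N k ω‖ ^ (2 * n + 1) * (1 + ‖x k ω‖) = B' at *
    generalize (1 + ‖x k ω‖) ^ (2 * (n + 1)) = X at *
    calc B + ε * (K₀ * (B' + X))
        ≤ β * Z + ε * (K₀ * ((l / (2 * (K₀ + 1)) * Z + K₁ * X) + X)) := by
          gcongr
          exact h2.trans (by gcongr)
      _ = β * Z + ε * (K₀ * (l / (2 * (K₀ + 1)))) * Z + K₀ * (K₁ + 1) * (ε * X) := by ring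
      _ ≤ (1 - l * ε) * Z + ε * (l / 2) * Z
          + K₀ * (K₁ + 1) * (q * (1 + C) * (ε * (1 + Y) + η * Z)) := by
        have h7 : ε * X ≤ q * (1 + C) * (ε * (1 + Y) + η * Z) := by
          calc ε * X ≤ ε * (q * (1 + Y + D)) := by gcongr
            _ = q * (ε * (1 + Y) + ε * D) := by ring
            _ ≤ q * (ε * (1 + Y) + C * (η * Z)) := by gcongr
            _ ≤ q * (ε * (1 + Y) + C * (η * Z)) + q * (C * (ε * (1 + Y)) + η * Z) :=
              le_add_of_nonneg_right (by positivity)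
            _ = _ := by ring
        have h8 : β ≤ 1 - l * ε := by linarith
        gcongr
      _ = _ := by rw [hK]; ring
  have ib : Integrable (fun ω ↦ (1 - l / 2 * ε + K * η) * ‖N k ω‖ ^ (2 * (n + 1))
        + K * ε * (1 + ‖y k ω‖ ^ (2 * (n + 1)))) P := by fun_prop
  have hgm : Measurable g := by
    simp only [hg]
    exact Continuous.measurable (by fun_prop)
  have ig : Integrable (fun ω ↦ g (x k ω, y k ω, N k ω)) P := by
    refine ib.mono' (hgm.comp_aemeasurable (hD.cond k).aemeasurable_fst).aestronglyMeasurable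
      (.of_forall fun ω ↦ ?_)
    rw [Real.norm_of_nonneg (by simp only [hg]; positivity)]
    exact hgle ω
  have hmain := (hD.cond k).integrable_and_integral_le hFm (fun p ↦ by simp only [hF]; positivity)
    (g := g) (fun s ↦ (h b κ hκ hb s.1 (β • s.2.2) ε _ _ hε hε1 hγ hθ).1)
    (fun s ↦ (h b κ hκ hb s.1 (β • s.2.2) ε _ _ hε hε1 hγ hθ).2) ig
  simp only [hs] at hmain
  refine ⟨hmain.1, hmain.2.trans ((integral_mono ig ib hgle).trans (le_of_eq ?_))⟩
  rw [integral_add (by fun_prop) (by fun_prop), integral_const_mul, integral_const_mul,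
    integral_add (by fun_prop) iy]
  simp

/-- A discrete Gronwall estimate for a slow variable coupled to a fast contracting variable. -/
theorem exists_bound_of_slow_fast_recursion (K l T W : ℝ) (hK : 0 ≤ K) (hl : 0 < l) :
    ∃ B : ℝ, ∀ (y m : ℕ → ℝ) (η ε ρ : ℝ), (∀ k, 0 ≤ y k) → (∀ k, 0 ≤ m k) → 0 ≤ η →
      0 ≤ ε → 0 ≤ ρ → ρ ≤ 1 → ε * ρ ^ 2 = η → l * ε ≤ 1 → 1 + y 0 + m 0 ≤ W →
      (∀ k, y (k + 1) ≤ y k + η * (K * (1 + y k + ρ ^ 2 * m k))) →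
      (∀ k, m (k + 1) ≤ (1 - l * ε + K * η) * m k + K * ε * (1 + y k)) →
      ∀ k : ℕ, k * η ≤ T → y k ≤ B ∧ m k ≤ B := by
  set U := Real.exp (2 * K * T) * W with hU
  refine ⟨U + (W + K * U / l) * Real.exp (K * T), ?_⟩
  intro y m η ε ρ hy hm hη hε hρ hρ1 hερ hlε hW hry hrm
  have hW0 : 0 ≤ W := by linarith [hy 0, hm 0]
  have hU0 : 0 ≤ U := by positivity
  -- Weighting `m` by ρ² turns its forcing K ε (1 + y) into K η (1 + y), so this combination grows
  -- by a factor of at most 1 + 2Kη per step, even without the contraction.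
  have hw : ∀ k, 1 + y k + ρ ^ 2 * m k ≤ Real.exp (2 * K * (k * η)) * W := by
    intro k
    induction k with
    | zero =>
      have : ρ ^ 2 * m 0 ≤ m 0 := mul_le_of_le_one_left (hm 0) (pow_le_one₀ hρ hρ1)
      simp
      linarith
    | succ k ih =>
      have e1 : ρ ^ 2 * m (k + 1) ≤
          ρ ^ 2 * ((1 - l * ε + K * η) * m k + K * ε * (1 + y k)) := by
        gcongr
        exact hrm k
      have e2 : 0 ≤ l * ε * (ρ ^ 2 * m k) := by have := hm k; positivity
      have e3 : ρ ^ 2 * ((1 - l * ε + K * η) * m k + K * ε * (1 + y k)) =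
          ρ ^ 2 * m k - l * ε * (ρ ^ 2 * m k) + K * η * (ρ ^ 2 * m k) + K * η * (1 + y k) := by
        rw [← hερ]; ring
      have e4 : 1 + 2 * K * η ≤ Real.exp (2 * K * η) := by
        linarith [Real.add_one_le_exp (2 * K * η)]
      have e5 : 0 ≤ 1 + y k + ρ ^ 2 * m k := by have := hm k; have := hy k; positivity
      calc 1 + y (k + 1) + ρ ^ 2 * m (k + 1)
          ≤ (1 + 2 * K * η) * (1 + y k + ρ ^ 2 * m k) := by
            linarith [hry k]
        _ ≤ Real.exp (2 * K * η) * (Real.exp (2 * K * (k * η)) * W) := by gcongr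
        _ = _ := by
          rw [← mul_assoc, ← Real.exp_add]
          congr 2
          push_cast
          ring
  have hyU : ∀ k : ℕ, k * η ≤ T → 1 + y k ≤ U := fun k hk ↦ by
    have e1 : 0 ≤ ρ ^ 2 * m k := by have := hm k; positivity
    have e2 : Real.exp (2 * K * (k * η)) * W ≤ U := by
      rw [hU]
      gcongr
    linarith [hw k]
  -- Once 1 + y ≤ U, the forcing of `m` is at most ε K U ≤ ε l Q, which the contraction compensates
  -- at level `Q`. Only the factor 1 + Kη per step remains.
  set Q := W + K * U / l with hQ
  have hQ0 : 0 ≤ Q := by positivity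
  have hmQ : ∀ k : ℕ, k * η ≤ T → m k ≤ Q * Real.exp (K * (k * η)) := by
    intro k
    induction k with
    | zero =>
      intro _
      have : 0 ≤ K * U / l := by positivity
      simp
      linarith [hy 0]
    | succ k ih =>
      intro hk
      push_cast at hk
      have hk' : k * η ≤ T := by linarith
      have e1 := ih hk'
      have e2 := hyU k hk'
      have e3 : K * U ≤ l * Q := by
        rw [hQ, mul_add, mul_div_cancel₀ _ hl.ne']
        linarith [mul_nonneg hl.le hW0]
      have e4 : 1 ≤ Real.exp (K * (k * η)) := Real.one_le_exp (by positivity)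
      have e5 : K * η + 1 ≤ Real.exp (K * η) := Real.add_one_le_exp _
      calc m (k + 1) ≤ (1 - l * ε + K * η) * m k + K * ε * (1 + y k) := hrm k
        _ ≤ (1 - l * ε + K * η) * (Q * Real.exp (K * (k * η))) + ε * (K * U) := by
          have : 0 ≤ 1 - l * ε + K * η := by linarith [mul_nonneg hK hη]
          have : K * ε * (1 + y k) ≤ K * ε * U := by gcongr
          have : (1 - l * ε + K * η) * m k ≤
            (1 - l * ε + K * η) * (Q * Real.exp (K * (k * η))) := by gcongr
          linarith
        _ ≤ (1 - l * ε + K * η) * (Q * Real.exp (K * (k * η)))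
            + ε * (l * Q * Real.exp (K * (k * η))) := by
          have := mul_le_mul_of_nonneg_left
            (e3.trans (le_mul_of_one_le_right (by positivity) e4)) hε
          linarith
        _ = (K * η + 1) * (Q * Real.exp (K * (k * η))) := by ring
        _ ≤ Real.exp (K * η) * (Q * Real.exp (K * (k * η))) := by gcongr
        _ = _ := by
          rw [mul_left_comm, ← Real.exp_add]
          congr 2
          push_cast
          ring
  intro k hk
  have e1 : m k ≤ Q * Real.exp (K * T) := (hmQ k hk).trans (by gcongr)
  have e2 : 0 ≤ Q * Real.exp (K * T) := by positivity
  exact ⟨by linarith [hyU k hk], by linarith⟩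

/-- Uniform moment bounds for gradient descent with momentum, for the averaged iterate `y` and the
rescaled momentum `N`. -/
theorem exists_moment_bound_momentum (L Λ l c : ℝ) (hL : 0 ≤ L) (hΛ : 0 ≤ Λ) (hl : 0 < l)
    (hc : 0 ≤ c) (A : ℕ → ℝ) (hA : ∀ m, 0 ≤ A m) (n : ℕ) (T W : ℝ) :
    ∃ B : ℝ, ∀ (b : E → E) (κ : Kernel E E)
      [IsMarkovKernel κ], CenteredNoise A κ → Continuous b → (∀ x, ‖b x‖ ≤ L * (1 + ‖x‖)) →
      ∀ {Ω : Type*} [MeasurableSpace Ω] (P : Measure Ω) [IsProbabilityMeasure P]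
      (x y N v : ℕ → Ω → E) (σ η ε ρ : ℝ) (lr β : ℕ → ℝ),
      PerturbedDescent b κ σ lr (c * ρ) P x y N v →
      (∀ k ω, N (k + 1) ω = β k • N k ω + (ρ * (1 - β k)) • (b (x k ω) + σ • v k ω)) →
      0 ≤ η → η ≤ 1 → 0 ≤ ε → ε ≤ 1 → 0 ≤ ρ → ρ ≤ 1 → ε * ρ ^ 2 = η → σ ^ 2 * η ≤ 1 →
      (∀ k, |lr k| ≤ Λ * η) → (∀ k, 0 ≤ β k) → (∀ k, l * ε ≤ 1 - β k) → (∀ k, 1 - β k ≤ ε) →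
      Integrable (fun ω ↦ ‖y 0 ω‖ ^ (2 * (n + 1))) P →
      Integrable (fun ω ↦ ‖N 0 ω‖ ^ (2 * (n + 1))) P →
      1 + ∫ ω, ‖y 0 ω‖ ^ (2 * (n + 1)) ∂P + ∫ ω, ‖N 0 ω‖ ^ (2 * (n + 1)) ∂P ≤ W →
      ∀ k : ℕ, k * η ≤ T →
        (Integrable (fun ω ↦ ‖y k ω‖ ^ (2 * (n + 1))) P ∧
          Integrable (fun ω ↦ ‖N k ω‖ ^ (2 * (n + 1))) P) ∧
        ∫ ω, ‖y k ω‖ ^ (2 * (n + 1)) ∂P ≤ B ∧ ∫ ω, ‖N k ω‖ ^ (2 * (n + 1)) ∂P ≤ B := by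
  obtain ⟨K₁, hK₁, h₁⟩ := exists_moment_descent_le (E := E) L Λ c hL hΛ hc A hA n
  obtain ⟨K₂, hK₂, h₂⟩ := exists_moment_momentum_le (E := E) L l c hL hl hc A hA n
  obtain ⟨B, hB⟩ := exists_bound_of_slow_fast_recursion (K₁ + K₂) (l / 2) T W (by positivity)
    (by positivity)
  refine ⟨B, ?_⟩
  intro b κ _ hκ hbc hb Ω _ P _ x y N v σ η ε ρ lr β hD hN hη hη1 hε hε1 hρ hρ1 hερ hσ hlr hβ hβl
    hβε iy iN hW
  have hlrσ : ∀ k, (lr k * σ) ^ 2 ≤ Λ ^ 2 * η := fun k ↦ by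
    have h1 : lr k ^ 2 ≤ (Λ * η) ^ 2 := by
      rw [← sq_abs]
      exact pow_le_pow_left₀ (abs_nonneg _) (hlr k) 2
    calc (lr k * σ) ^ 2 = lr k ^ 2 * σ ^ 2 := by ring
      _ ≤ (Λ * η) ^ 2 * σ ^ 2 := by gcongr
      _ = Λ ^ 2 * η * (σ ^ 2 * η) := by ring
      _ ≤ Λ ^ 2 * η * 1 := by gcongr
      _ = _ := mul_one _
  have hint : ∀ k, Integrable (fun ω ↦ ‖y k ω‖ ^ (2 * (n + 1))) P ∧
      Integrable (fun ω ↦ ‖N k ω‖ ^ (2 * (n + 1))) P := by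
    intro k
    induction k with
    | zero => exact ⟨iy, iN⟩
    | succ k ih =>
      exact ⟨(h₁ b κ hκ hbc hb P x y N v σ η ρ lr k hD hη hη1 hρ hρ1 (hlr k) (hlrσ k) ih.1 ih.2).1,
        (h₂ b κ hκ hbc hb P x y N v σ η ε ρ (β k) lr k hD (hN k) hη hε hε1 hρ hρ1 hερ hσ (hβ k)
          (hβl k) (hβε k) ih.1 ih.2).1⟩
  intro k hk
  refine ⟨hint k, hB (fun k ↦ ∫ ω, ‖y k ω‖ ^ (2 * (n + 1)) ∂P)
    (fun k ↦ ∫ ω, ‖N k ω‖ ^ (2 * (n + 1)) ∂P) η ε ρ (fun k ↦ integral_nonneg fun _ ↦ by positivity)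
    (fun k ↦ integral_nonneg fun _ ↦ by positivity) hη hε hρ hρ1 hερ ?_ hW ?_ ?_ k hk⟩
  · linarith [hβl 0, hβ 0, mul_nonneg hl.le hε]
  · intro k
    have hi1 : 0 ≤ ∫ ω, ‖y k ω‖ ^ (2 * (n + 1)) ∂P := integral_nonneg fun _ ↦ by positivity
    have hi2 : 0 ≤ ∫ ω, ‖N k ω‖ ^ (2 * (n + 1)) ∂P := integral_nonneg fun _ ↦ by positivity
    refine (h₁ b κ hκ hbc hb P x y N v σ η ρ lr k hD hη hη1 hρ hρ1 (hlr k) (hlrσ k) (hint k).1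
      (hint k).2).2.trans ?_
    gcongr
    linarith
  · intro k
    have hi1 : 0 ≤ ∫ ω, ‖y k ω‖ ^ (2 * (n + 1)) ∂P := integral_nonneg fun _ ↦ by positivity
    have hi2 : 0 ≤ ∫ ω, ‖N k ω‖ ^ (2 * (n + 1)) ∂P := integral_nonneg fun _ ↦ by positivity
    refine (h₂ b κ hκ hbc hb P x y N v σ η ε ρ (β k) lr k hD (hN k) hη hε hε1 hρ hρ1 hερ hσ (hβ k)
      (hβl k) (hβε k) (hint k).1 (hint k).2).2.trans ?_
    gcongr <;> linarith

/-- Uniform moment bounds for gradient descent without momentum. -/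
theorem exists_moment_bound_descent (L Λ : ℝ) (hL : 0 ≤ L) (hΛ : 0 ≤ Λ)
    (A : ℕ → ℝ) (hA : ∀ m, 0 ≤ A m) (n : ℕ) (T W : ℝ) :
    ∃ B : ℝ, ∀ (b : E → E) (κ : Kernel E E)
      [IsMarkovKernel κ], CenteredNoise A κ → Continuous b → (∀ x, ‖b x‖ ≤ L * (1 + ‖x‖)) →
      ∀ {Ω : Type*} [MeasurableSpace Ω] (P : Measure Ω) [IsProbabilityMeasure P]
      (z v : ℕ → Ω → E) (σ η : ℝ) (lr : ℕ → ℝ),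
      PerturbedDescent b κ σ lr 0 P z z (fun _ _ ↦ 0) v →
      0 ≤ η → η ≤ 1 → σ ^ 2 * η ≤ 1 → (∀ k, |lr k| ≤ Λ * η) →
      Integrable (fun ω ↦ ‖z 0 ω‖ ^ (2 * (n + 1))) P →
      1 + ∫ ω, ‖z 0 ω‖ ^ (2 * (n + 1)) ∂P ≤ W →
      ∀ k : ℕ, k * η ≤ T → Integrable (fun ω ↦ ‖z k ω‖ ^ (2 * (n + 1))) P ∧
        ∫ ω, ‖z k ω‖ ^ (2 * (n + 1)) ∂P ≤ B := by
  obtain ⟨K₁, hK₁, h₁⟩ := exists_moment_descent_le (E := E) L Λ 0 hL hΛ le_rfl A hA n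
  obtain ⟨B, hB⟩ := exists_bound_of_slow_fast_recursion K₁ 1 T W hK₁ one_pos
  refine ⟨B, ?_⟩
  intro b κ _ hκ hbc hb Ω _ P _ z v σ η lr hD hη hη1 hσ hlr iz hW
  have hlrσ : ∀ k, (lr k * σ) ^ 2 ≤ Λ ^ 2 * η := fun k ↦ by
    have h1 : lr k ^ 2 ≤ (Λ * η) ^ 2 := by
      rw [← sq_abs]
      exact pow_le_pow_left₀ (abs_nonneg _) (hlr k) 2
    calc (lr k * σ) ^ 2 = lr k ^ 2 * σ ^ 2 := by ring
      _ ≤ (Λ * η) ^ 2 * σ ^ 2 := by gcongr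
      _ = Λ ^ 2 * η * (σ ^ 2 * η) := by ring
      _ ≤ Λ ^ 2 * η * 1 := by gcongr
      _ = _ := mul_one _
  have hD' : PerturbedDescent b κ σ lr (0 * 1) P z z (fun _ _ ↦ 0) v := by simpa using hD
  have hstep := fun k ↦ h₁ b κ hκ hbc hb P z z (fun _ _ ↦ 0) v σ η 1 lr k hD' hη hη1 zero_le_one
    le_rfl (hlr k) (hlrσ k)
  have hint : ∀ k, Integrable (fun ω ↦ ‖z k ω‖ ^ (2 * (n + 1))) P := by
    intro k
    induction k with
    | zero => exact iz
    | succ k ih => exact (hstep k ih (by simp)).1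
  intro k hk
  -- Without momentum the fast variable vanishes, and ε = η, ρ = 1 satisfy ε ρ² = η.
  refine ⟨hint k, (hB (fun k ↦ ∫ ω, ‖z k ω‖ ^ (2 * (n + 1)) ∂P) (fun _ ↦ 0) η η 1
    (fun k ↦ integral_nonneg fun _ ↦ by positivity) (fun _ ↦ le_rfl) hη hη zero_le_one le_rfl
    (by ring) (by linarith) (by simpa using hW) (fun k ↦ ?_) (fun k ↦ ?_) k hk).1⟩
  · simpa using (hstep k (hint k) (by simp)).2
  · have hi1 : 0 ≤ ∫ ω, ‖z k ω‖ ^ (2 * (n + 1)) ∂P := integral_nonneg fun _ ↦ by positivity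
    simp only [mul_zero, zero_add]
    positivity

end Moments

/-! ### Weak error of perturbed gradient descent -/

theorem integrable_and_integral_one_add_add {Ω : Type*} [MeasurableSpace Ω] {P : Measure Ω}
    [IsProbabilityMeasure P] {f g : Ω → ℝ} (hf : Integrable f P) (hg : Integrable g P) :
    Integrable (fun ω ↦ 1 + f ω + g ω) P ∧
      ∫ ω, (1 + f ω + g ω) ∂P = 1 + ∫ ω, f ω ∂P + ∫ ω, g ω ∂P := by
  have h1 : Integrable (fun ω ↦ 1 + f ω) P := (integrable_const _).add hf
  refine ⟨h1.add hg, ?_⟩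
  rw [integral_add h1 hg, integral_add (integrable_const _) hf]
  simp

section WeakError

variable {E : Type*} [NormedAddCommGroup E] [InnerProductSpace ℝ E]

theorem JetBound.mono {N : ℕ} {M M' : ℝ} {u : E → ℝ} (h : JetBound N M u) (hM : M ≤ M') :
    JetBound N M' u :=
  ⟨h.smooth, fun γ hγ t j hj ↦ (h.bound γ hγ t j hj).trans
    (mul_le_mul_of_nonneg_right hM (zero_le_one.trans (one_le_jetWeight N γ t)))⟩

theorem JetBound.abs_sub_le {N : ℕ} {M : ℝ} {u : E → ℝ} (h : JetBound N M u) (x y : E) :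
    |u x - u y| ≤ 2 * M * (1 + (‖y‖ + ‖x - y‖) ^ (2 * (N + 1))) * ‖x - y‖ := by
  have hM := h.nonneg
  have hd : Differentiable ℝ u := h.smooth.differentiable (by simp)
  refine Convex.norm_image_sub_le_of_norm_fderiv_le (𝕜 := ℝ) (s := segment ℝ y x)
    (fun z _ ↦ hd z) (fun z hz ↦ ?_) (convex_segment y x) (left_mem_segment ℝ y x)
    (right_mem_segment ℝ y x)
  have hz' : ‖z‖ ≤ ‖y‖ + ‖x - y‖ := by
    have h1 : ‖z - y‖ ≤ ‖x - y‖ := by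
      obtain ⟨t, ht, rfl⟩ := (segment_eq_image' ℝ y x ▸ hz :)
      rw [add_sub_cancel_left, norm_smul, Real.norm_of_nonneg ht.1]
      exact mul_le_of_le_one_left (norm_nonneg _) ht.2
    have : ‖z‖ ≤ ‖y‖ + ‖z - y‖ := by
      simpa [add_comm] using norm_le_norm_add_norm_sub' z y
    linarith
  refine ContinuousLinearMap.opNorm_le_bound _ (by positivity) fun v ↦ ?_
  refine (h.abs_fderiv_le z v).trans ?_
  gcongr

variable {ι : Type*} [Fintype ι]

/-- The expectation of `u` after `j` steps of the two-point scheme, as a function of the state at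
time `k`. -/
noncomputable def signedEvolution (b : E → E) (s : ι → E → E) (lr τ : ℕ → ℝ) (u : E → ℝ) :
    ℕ → ℕ → E → ℝ
  | 0, _ => u
  | j + 1, k => signedStep b s (lr k) (τ k) (signedEvolution b s lr τ u j (k + 1))

/-- A factor 1 + Cη for each of at most T/η steps accumulates to at most exp(CT), independently of
η. -/
theorem exists_jetBound_signedEvolution (L Λ : ℝ) (hL : 0 ≤ L) (hΛ : 0 ≤ Λ) (q N : ℕ)
    (hq : 6 * q ≤ N + 1) (T : ℝ) : ∃ C : ℝ, 1 ≤ C ∧ ∀ {ι : Type*} [Fintype ι] [Nonempty ι]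
    (b : E → E) (s : ι → E → E) (η M : ℝ) (lr τ : ℕ → ℝ) (u : E → ℝ),
    RegularField L q b → (∀ i, RegularField L q (s i)) → 0 ≤ η → η ≤ 1 →
    (∀ k, |lr k| ≤ Λ * η) → (∀ k, τ k ^ 2 ≤ Λ ^ 2 * η) → JetBound N M u →
    ∀ j k : ℕ, j * η ≤ T → JetBound N (C * M) (signedEvolution b s lr τ u j k) := by
  obtain ⟨C, hC, h⟩ := exists_jetBound_signedStep (E := E) L Λ hL hΛ q N hq
  refine ⟨max 1 (Real.exp (C * T)), le_max_left _ _, ?_⟩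
  intro ι _ _ b s η M lr τ u hb hs hη hη1 hlr hτ hu
  have hM := hu.nonneg
  have key : ∀ j k : ℕ, JetBound N (M * (1 + C * η) ^ j) (signedEvolution b s lr τ u j k) := by
    intro j
    induction j with
    | zero => intro k; simpa [signedEvolution] using hu
    | succ j ih =>
      intro k
      rw [pow_succ, ← mul_assoc]
      exact h b s η (lr k) (τ k) _ _ hb hs hη hη1 (hlr k) (hτ k) (by positivity) (ih (k + 1))
  intro j k hj
  refine (key j k).mono ?_
  rw [mul_comm]
  refine mul_le_mul_of_nonneg_right ((?_ : _ ≤ Real.exp (C * T)).trans (le_max_right _ _)) hM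
  calc (1 + C * η) ^ j ≤ Real.exp (C * η) ^ j := by
        gcongr
        linarith [Real.add_one_le_exp (C * η)]
    _ = Real.exp (C * (j * η)) := by rw [← Real.exp_nat_mul]; ring_nf
    _ ≤ _ := by gcongr

theorem PerturbedDescent.aemeasurable [MeasurableSpace E] {b : E → E} {κ : Kernel E E} {σ c : ℝ}
    {lr : ℕ → ℝ} {Ω : Type*} [MeasurableSpace Ω] {P : Measure Ω} {x y n v : ℕ → Ω → E}
    (h : PerturbedDescent b κ σ lr c P x y n v) (k : ℕ) :
    AEMeasurable (x k) P ∧ AEMeasurable (y k) P ∧ AEMeasurable (n k) P :=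
  have h1 := (h.cond k).aemeasurable_fst
  ⟨measurable_fst.comp_aemeasurable h1,
    (measurable_fst.comp measurable_snd).comp_aemeasurable h1,
    (measurable_snd.comp measurable_snd).comp_aemeasurable h1⟩

variable [MeasurableSpace E] [BorelSpace E]

theorem JetBound.integrable_comp {N : ℕ} {M : ℝ} {u : E → ℝ} (h : JetBound N M u) {Ω : Type*}
    [MeasurableSpace Ω] {P : Measure Ω} [IsProbabilityMeasure P] {y : Ω → E}
    (hy : AEMeasurable y P) (hi : Integrable (fun ω ↦ ‖y ω‖ ^ (2 * (N + 3))) P) :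
    Integrable (fun ω ↦ u (y ω)) P := by
  have hM := h.nonneg
  refine (((integrable_const (2 : ℝ)).add hi).const_mul M).mono'
    (h.smooth.continuous.measurable.comp_aemeasurable hy).aestronglyMeasurable
    (.of_forall fun ω ↦ (h.abs_le _).trans ?_)
  have := pow_le_one_add_pow (norm_nonneg (y ω)) (show 2 * (N + 1) ≤ 2 * (N + 3) by omega)
  refine mul_le_mul_of_nonneg_left ?_ hM
  simp only [Pi.add_apply]
  linarith

/-- The price of exchanging `x` for `y` inside an expectation. It is O(ρ), so it is affordable only
at the two ends of the time interval and not once per step. -/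
theorem exists_abs_integral_sub_le (c : ℝ) (hc : 0 ≤ c) (N : ℕ) : ∃ K : ℝ, 0 ≤ K ∧
    ∀ {Ω : Type*} [MeasurableSpace Ω] (P : Measure Ω) [IsProbabilityMeasure P] (x y n : Ω → E)
      (ρ M : ℝ) (u : E → ℝ), JetBound N M u → AEMeasurable x P → AEMeasurable y P → 0 ≤ ρ → ρ ≤ 1 →
      (∀ ω, ‖x ω - y ω‖ ≤ c * ρ * ‖n ω‖) →
      Integrable (fun ω ↦ ‖y ω‖ ^ (2 * (N + 3))) P →
      Integrable (fun ω ↦ ‖n ω‖ ^ (2 * (N + 3))) P →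
      Integrable (fun ω ↦ u (x ω)) P ∧ |∫ ω, u (x ω) ∂P - ∫ ω, u (y ω) ∂P| ≤
        K * M * ρ * (1 + ∫ ω, ‖y ω‖ ^ (2 * (N + 3)) ∂P + ∫ ω, ‖n ω‖ ^ (2 * (N + 3)) ∂P) := by
  refine ⟨4 * (1 + c) ^ (2 * (N + 3)) * 4 ^ (2 * (N + 3)), by positivity, ?_⟩
  intro Ω _ P _ x y n ρ M u hu hx hy hρ hρ1 hxy iy iN
  have hM := hu.nonneg
  have huy := hu.integrable_comp hy iy
  have hb : ∀ ω, |u (x ω) - u (y ω)| ≤ 4 * (1 + c) ^ (2 * (N + 3)) * 4 ^ (2 * (N + 3)) * M * ρ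
      * (1 + ‖y ω‖ ^ (2 * (N + 3)) + ‖n ω‖ ^ (2 * (N + 3))) := by
    intro ω
    set R := (1 + c) * (1 + ‖y ω‖ + ‖n ω‖) with hR
    have hn0 := norm_nonneg (n ω)
    have hy0 := norm_nonneg (y ω)
    have hcn : 0 ≤ c * ‖n ω‖ := by positivity
    have hcy : 0 ≤ c * ‖y ω‖ := by positivity
    have hR1 : 1 ≤ R := by rw [hR]; linarith
    have h1 : ‖x ω - y ω‖ ≤ ρ * R := by
      calc _ ≤ c * ρ * ‖n ω‖ := hxy ω
        _ = ρ * (c * ‖n ω‖) := by ring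
        _ ≤ ρ * R := by gcongr; rw [hR]; linarith
    have h2 : ‖y ω‖ + ‖x ω - y ω‖ ≤ R := by
      have : c * ρ * ‖n ω‖ ≤ c * ‖n ω‖ := by
        rw [mul_right_comm]; exact mul_le_of_le_one_right hcn hρ1
      have := hxy ω
      rw [hR]; linarith
    have h3 : R ^ (2 * (N + 1)) * R ≤ R ^ (2 * (N + 3)) := by
      rw [← pow_succ]; exact pow_le_pow_right₀ hR1 (by omega)
    have h4 : R ≤ R ^ (2 * (N + 1)) * R :=
      le_mul_of_one_le_left (by linarith) (one_le_pow₀ hR1)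
    calc |u (x ω) - u (y ω)|
        ≤ 2 * M * (1 + (‖y ω‖ + ‖x ω - y ω‖) ^ (2 * (N + 1))) * ‖x ω - y ω‖ := hu.abs_sub_le _ _
      _ ≤ 2 * M * (1 + R ^ (2 * (N + 1))) * (ρ * R) := by gcongr
      _ = 2 * M * ρ * (R + R ^ (2 * (N + 1)) * R) := by ring
      _ ≤ 2 * M * ρ * (R ^ (2 * (N + 3)) + R ^ (2 * (N + 3))) := by
        gcongr
        exact h4.trans h3
      _ = 4 * M * ρ * ((1 + c) ^ (2 * (N + 3)) * (1 + ‖y ω‖ + ‖n ω‖) ^ (2 * (N + 3))) := by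
        rw [← mul_pow]; ring
      _ ≤ 4 * M * ρ * ((1 + c) ^ (2 * (N + 3))
          * (4 ^ (2 * (N + 3)) * (1 + ‖y ω‖ ^ (2 * (N + 3)) + ‖n ω‖ ^ (2 * (N + 3))))) := by
        gcongr
        exact one_add_add_pow_le hy0 hn0 _
      _ = _ := by ring
  have hi : Integrable (fun ω ↦ 4 * (1 + c) ^ (2 * (N + 3)) * 4 ^ (2 * (N + 3)) * M * ρ
      * (1 + ‖y ω‖ ^ (2 * (N + 3)) + ‖n ω‖ ^ (2 * (N + 3)))) P :=
    (integrable_and_integral_one_add_add iy iN).1.const_mul _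
  have hm : AEStronglyMeasurable (fun ω ↦ u (x ω)) P :=
    (hu.smooth.continuous.measurable.comp_aemeasurable hx).aestronglyMeasurable
  have hd : Integrable (fun ω ↦ u (x ω) - u (y ω)) P :=
    hi.mono' (hm.sub huy.aestronglyMeasurable) (.of_forall hb)
  have hux : Integrable (fun ω ↦ u (x ω)) P := by
    exact (hd.add huy).congr (.of_forall fun ω ↦ sub_add_cancel _ _)
  refine ⟨hux, ?_⟩
  rw [← integral_sub hux huy, ← Real.norm_eq_abs]
  refine (norm_integral_le_of_norm_le hi (.of_forall hb)).trans_eq ?_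
  rw [integral_const_mul, (integrable_and_integral_one_add_add iy iN).2]

variable [CompleteSpace E] [SecondCountableTopology E]

/-- The local error: the pointwise one-step estimate with r = √η, integrated over the current state.
The factor η ρ is what survives summation over T/η steps. -/
theorem exists_abs_integral_descent_sub_le (L Λ A c : ℝ) (hL : 0 ≤ L) (hΛ : 0 ≤ Λ) (hA : 0 ≤ A)
    (hc : 0 ≤ c) (N m : ℕ) : ∃ K : ℝ, 0 ≤ K ∧ ∀ {ι : Type*} [Fintype ι] [Nonempty ι]
      (b : E → E) (s : ι → E → E) (κ : Kernel E E) [IsMarkovKernel κ], Fintype.card ι ≤ m →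
      (∀ x, ‖b x‖ ≤ L * (1 + ‖x‖)) → (∀ x y, ‖b x - b y‖ ≤ L * ‖x - y‖) →
      (∀ i x, ‖s i x‖ ≤ L) → (∀ i x y, ‖s i x - s i y‖ ≤ L * ‖x - y‖) →
      (∀ x, ∫ v, v ∂(κ x) = 0) →
      (∀ x, ∀ B : E →L[ℝ] E →L[ℝ] ℝ, ∫ v, B v v ∂(κ x) = ∑ i, B (s i x) (s i x)) →
      (∀ x, Integrable (fun v ↦ ‖v‖ ^ (2 * (N + 3))) (κ x)) →
      (∀ x, ∫ v, ‖v‖ ^ (2 * (N + 3)) ∂(κ x) ≤ (A * (1 + ‖x‖)) ^ (2 * (N + 3))) →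
      ∀ {Ω : Type*} [MeasurableSpace Ω] (P : Measure Ω) [IsProbabilityMeasure P]
      (x y n v : ℕ → Ω → E) (σ η ρ : ℝ) (lr : ℕ → ℝ) (k : ℕ) (M M' : ℝ) (u : E → ℝ),
      PerturbedDescent b κ σ lr (c * ρ) P x y n v → JetBound N M u →
      JetBound N M' (signedStep b s (lr k) (lr k * σ * √(Fintype.card ι)) u) →
      0 ≤ η → 0 ≤ ρ → ρ ≤ 1 → η ≤ ρ ^ 2 → |lr k| ≤ Λ * η → σ ^ 2 * η ≤ 1 →
      Integrable (fun ω ↦ ‖y k ω‖ ^ (2 * (N + 3))) P →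
      Integrable (fun ω ↦ ‖n k ω‖ ^ (2 * (N + 3))) P →
      Integrable (fun ω ↦ ‖y (k + 1) ω‖ ^ (2 * (N + 3))) P →
      |∫ ω, u (y (k + 1) ω) ∂P
        - ∫ ω, signedStep b s (lr k) (lr k * σ * √(Fintype.card ι)) u (y k ω) ∂P| ≤
        K * M * η * ρ
          * (1 + ∫ ω, ‖y k ω‖ ^ (2 * (N + 3)) ∂P + ∫ ω, ‖n k ω‖ ^ (2 * (N + 3)) ∂P) := by
  obtain ⟨K, hK, h⟩ := exists_abs_integral_step_sub_signedStep_le (E := E) L Λ A c hL hΛ hA hc N m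
  refine ⟨K * 4 ^ (2 * (N + 3)), by positivity, ?_⟩
  intro ι _ _ b s κ _ hm hb hbL hs hsL h0 hB hκi hκA Ω _ P _ x y n v σ η ρ lr k M M' u hD hu hu' hη
    hρ hρ1 hηρ hlr hσ iy iN iy'
  have hM := hu.nonneg
  obtain ⟨-, my, -⟩ := hD.aemeasurable k
  have iu := hu.integrable_comp (hD.aemeasurable (k + 1)).2.1 iy'
  have iu' := hu'.integrable_comp my iy
  have hbc : Continuous b :=
    (LipschitzWith.of_dist_le_mul (K := L.toNNReal) fun x y ↦ by
      simpa [dist_eq_norm, hL] using hbL x y).continuous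
  have huc := hu.smooth.continuous
  set F : (E × E × E) × E → ℝ := fun p ↦ u (p.1.2.1 - lr k • (b p.1.1 + σ • p.2)) with hF
  have hFm : Measurable F := by
    simp only [hF]
    exact Continuous.measurable (by fun_prop)
  have iF : Integrable (fun ω ↦ F ((x k ω, y k ω, n k ω), v k ω)) P := by
    simpa only [hF, ← hD.step] using iu
  obtain ⟨i1, e1⟩ := (hD.cond k).integrable_and_integral_eq hFm iF
  simp only [hF, ← hD.step, Kernel.comap_apply] at e1 i1
  have hr : √η ≤ ρ := by
    rw [← Real.sqrt_sq hρ]; exact Real.sqrt_le_sqrt hηρ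
  have hr2 : √η ^ 2 = η := Real.sq_sqrt hη
  have hrσ : √η * |σ| ≤ 1 := by
    rw [← abs_of_nonneg (Real.sqrt_nonneg η), ← abs_mul]
    refine (sq_le_one_iff_abs_le_one _).1 ?_
    rw [mul_pow, hr2, mul_comm]; exact hσ
  have hlrσ : |lr k * σ| ≤ Λ * √η := by
    rw [abs_mul]
    calc |lr k| * |σ| ≤ Λ * η * |σ| := by gcongr
      _ = Λ * √η * (√η * |σ|) := by nth_rw 1 [← hr2]; ring
      _ ≤ Λ * √η * 1 := by gcongr
      _ = _ := mul_one _
  have hbd : ∀ ω, |∫ e, u (y k ω - lr k • (b (x k ω) + σ • e)) ∂(κ (x k ω))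
      - signedStep b s (lr k) (lr k * σ * √(Fintype.card ι)) u (y k ω)| ≤
      K * 4 ^ (2 * (N + 3)) * M * η * ρ
        * (1 + ‖y k ω‖ ^ (2 * (N + 3)) + ‖n k ω‖ ^ (2 * (N + 3))) := by
    intro ω
    refine (h b s hm hb hbL hs hsL (κ (x k ω)) (x k ω) (y k ω) (n k ω) (lr k) σ (√η) ρ M u hu
      (Real.sqrt_nonneg _) hr hρ1 (by rwa [hr2]) hlrσ ((hD.near k ω).trans_eq (mul_assoc _ _ _))
      (h0 _) (hB _) (hκi _) (hκA _)).trans ?_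
    rw [hr2]
    calc _ ≤ K * M * η * ρ
          * (4 ^ (2 * (N + 3)) * (1 + ‖y k ω‖ ^ (2 * (N + 3)) + ‖n k ω‖ ^ (2 * (N + 3)))) := by
          gcongr
          exact one_add_add_pow_le (norm_nonneg _) (norm_nonneg _) _
      _ = _ := by ring
  have hi : Integrable (fun ω ↦ K * 4 ^ (2 * (N + 3)) * M * η * ρ
      * (1 + ‖y k ω‖ ^ (2 * (N + 3)) + ‖n k ω‖ ^ (2 * (N + 3)))) P :=
    (integrable_and_integral_one_add_add iy iN).1.const_mul _
  rw [e1, ← integral_sub i1 iu', ← Real.norm_eq_abs]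
  refine (norm_integral_le_of_norm_le hi (.of_forall hbd)).trans_eq ?_
  rw [integral_const_mul, (integrable_and_integral_one_add_add iy iN).2]

end WeakError

/-! ### Summation of the local errors up to time T -/

section WeakErrorGlobal

variable {E : Type*} [NormedAddCommGroup E] [InnerProductSpace ℝ E]

/-- Drift `b`, diffusion directions `s` and noise kernel `κ` satisfying the regularity conditions
used in the weak error analysis, with covariance of the noise equal to `∑ i, s i ⊗ s i`. -/
structure RegularDiffusion [MeasurableSpace E] {ι : Type*} [Fintype ι] (L : ℝ) (q : ℕ) (A : ℕ → ℝ)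
    (b : E → E) (s : ι → E → E) (κ : Kernel E E) : Prop where
  drift : RegularField L q b
  drift_lipschitz : ∀ x y, ‖b x - b y‖ ≤ L * ‖x - y‖
  diffusion : ∀ i, RegularField L q (s i)
  diffusion_le : ∀ i x, ‖s i x‖ ≤ L
  diffusion_lipschitz : ∀ i x y, ‖s i x - s i y‖ ≤ L * ‖x - y‖
  noise : CenteredNoise A κ
  covariance : ∀ x, ∀ B : E →L[ℝ] E →L[ℝ] ℝ, ∫ v, B v v ∂(κ x) = ∑ i, B (s i x) (s i x)

variable [CompleteSpace E] [MeasurableSpace E] [BorelSpace E] [SecondCountableTopology E]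

/-- Perturbed gradient descent started at `x₀` agrees weakly, up to `O(ρ)`, with the two-point
scheme started at `x₀`. -/
theorem exists_abs_integral_sub_signedEvolution_le (L Λ c : ℝ) (hL : 0 ≤ L) (hΛ : 0 ≤ Λ)
    (hc : 0 ≤ c) (A : ℕ → ℝ) (hA : ∀ m, 0 ≤ A m) (q N m : ℕ) (hq : 6 * q ≤ N + 1) (T : ℝ)
    (hT : 0 ≤ T) (W : ℝ) :
    ∃ K : ℝ, 0 ≤ K ∧ ∀ {ι : Type*} [Fintype ι] [Nonempty ι]
      (b : E → E) (s : ι → E → E) (κ : Kernel E E) [IsMarkovKernel κ], Fintype.card ι ≤ m →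
      RegularDiffusion L q A b s κ →
      ∀ {Ω : Type*} [MeasurableSpace Ω] (P : Measure Ω) [IsProbabilityMeasure P]
      (x y n v : ℕ → Ω → E) (x₀ : E) (σ η ρ : ℝ) (lr : ℕ → ℝ) (M : ℝ) (u : E → ℝ),
      PerturbedDescent b κ σ lr (c * ρ) P x y n v → (∀ ω, x 0 ω = x₀) → JetBound N M u →
      0 ≤ η → 0 ≤ ρ → ρ ≤ 1 → η ≤ ρ ^ 2 → (∀ k, |lr k| ≤ Λ * η) → σ ^ 2 * η ≤ 1 →
      (∀ k : ℕ, k * η ≤ T → Integrable (fun ω ↦ ‖y k ω‖ ^ (2 * (N + 3))) P ∧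
        Integrable (fun ω ↦ ‖n k ω‖ ^ (2 * (N + 3))) P) →
      (∀ k : ℕ, k * η ≤ T → ∫ ω, ‖y k ω‖ ^ (2 * (N + 3)) ∂P ≤ W ∧
        ∫ ω, ‖n k ω‖ ^ (2 * (N + 3)) ∂P ≤ W) →
      ∀ k : ℕ, k * η ≤ T → Integrable (fun ω ↦ u (x k ω)) P ∧
        |∫ ω, u (x k ω) ∂P - signedEvolution b s lr (fun k ↦ lr k * σ * √(Fintype.card ι)) u k 0 x₀|
          ≤ K * M * ρ := by
  obtain ⟨C, hC, hev⟩ := exists_jetBound_signedEvolution (E := E) L (Λ * √m + Λ) hL (by positivity)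
    q N hq T
  obtain ⟨K₁, hK₁, h₁⟩ := exists_abs_integral_sub_le (E := E) c hc N
  obtain ⟨K₂, hK₂, h₂⟩ := exists_abs_integral_descent_sub_le (E := E) L Λ (A (N + 3)) c hL hΛ
    (hA _) hc N m
  refine ⟨(K₁ * (1 + C) + T * (K₂ * C)) * (1 + |W| + |W|), by positivity, ?_⟩
  intro ι _ _ b s κ _ hm hR Ω _ P _ x y n v x₀ σ η ρ lr M u hD hx0 hu hη hρ hρ1 hηρ hlr hσ hi hW
  have hM := hu.nonneg
  have hη1 : η ≤ 1 := hηρ.trans (pow_le_one₀ hρ hρ1)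
  set τ : ℕ → ℝ := fun k ↦ lr k * σ * √(Fintype.card ι) with hτ
  have hτ2 : ∀ k, τ k ^ 2 ≤ (Λ * √m + Λ) ^ 2 * η := by
    intro k
    have h1 : lr k ^ 2 ≤ (Λ * η) ^ 2 := by
      rw [← sq_abs]
      exact pow_le_pow_left₀ (abs_nonneg _) (hlr k) 2
    have h2 : (√(Fintype.card ι)) ^ 2 ≤ m := by
      rw [Real.sq_sqrt (by positivity)]; exact_mod_cast hm
    have h3 : 0 ≤ Λ * √m := by positivity
    calc τ k ^ 2 = lr k ^ 2 * σ ^ 2 * (√(Fintype.card ι)) ^ 2 := by rw [hτ]; ring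
      _ ≤ (Λ * η) ^ 2 * σ ^ 2 * m := by gcongr
      _ = (Λ ^ 2 * η * m) * (σ ^ 2 * η) := by ring
      _ ≤ (Λ ^ 2 * η * m) * 1 := by gcongr
      _ = (Λ * √m) ^ 2 * η := by rw [mul_pow, Real.sq_sqrt (by positivity)]; ring
      _ ≤ _ := by gcongr; linarith
  have hJ := hev b s η M lr τ u hR.drift hR.diffusion hη hη1
    (fun k ↦ (hlr k).trans (by gcongr; exact le_add_of_nonneg_left (by positivity))) hτ2 hu
  have hV : ∀ k : ℕ, k * η ≤ T → 1 + ∫ ω, ‖y k ω‖ ^ (2 * (N + 3)) ∂P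
      + ∫ ω, ‖n k ω‖ ^ (2 * (N + 3)) ∂P ≤ 1 + |W| + |W| := fun k hk ↦
    add_le_add (add_le_add le_rfl ((hW k hk).1.trans (le_abs_self W)))
      ((hW k hk).2.trans (le_abs_self W))
  -- Telescoping by induction on `j` with `k` free: the step of `y` from time `k` is exchanged for
  -- one step of the two-point scheme, tested against the function evolved over the remaining `j`
  -- steps.
  have tele : ∀ j k : ℕ, ((k + j : ℕ) : ℝ) * η ≤ T →
      |∫ ω, u (y (k + j) ω) ∂P - ∫ ω, signedEvolution b s lr τ u j k (y k ω) ∂P| ≤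
        j * (K₂ * (C * M) * η * ρ * (1 + |W| + |W|)) := by
    intro j
    induction j with
    | zero => intro k _; simp [signedEvolution]
    | succ j ih =>
      intro k hk
      have e : k + (j + 1) = (k + 1) + j := by ring
      rw [e] at hk ⊢
      have mono : ∀ i : ℕ, i ≤ k + 1 + j → (i : ℝ) * η ≤ T := fun i hi' ↦
        (mul_le_mul_of_nonneg_right (by exact_mod_cast hi') hη).trans hk
      have hk0 := mono k (by omega)
      have hk1 := mono (k + 1) (by omega)
      have step := h₂ b s κ hm hR.drift.growth hR.drift_lipschitz hR.diffusion_le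
        hR.diffusion_lipschitz hR.noise.mean hR.covariance
        (hR.noise.integrable _ (by omega)) (hR.noise.moment _ (by omega)) P x y n v σ η ρ lr k _ _ _
        hD (hJ j (k + 1) (mono j (by omega))) (hJ (j + 1) k (mono (j + 1) (by omega))) hη hρ hρ1 hηρ
        (hlr k) hσ (hi k hk0).1 (hi k hk0).2 (hi (k + 1) hk1).1
      have step' := step.trans (mul_le_mul_of_nonneg_left (hV k hk0) (by positivity))
      have := abs_sub_le (∫ ω, u (y (k + 1 + j) ω) ∂P)
        (∫ ω, signedEvolution b s lr τ u j (k + 1) (y (k + 1) ω) ∂P)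
        (∫ ω, signedEvolution b s lr τ u (j + 1) k (y k ω) ∂P)
      refine this.trans ((add_le_add (ih (k + 1) hk) step').trans_eq ?_)
      push_cast
      ring
  intro k hk
  have hk0 : ((0 : ℕ) : ℝ) * η ≤ T := by simpa using hT
  have near : ∀ (i : ℕ) ω, ‖x i ω - y i ω‖ ≤ c * ρ * ‖n i ω‖ := hD.near
  have hme := hD.aemeasurable
  obtain ⟨ik, ek⟩ := h₁ P (x k) (y k) (n k) ρ M u hu (hme k).1 (hme k).2.1 hρ hρ1 (near k)
    (hi k hk).1 (hi k hk).2
  -- For SGDM, `y 0` is shifted from `x₀` by the random initial momentum, so the evolved function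
  -- must be moved to `x₀`.
  obtain ⟨-, e0⟩ := h₁ P (x 0) (y 0) (n 0) ρ _ _ (hJ k 0 hk) (hme 0).1 (hme 0).2.1 hρ hρ1 (near 0)
    (hi 0 hk0).1 (hi 0 hk0).2
  have et := tele k 0 (by simpa using hk)
  rw [zero_add] at et
  simp only [hx0, integral_const, probReal_univ, one_smul] at e0
  refine ⟨ik, ?_⟩
  have a1 := ek.trans (mul_le_mul_of_nonneg_left (hV k hk) (by positivity))
  have a2 := e0.trans (mul_le_mul_of_nonneg_left (hV 0 hk0) (by positivity))
  have a3 : k * (K₂ * (C * M) * η * ρ * (1 + |W| + |W|))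
      ≤ T * (K₂ * C * M * ρ * (1 + |W| + |W|)) := by
    calc _ = (k * η) * (K₂ * C * M * ρ * (1 + |W| + |W|)) := by ring
      _ ≤ _ := by gcongr
  have b1 := abs_sub_le (∫ ω, u (x k ω) ∂P) (∫ ω, u (y k ω) ∂P)
    (signedEvolution b s lr τ u k 0 x₀)
  have b2 := abs_sub_le (∫ ω, u (y k ω) ∂P) (∫ ω, signedEvolution b s lr τ u k 0 (y 0 ω) ∂P)
    (signedEvolution b s lr τ u k 0 x₀)
  rw [abs_sub_comm] at a2
  calc _ ≤ K₁ * M * ρ * (1 + |W| + |W|) + (T * (K₂ * C * M * ρ * (1 + |W| + |W|))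
        + K₁ * (C * M) * ρ * (1 + |W| + |W|)) := by linarith
    _ = _ := by ring

end WeakErrorGlobal

/-! ### Polynomial growth and test functions -/

/-- Both constants may be enlarged freely, so that finitely many growth bounds can share one pair.
-/
theorem HasPolynomialGrowth.exists_nat {E F : Type*} [NormedAddCommGroup E]
    [NormedAddCommGroup F] {g : E → F} (h : HasPolynomialGrowth g) :
    ∃ (K : ℝ) (k : ℕ), 0 ≤ K ∧ ∀ K' k', K ≤ K' → k ≤ k' → ∀ x, ‖g x‖ ≤ K' * (1 + ‖x‖ ^ k') := by
  obtain ⟨k₁, k₂, h1, h2, h⟩ := h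
  refine ⟨2 * k₁, ⌈k₂⌉₊, by positivity, fun K' k' hK hk x ↦ (h x).trans ?_⟩
  have h3 : ‖x‖ ^ k₂ ≤ 1 + ‖x‖ ^ k' := by
    rcases le_total ‖x‖ 1 with hx | hx
    · have := Real.rpow_le_one (norm_nonneg x) hx h2.le
      have : 0 ≤ ‖x‖ ^ k' := by positivity
      linarith
    · rw [← Real.rpow_natCast]
      have : ‖x‖ ^ k₂ ≤ ‖x‖ ^ (k' : ℝ) :=
        Real.rpow_le_rpow_of_exponent_le hx ((Nat.le_ceil k₂).trans (by exact_mod_cast hk))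
      linarith
  have h4 : 0 ≤ ‖x‖ ^ k' := by positivity
  calc k₁ * (1 + ‖x‖ ^ k₂) ≤ k₁ * (2 * (1 + ‖x‖ ^ k')) := by gcongr; linarith
    _ = 2 * k₁ * (1 + ‖x‖ ^ k') := by ring
    _ ≤ _ := by gcongr

theorem exists_uniform_growth {E : Type*} [NormedAddCommGroup E] [NormedSpace ℝ E] {F : Type*}
    [NormedAddCommGroup F] [NormedSpace ℝ F] {f : E → F}
    (h : ∀ n : ℕ, n ≤ 3 → HasPolynomialGrowth (iteratedFDeriv ℝ n f)) :
    ∃ (K : ℝ) (k : ℕ), 0 ≤ K ∧ ∀ K' k', K ≤ K' → k ≤ k' → ∀ n ≤ 3, ∀ x,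
      ‖iteratedFDeriv ℝ n f x‖ ≤ K' * (1 + ‖x‖ ^ k') := by
  choose! K k hK hg using fun n (hn : n ≤ 3) ↦ (h n hn).exists_nat
  refine ⟨∑ n ∈ Finset.range 4, K n, ∑ n ∈ Finset.range 4, k n,
    Finset.sum_nonneg fun n hn ↦ hK n (by simp at hn; omega), fun K' k' hK' hk' n hn ↦
    hg n hn K' k' ?_ ?_⟩
  · exact (Finset.single_le_sum (f := K) (fun n hn ↦ hK n (by simp at hn; omega))
      (Finset.mem_range.2 (by omega))).trans hK'
  · exact (Finset.single_le_sum (f := k) (fun n hn ↦ Nat.zero_le _)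
      (Finset.mem_range.2 (by omega))).trans hk'

/-- The chain rules bound the derivatives by products of the growth factor `w` and the jet; ab ≤ a²
+ b² separates these into powers below those of the weight. The constant 28 is dictated by order
three. -/
theorem jetBound_of_growth {E : Type*} [NormedAddCommGroup E] [InnerProductSpace ℝ E] {h : E → ℝ}
    {K : ℝ} {q N : ℕ} (hK : 0 ≤ K) (hs : ContDiff ℝ (⊤ : ℕ∞) h)
    (hg : ∀ n ≤ 3, ∀ x, ‖iteratedFDeriv ℝ n h x‖ ≤ K * (1 + ‖x‖ ^ q)) (hq : q ≤ N + 1) :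
    JetBound N (28 * K) h := by
  refine ⟨hs, fun γ hγ t j hj ↦ ?_⟩
  have g0 := hg 0 (by omega) (γ t)
  have g1 := hg 1 (by omega) (γ t)
  have g2 := hg 2 (by omega) (γ t)
  have g3 := hg 3 (by omega) (γ t)
  have hJ : jetWeight N γ t = 1 + ‖γ t‖ ^ (2 * (N + 1)) + ‖iteratedDeriv 1 γ t‖ ^ 24
    + ‖iteratedDeriv 2 γ t‖ ^ 6 + ‖iteratedDeriv 3 γ t‖ ^ 2 := rfl
  have hX := norm_nonneg (γ t)
  have hP := norm_nonneg (iteratedDeriv 1 γ t)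
  have hQ := norm_nonneg (iteratedDeriv 2 γ t)
  have hR := norm_nonneg (iteratedDeriv 3 γ t)
  have d1 := norm_iteratedDeriv_one_comp_le hs hγ t
  have d2 := norm_iteratedDeriv_two_comp_le hs hγ t
  have d3 := norm_iteratedDeriv_three_comp_le hs hγ t
  have w0 : 1 ≤ 1 + ‖γ t‖ ^ q := by
    have : 0 ≤ ‖γ t‖ ^ q := by positivity
    linarith
  have wsq : (1 + ‖γ t‖ ^ q) ^ 2 ≤ 2 * (1 + (1 + ‖γ t‖ ^ (2 * (N + 1)))) := by
    have e1 : ‖γ t‖ ^ (q * 2) ≤ 1 + ‖γ t‖ ^ (2 * (N + 1)) :=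
      pow_le_one_add_pow hX (by omega)
    rw [pow_mul] at e1
    nlinarith [sq_nonneg (‖γ t‖ ^ q - 1)]
  rw [norm_iteratedFDeriv_zero] at g0
  have p2 := pow_le_one_add_pow hP (show 2 ≤ 24 by norm_num)
  have p4 := pow_le_one_add_pow hP (show 4 ≤ 24 by norm_num)
  have p6 := pow_le_one_add_pow hP (show 6 ≤ 24 by norm_num)
  have q2 := pow_le_one_add_pow hQ (show 2 ≤ 6 by norm_num)
  have q4 := pow_le_one_add_pow hQ (show 4 ≤ 6 by norm_num)
  have x0 : 0 ≤ ‖γ t‖ ^ (2 * (N + 1)) := by positivity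
  have P0 : 0 ≤ ‖iteratedDeriv 1 γ t‖ ^ 24 := by positivity
  have Q0 : 0 ≤ ‖iteratedDeriv 2 γ t‖ ^ 6 := by positivity
  have R0 : 0 ≤ ‖iteratedDeriv 3 γ t‖ ^ 2 := by positivity
  rw [hJ]
  rw [← Real.norm_eq_abs]
  generalize ‖γ t‖ ^ (2 * (N + 1)) = X at *
  generalize 1 + ‖γ t‖ ^ q = w at *
  generalize ‖iteratedDeriv 1 γ t‖ = P at *
  generalize ‖iteratedDeriv 2 γ t‖ = Q at *
  generalize ‖iteratedDeriv 3 γ t‖ = R at *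
  have hw : 0 ≤ w := zero_le_one.trans w0
  have am : ∀ a b : ℝ, a * b ≤ a ^ 2 + b ^ 2 := fun a b ↦ by
    nlinarith [sq_nonneg (a - b), sq_nonneg (a + b)]
  have ww : w ≤ w ^ 2 := le_self_pow₀ w0 two_ne_zero
  have wP := am w P
  have wQ := am w Q
  have wR := am w R
  have wPP : w * P ^ 2 ≤ w ^ 2 + P ^ 4 := (am w (P ^ 2)).trans_eq (by ring)
  have wPPP : w * P ^ 3 ≤ w ^ 2 + P ^ 6 := (am w (P ^ 3)).trans_eq (by ring)
  have wPQ : w * P * Q ≤ w ^ 2 + (P ^ 4 + Q ^ 4) := by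
    have h1 := am w (P * Q)
    have h2 := am (P ^ 2) (Q ^ 2)
    calc w * P * Q = w * (P * Q) := mul_assoc _ _ _
      _ ≤ w ^ 2 + (P * Q) ^ 2 := h1
      _ = w ^ 2 + P ^ 2 * Q ^ 2 := by rw [mul_pow]
      _ ≤ w ^ 2 + ((P ^ 2) ^ 2 + (Q ^ 2) ^ 2) := by gcongr
      _ = _ := by ring
  have fin : ∀ a c : ℝ, a ≤ K * c → c ≤ 28 * (1 + X + P ^ 24 + Q ^ 6 + R ^ 2) →
      a ≤ 28 * K * (1 + X + P ^ 24 + Q ^ 6 + R ^ 2) := fun a c h1 h2 ↦ by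
    have := mul_le_mul_of_nonneg_left h2 hK
    linarith
  interval_cases j
  · rw [iteratedDeriv_zero]
    exact fin _ _ g0 (by linarith)
  · refine fin _ (w * P) (d1.trans ?_) (by linarith)
    rw [← mul_assoc]
    gcongr
  · refine fin _ (w * Q + w * P ^ 2) (d2.trans ?_) (by linarith)
    calc _ ≤ K * w * Q + K * w * P ^ 2 := by gcongr
      _ = _ := by ring
  · refine fin _ (w * R + 3 * (w * P * Q) + w * P ^ 3) (d3.trans ?_) (by linarith)
    calc _ ≤ K * w * R + 3 * (K * w) * P * Q + K * w * P ^ 3 := by gcongr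
      _ = _ := by ring

/-- For a fixed test function, all sufficiently large orders are admissible. -/
theorem HasAllOrderPolynomialGrowth.exists_jetBound {d : ℕ} {h : EuclideanSpace ℝ (Fin d) → ℝ}
    (hh : HasAllOrderPolynomialGrowth h) (N₀ : ℕ) : ∃ N M, N₀ ≤ N ∧ JetBound N M h := by
  obtain ⟨K, k, hK, hg⟩ := exists_uniform_growth fun n _ ↦ hh.2 n
  exact ⟨N₀ + k, 28 * K, by omega,
    jetBound_of_growth hK hh.1 (hg K k le_rfl le_rfl) (by omega)⟩

/-! ### The oracle -/

namespace NGOS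

variable {d : ℕ}

/-- The columns of the square root of the covariance matrix, together with the zero vector. -/
noncomputable def diffusion (G : NGOS d) :
    Option (Fin d) → EuclideanSpace ℝ (Fin d) → EuclideanSpace ℝ (Fin d)
  | none, _ => 0
  | some i, θ => G.sqrtCov θ (EuclideanSpace.single i 1)

theorem integrable_mul_noise (G : NGOS d) {σ : ℝ} (hσ : 0 < σ) (θ : EuclideanSpace ℝ (Fin d))
    (i j : Fin d) : Integrable (fun v : EuclideanSpace ℝ (Fin d) ↦ v i * v j) (G.noise σ θ) := by
  have h : ∀ i, MemLp (fun v : EuclideanSpace ℝ (Fin d) ↦ v i) 2 (G.noise σ θ) := fun i ↦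
    (EuclideanSpace.proj (𝕜 := ℝ) i).comp_memLp' (G.memLp_noise σ hσ θ)
  exact (h i).integrable_mul (h j)

/-- The quadratic form of the covariance is the mean of the square of a linear form of the noise;
scale 1 serves as well as any other. This is what makes `CFC.sqrt` square back to the covariance. -/
theorem posSemidef_cov (G : NGOS d) (θ : EuclideanSpace ℝ (Fin d)) : (G.cov θ).PosSemidef := by
  refine Matrix.PosSemidef.of_dotProduct_mulVec_nonneg ?_ fun a ↦ ?_
  · ext i j
    simp only [Matrix.conjTranspose_apply, star_trivial, ← G.cov_noise 1 one_pos, mul_comm]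
  · have e : star a ⬝ᵥ (G.cov θ).mulVec a
        = ∫ v : EuclideanSpace ℝ (Fin d), (∑ i, a i * v i) ^ 2 ∂(G.noise 1 θ) := by
      have e1 : ∀ v : EuclideanSpace ℝ (Fin d), (∑ i, a i * v i) ^ 2
          = ∑ i, ∑ j, a i * a j * (v i * v j) := fun v ↦ by
        rw [sq, Finset.sum_mul_sum]
        refine Finset.sum_congr rfl fun i _ ↦ Finset.sum_congr rfl fun j _ ↦ by ring
      simp only [e1]
      rw [integral_finsetSum _ fun i _ ↦ integrable_finsetSum _ fun j _ ↦
        (G.integrable_mul_noise one_pos θ i j).const_mul _]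
      simp only [dotProduct, Matrix.mulVec, Finset.mul_sum]
      refine Finset.sum_congr rfl fun i _ ↦ ?_
      rw [integral_finsetSum _ fun j _ ↦ (G.integrable_mul_noise one_pos θ i j).const_mul _]
      refine Finset.sum_congr rfl fun j _ ↦ ?_
      rw [integral_const_mul, G.cov_noise 1 one_pos]
      simp only [Pi.star_apply, star_trivial]
      ring
    rw [e]
    exact integral_nonneg fun v ↦ sq_nonneg _

theorem diffusion_some_apply (G : NGOS d) (i j : Fin d) (θ : EuclideanSpace ℝ (Fin d)) :
    G.diffusion (some i) θ j = CFC.sqrt (G.cov θ) j i := by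
  simp [diffusion, sqrtCov, Matrix.ofLp_toEuclideanCLM]

theorem sum_diffusion_mul (G : NGOS d) (θ : EuclideanSpace ℝ (Fin d)) (j l : Fin d) :
    ∑ i, G.diffusion (some i) θ j * G.diffusion (some i) θ l = G.cov θ j l := by
  have h0 : 0 ≤ G.cov θ := Matrix.nonneg_iff_posSemidef.2 (G.posSemidef_cov θ)
  have hs : (CFC.sqrt (G.cov θ)).IsHermitian :=
    (Matrix.nonneg_iff_posSemidef.1 (CFC.sqrt_nonneg _)).isHermitian
  have h1 := CFC.sqrt_mul_sqrt_self (G.cov θ) h0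
  conv_rhs => rw [← h1]
  rw [Matrix.mul_apply]
  refine Finset.sum_congr rfl fun i _ ↦ ?_
  rw [diffusion_some_apply, diffusion_some_apply]
  congr 1
  simpa using hs.apply i l

theorem bilin_apply_self (B : EuclideanSpace ℝ (Fin d) →L[ℝ] EuclideanSpace ℝ (Fin d) →L[ℝ] ℝ)
    (v : EuclideanSpace ℝ (Fin d)) : B v v = ∑ j, ∑ l, v j * v l
      * B (EuclideanSpace.single j 1) (EuclideanSpace.single l 1) := by
  have hv : v = ∑ j, v j • EuclideanSpace.single j (1 : ℝ) := by
    ext i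
    simp [Finset.sum_apply, Pi.single_apply]
  conv_lhs => rw [hv]
  simp only [map_sum, map_smul, FunLike.coe_sum, Finset.sum_apply, FunLike.coe_smul,
    Pi.smul_apply, smul_eq_mul, Finset.mul_sum]
  rw [Finset.sum_comm]
  refine Finset.sum_congr rfl fun j _ ↦ Finset.sum_congr rfl fun l _ ↦ by ring

theorem integral_bilin_noise (G : NGOS d) {σ : ℝ} (hσ : 0 < σ) (θ : EuclideanSpace ℝ (Fin d))
    (B : EuclideanSpace ℝ (Fin d) →L[ℝ] EuclideanSpace ℝ (Fin d) →L[ℝ] ℝ) :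
    ∫ v, B v v ∂(G.noise σ θ) = ∑ i, B (G.diffusion i θ) (G.diffusion i θ) := by
  simp only [bilin_apply_self B]
  rw [integral_finsetSum _ fun i _ ↦ integrable_finsetSum _ fun j _ ↦
    (G.integrable_mul_noise hσ θ i j).mul_const _, Finset.sum_comm]
  refine Finset.sum_congr rfl fun j _ ↦ ?_
  rw [integral_finsetSum _ fun l _ ↦ (G.integrable_mul_noise hσ θ j l).mul_const _,
    Finset.sum_comm]
  refine Finset.sum_congr rfl fun l _ ↦ ?_
  rw [integral_mul_const, G.cov_noise σ hσ, ← Finset.sum_mul, Fintype.sum_option,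
    G.sum_diffusion_mul]
  simp [diffusion]

theorem exists_centeredNoise (G : NGOS d) (hG : G.IsRegular) :
    ∃ A : ℕ → ℝ, (∀ m, 0 ≤ A m) ∧ ∀ σ, 0 < σ → CenteredNoise A (G.noise σ) := by
  choose! C hC using hG.bounded_moments
  refine ⟨fun m ↦ |C m|, fun m ↦ abs_nonneg _, fun σ hσ ↦ ⟨G.mean_noise σ hσ, ?_, ?_⟩⟩
  all_goals
    intro m hm θ
    have hp : MemLp id ((2 * m : ℕ) : ℝ≥0∞) (G.noise σ θ) :=
      ⟨aestronglyMeasurable_id, (hC m hm σ hσ θ).trans_lt ENNReal.ofReal_lt_top⟩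
  · exact hp.integrable_norm_pow (by omega)
  · have h1 := hC m hm σ hσ θ
    have hm0 : ((2 * m : ℕ) : ℝ) ≠ 0 := by positivity
    rw [hp.eLpNorm_eq_integral_rpow_norm (by simp; omega) (ENNReal.natCast_ne_top _)] at h1
    simp only [id, ENNReal.toReal_natCast, Real.rpow_natCast] at h1
    have h0 : 0 ≤ ∫ v, ‖v‖ ^ (2 * m) ∂(G.noise σ θ) := integral_nonneg fun _ ↦ by positivity
    have h2 := h1.trans (ENNReal.ofReal_le_ofReal
      (mul_le_mul_of_nonneg_right (le_abs_self (C m)) (by positivity : 0 ≤ 1 + ‖θ‖)))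
    rw [ENNReal.ofReal_le_ofReal_iff (by positivity)] at h2
    have h3 := pow_le_pow_left₀ (by positivity) h2 (2 * m)
    rwa [Real.rpow_inv_natCast_pow h0 (by omega)] at h3

end NGOS

/-- The Lipschitz constant supplies the linear growth and the uniform bound on the first derivative;
polynomial growth enters only at orders two and three. -/
theorem LipschitzWith.regularField {E : Type*} [NormedAddCommGroup E]
    [InnerProductSpace ℝ E] {f : E → E} {C K : ℝ} {q : ℕ} {D : NNReal} (hf : LipschitzWith D f)
    (hs : ContDiff ℝ (⊤ : ℕ∞) f) (h0 : ‖f 0‖ ≤ C) (hC : C ≤ K) (hD : D ≤ K)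
    (hg : ∀ n ≤ 3, ∀ x, ‖iteratedFDeriv ℝ n f x‖ ≤ K * (1 + ‖x‖ ^ q)) : RegularField K q f where
  smooth := hs
  growth x := by
    have h1 : ‖f x‖ ≤ ‖f 0‖ + ‖f x - f 0‖ := by
      simpa [add_comm] using norm_le_norm_add_norm_sub' (f x) (f 0)
    have h2 : ‖f x - f 0‖ ≤ D * ‖x‖ := by simpa using hf.norm_sub_le x 0
    have h3 : D * ‖x‖ ≤ K * ‖x‖ := by gcongr
    linarith
  bound_one x := by
    rw [norm_iteratedFDeriv_one]
    exact (norm_fderiv_le_of_lipschitz ℝ hf).trans hD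
  bound_two := hg 2 (by norm_num)
  bound_three := hg 3 (by norm_num)

theorem RegularField.zero {E : Type*} [NormedAddCommGroup E] [InnerProductSpace ℝ E] {K : ℝ}
    (hK : 0 ≤ K) (q : ℕ) : RegularField K q (fun _ : E ↦ (0 : E)) where
  smooth := contDiff_const
  growth x := by simp; positivity
  bound_one x := by simpa [iteratedFDeriv_fun_zero] using hK
  bound_two x := by simp; positivity
  bound_three x := by simp; positivity

theorem NGOS.IsRegular.exists_regularDiffusion {d : ℕ} {G : NGOS d} (hG : G.IsRegular) :
    ∃ (L : ℝ) (q : ℕ) (A : ℕ → ℝ), 0 ≤ L ∧ (∀ m, 0 ≤ A m) ∧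
      ∀ σ, 0 < σ → RegularDiffusion L q A (gradient G.loss) G.diffusion (G.noise σ) := by
  obtain ⟨A, hA, hκ⟩ := G.exists_centeredNoise hG
  obtain ⟨D₁, hD₁⟩ := hG.grad_lipschitz
  obtain ⟨D₂, hD₂⟩ := hG.sqrtCov_lipschitz
  obtain ⟨C, hC⟩ := hG.sqrtCov_bounded
  obtain ⟨K₁, k₁, hK₁, hg₁⟩ := exists_uniform_growth hG.grad_growth
  obtain ⟨K₂, k₂, hK₂, hg₂⟩ := exists_uniform_growth hG.sqrtCov_growth
  have hC0 : 0 ≤ C := (norm_nonneg _).trans (hC 0)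
  set g0 := ‖gradient G.loss 0‖ with hg0
  have hg00 : 0 ≤ g0 := norm_nonneg _
  set L := (D₁ : ℝ) + D₂ + C + K₁ + K₂ + g0 with hL
  have d1 : 0 ≤ (D₁ : ℝ) := D₁.2
  have d2 : 0 ≤ (D₂ : ℝ) := D₂.2
  have hL0 : 0 ≤ L := by positivity
  have ev : ∀ (i : Fin d) (T : EuclideanSpace ℝ (Fin d) →L[ℝ] EuclideanSpace ℝ (Fin d)),
      ‖T (EuclideanSpace.single i 1)‖ ≤ ‖T‖ := fun i T ↦ by
    simpa using T.le_opNorm (EuclideanSpace.single i 1)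
  have lip : ∀ i x y, ‖G.diffusion (some i) x - G.diffusion (some i) y‖ ≤ D₂ * ‖x - y‖ :=
    fun i x y ↦ (ev i (G.sqrtCov x - G.sqrtCov y)).trans (hD₂.norm_sub_le x y)
  refine ⟨L, k₁ + k₂, A, hL0, hA, fun σ hσ ↦ ⟨?_, ?_, ?_, ?_, ?_, hκ σ hσ, fun x B ↦
    G.integral_bilin_noise hσ x B⟩⟩
  · exact hD₁.regularField hG.grad_smooth le_rfl (by rw [hL, ← hg0]; linarith)
      (by rw [hL]; linarith) (hg₁ L _ (by rw [hL]; linarith) (by omega))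
  · intro x y
    refine (hD₁.norm_sub_le x y).trans ?_
    gcongr
    rw [hL]; linarith
  -- The zero field `none` keeps the index type nonempty even for `d = 0`, as the uniform choice of
  -- a direction requires.
  · rintro (_ | i)
    · exact RegularField.zero hL0 _
    · have hl : LipschitzWith D₂ (G.diffusion (some i)) :=
        LipschitzWith.of_dist_le_mul fun x y ↦ by simpa [dist_eq_norm] using lip i x y
      set e := ContinuousLinearMap.apply ℝ (EuclideanSpace ℝ (Fin d))
        (EuclideanSpace.single i (1 : ℝ)) with he
      have hcomp : G.diffusion (some i) = e ∘ G.sqrtCov := rfl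
      have hen : ‖e‖ ≤ 1 := ContinuousLinearMap.opNorm_le_bound _ zero_le_one fun T ↦ by
        rw [one_mul]; exact ev i T
      refine hl.regularField (C := C) ?_ ((ev i _).trans (hC 0)) (by rw [hL]; linarith)
        (by rw [hL]; linarith) fun n hn x ↦ ?_
      · rw [hcomp]
        exact e.contDiff.comp hG.sqrtCov_smooth
      · rw [hcomp]
        refine (e.norm_iteratedFDeriv_comp_left (hG.sqrtCov_smooth.contDiffAt (x := x))
          (by exact_mod_cast le_top)).trans ?_
        refine (mul_le_of_le_one_left (norm_nonneg _) hen).trans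
          (hg₂ L _ (by rw [hL]; linarith) (by omega) n hn x)
  · rintro (_ | i) x
    · simpa [NGOS.diffusion] using hL0
    · exact ((ev i _).trans (hC x)).trans (by rw [hL]; linarith)
  · rintro (_ | i) x y
    · simp only [NGOS.diffusion, sub_self, norm_zero]
      positivity
    · refine (lip i x y).trans ?_
      gcongr
      rw [hL]; linarith

/-! ### Averaged learning rates -/

/-- The total future learning rate applied to the momentum of step `k + 1`. -/
noncomputable def tailLR (lr β : ℕ → ℝ) (k : ℕ) : ℝ :=
  ∑' j, lr (k + j) * ∏ τ ∈ Finset.Ioc k (k + j), β τ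

section Schedule

variable {lr β : ℕ → ℝ} {H b : ℝ}

theorem prod_Ioc_mem_Icc (hβ : ∀ k, 0 ≤ β k) (hβb : ∀ k, β k ≤ b) (k j : ℕ) :
    ∏ τ ∈ Finset.Ioc k (k + j), β τ ∈ Set.Icc 0 (b ^ j) :=
  ⟨Finset.prod_nonneg fun i _ ↦ hβ i, by
    simpa using Finset.prod_le_prod (s := Finset.Ioc k (k + j)) (fun i _ ↦ hβ i) fun i _ ↦ hβb i⟩

theorem tailLR_term_mem_Icc (hlr : ∀ k, 0 ≤ lr k) (hlrH : ∀ k, lr k ≤ H) (hβ : ∀ k, 0 ≤ β k)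
    (hβb : ∀ k, β k ≤ b) (k j : ℕ) :
    lr (k + j) * ∏ τ ∈ Finset.Ioc k (k + j), β τ ∈ Set.Icc 0 (H * b ^ j) := by
  obtain ⟨h1, h2⟩ := prod_Ioc_mem_Icc hβ hβb k j
  exact ⟨mul_nonneg (hlr _) h1, mul_le_mul (hlrH _) h2 h1 ((hlr 0).trans (hlrH 0))⟩

theorem summable_tailLR_term (hlr : ∀ k, 0 ≤ lr k) (hlrH : ∀ k, lr k ≤ H) (hβ : ∀ k, 0 ≤ β k)
    (hβb : ∀ k, β k ≤ b) (hb : b < 1) (k : ℕ) :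
    Summable fun j ↦ lr (k + j) * ∏ τ ∈ Finset.Ioc k (k + j), β τ :=
  Summable.of_nonneg_of_le (fun j ↦ (tailLR_term_mem_Icc hlr hlrH hβ hβb k j).1)
    (fun j ↦ (tailLR_term_mem_Icc hlr hlrH hβ hβb k j).2)
    ((summable_geometric_of_lt_one ((hβ 0).trans (hβb 0)) hb).mul_left H)

theorem tailLR_mem_Icc (hlr : ∀ k, 0 ≤ lr k) (hlrH : ∀ k, lr k ≤ H) (hβ : ∀ k, 0 ≤ β k)
    (hβb : ∀ k, β k ≤ b) (hb : b < 1) (k : ℕ) : tailLR lr β k ∈ Set.Icc 0 (H / (1 - b)) := by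
  have h0 := (hβ 0).trans (hβb 0)
  refine ⟨tsum_nonneg fun j ↦ (tailLR_term_mem_Icc hlr hlrH hβ hβb k j).1, ?_⟩
  rw [div_eq_mul_inv, ← tsum_geometric_of_lt_one h0 hb, ← tsum_mul_left]
  exact (summable_tailLR_term hlr hlrH hβ hβb hb k).tsum_le_tsum
    (fun j ↦ (tailLR_term_mem_Icc hlr hlrH hβ hβb k j).2)
    ((summable_geometric_of_lt_one h0 hb).mul_left H)

/-- Splitting off the first term of the series. This recursion is the only property of `tailLR`,
besides its size, that the elimination of the momentum uses. -/
theorem tailLR_eq (hlr : ∀ k, 0 ≤ lr k) (hlrH : ∀ k, lr k ≤ H) (hβ : ∀ k, 0 ≤ β k)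
    (hβb : ∀ k, β k ≤ b) (hb : b < 1) (k : ℕ) :
    tailLR lr β k = lr k + β (k + 1) * tailLR lr β (k + 1) := by
  have h := (summable_tailLR_term hlr hlrH hβ hβb hb k).tsum_eq_zero_add
  rw [tailLR, h, tailLR, ← tsum_mul_left]
  simp only [add_zero, Finset.Ioc_self, Finset.prod_empty, mul_one]
  congr 2
  funext j
  have e : k + (j + 1) = k + 1 + j := by ring
  rw [e, ← Finset.prod_Ioc_consecutive β (Nat.le_succ k) (Nat.le_add_right (k + 1) j),
    Nat.succ_eq_add_one, Nat.Ioc_succ_singleton, Finset.prod_singleton]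
  ring

theorem averagedLRTerm_eq (lr β : ℕ → ℝ) (k : ℕ) : averagedLRTerm lr β k =
    fun j ↦ (lr (k + j) * ∏ τ ∈ Finset.Ioc k (k + j), β τ) * (1 - β k) := rfl

theorem summable_averagedLRTerm (hlr : ∀ k, 0 ≤ lr k) (hlrH : ∀ k, lr k ≤ H) (hβ : ∀ k, 0 ≤ β k)
    (hβb : ∀ k, β k ≤ b) (hb : b < 1) (k : ℕ) : Summable (averagedLRTerm lr β k) := by
  rw [averagedLRTerm_eq]
  exact (summable_tailLR_term hlr hlrH hβ hβb hb k).mul_right _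

theorem averagedLR_eq (lr β : ℕ → ℝ) (k : ℕ) : averagedLR lr β k = tailLR lr β k * (1 - β k) := by
  rw [averagedLR, averagedLRTerm_eq, tsum_mul_right, tailLR]

theorem averagedLR_const {η : ℝ} (hlr : ∀ k, lr k = η) (hβ : ∀ k, β k = b) (hb0 : 0 ≤ b)
    (hb : b < 1) (k : ℕ) : averagedLR lr β k = η := by
  rw [averagedLR_eq, tailLR]
  simp only [hlr, hβ, Finset.prod_const, Nat.card_Ioc, add_tsub_cancel_left]
  rw [tsum_mul_left, tsum_geometric_of_lt_one hb0 hb, mul_assoc, inv_mul_cancel₀ (by linarith),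
    mul_one]

end Schedule

/-! ### The trajectories as perturbed gradient descent -/

section Trajectories

variable {d : ℕ} {G : NGOS d} {σ : ℝ} {lr β : ℕ → ℝ} {x₀ : EuclideanSpace ℝ (Fin d)}
  {Ω : Type*} [MeasurableSpace Ω] {P : Measure Ω} [IsProbabilityMeasure P]

theorem IsSGD.perturbedDescent {z v : ℕ → Ω → EuclideanSpace ℝ (Fin d)}
    (h : IsSGD G σ lr x₀ P z v) (hσ : 0 < σ) :
    PerturbedDescent (gradient G.loss) (G.noise σ) σ lr 0 P z z (fun _ _ ↦ 0) v where
  step := h.step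
  near k ω := by simp
  cond k := by
    have := G.isMarkovKernel_noise σ hσ
    refine HasCondDistrib.comp_right
      (κ := (G.noise σ).comap (fun s : EuclideanSpace ℝ (Fin d) × EuclideanSpace ℝ (Fin d)
        × EuclideanSpace ℝ (Fin d) ↦ s.1) (by fun_prop))
      (Z := fun ω (i : Fin (k + 1)) ↦ z i ω)
      (f := fun w : Fin (k + 1) → EuclideanSpace ℝ (Fin d) ↦
        (w (Fin.last k), w (Fin.last k), (0 : EuclideanSpace ℝ (Fin d)))) (hf := by fun_prop) ?_
    exact h.noise k

/-- The change of variables that removes the momentum. The shift β a m is O(ρ²) m, written as O(ρ)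
times the rescaled momentum ρ m. The noise kernel depends on the history only through the last `x`,
so conditioning may be coarsened to the current state. -/
theorem IsSGDM.perturbedDescent {m x v : ℕ → Ω → EuclideanSpace ℝ (Fin d)}
    (h : IsSGDM G σ lr β x₀ P m x v) (hσ : 0 < σ) {a : ℕ → ℝ}
    (ha : ∀ k, a k = lr k + β (k + 1) * a (k + 1))
    {ρ c : ℝ} (hρ : 0 ≤ ρ) (hβa : ∀ k, |β k * a k| ≤ c * ρ ^ 2) :
    PerturbedDescent (gradient G.loss) (G.noise σ) σ (fun k ↦ a k * (1 - β k)) (c * ρ) P x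
      (fun k ω ↦ x k ω - (β k * a k) • m k ω) (fun k ω ↦ ρ • m k ω) v where
  step k ω := by
    have h1 := h.step k ω
    have h2 := h.step_momentum k ω
    -- Hence the new averaged iterate is x_k - a_k m_{k+1}; expanding m_{k+1}, its β_k m_k part is
    -- exactly the old shift.
    have h3 : lr k = a k - β (k + 1) * a (k + 1) := by rw [ha k]; ring
    simp only [h1, h3, h2, NGOS.stochGrad]
    module
  near k ω := by
    rw [sub_sub_cancel, norm_smul, norm_smul, Real.norm_eq_abs, Real.norm_of_nonneg hρ]
    calc |β k * a k| * ‖m k ω‖ ≤ c * ρ ^ 2 * ‖m k ω‖ := by gcongr; exact hβa k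
      _ = _ := by ring
  cond k := by
    have := G.isMarkovKernel_noise σ hσ
    refine HasCondDistrib.comp_right
      (κ := (G.noise σ).comap (fun s : EuclideanSpace ℝ (Fin d) × EuclideanSpace ℝ (Fin d)
        × EuclideanSpace ℝ (Fin d) ↦ s.1) (by fun_prop))
      (Z := fun ω (i : Fin (k + 1)) ↦ (m i ω, x i ω))
      (f := fun w : Fin (k + 1) → EuclideanSpace ℝ (Fin d) × EuclideanSpace ℝ (Fin d) ↦
        ((w (Fin.last k)).2, (w (Fin.last k)).2 - (β k * a k) • (w (Fin.last k)).1,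
          ρ • (w (Fin.last k)).1)) (hf := by fun_prop) ?_
    exact h.noise k

end Trajectories

theorem sq_mul_le_one_of_le_rpow {σ η : ℝ} (hη : 0 < η) (hσ : 0 < σ)
    (h : σ ≤ η ^ (-(1 / 2) : ℝ)) : σ ^ 2 * η ≤ 1 := by
  have h1 : σ ^ 2 ≤ (η ^ (-(1 / 2) : ℝ)) ^ 2 := pow_le_pow_left₀ hσ.le h 2
  have h2 : (η ^ (-(1 / 2) : ℝ)) ^ 2 = η⁻¹ := by
    rw [← Real.rpow_natCast, ← Real.rpow_mul hη.le, ← Real.rpow_neg_one]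
    norm_num
  rw [h2] at h1
  calc σ ^ 2 * η ≤ η⁻¹ * η := by gcongr
    _ = 1 := inv_mul_cancel₀ hη.ne'

/-! ### Weak approximation -/

/-- SGD with learning rates of order `η` agrees weakly with the two-point scheme. -/
theorem exists_abs_integral_sgd_sub_le {d : ℕ} {G : NGOS d} {L Λ : ℝ} {q : ℕ} {A : ℕ → ℝ}
    (hL : 0 ≤ L) (hΛ : 0 ≤ Λ) (hA : ∀ m, 0 ≤ A m)
    (hR : ∀ σ, 0 < σ → RegularDiffusion L q A (gradient G.loss) G.diffusion (G.noise σ))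
    (N : ℕ) (hq : 6 * q ≤ N + 1) {T : ℝ} (hT : 0 ≤ T) (x₀ : EuclideanSpace ℝ (Fin d)) :
    ∃ K : ℝ, 0 ≤ K ∧ ∀ {Ω : Type*} [MeasurableSpace Ω] (P : Measure Ω) [IsProbabilityMeasure P]
      (z v : ℕ → Ω → EuclideanSpace ℝ (Fin d)) (σ η ρ : ℝ) (lr : ℕ → ℝ) (M : ℝ)
      (u : EuclideanSpace ℝ (Fin d) → ℝ),
      IsSGD G σ lr x₀ P z v → JetBound N M u → 0 < σ → 0 ≤ η → 0 ≤ ρ → ρ ≤ 1 → η ≤ ρ ^ 2 →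
      σ ^ 2 * η ≤ 1 → (∀ k, |lr k| ≤ Λ * η) → ∀ k : ℕ, k * η ≤ T →
        Integrable (fun ω ↦ u (z k ω)) P ∧
        |∫ ω, u (z k ω) ∂P - signedEvolution (gradient G.loss) G.diffusion lr
          (fun k ↦ lr k * σ * √(Fintype.card (Option (Fin d)))) u k 0 x₀| ≤ K * M * ρ := by
  obtain ⟨B, hB⟩ := exists_moment_bound_descent (E := EuclideanSpace ℝ (Fin d)) L Λ hL hΛ A hA
    (N + 2) T (1 + ‖x₀‖ ^ (2 * (N + 3)))
  obtain ⟨K, hK, h⟩ := exists_abs_integral_sub_signedEvolution_le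
    (E := EuclideanSpace ℝ (Fin d)) L Λ 0 hL hΛ le_rfl A hA q N (Fintype.card (Option (Fin d))) hq T
    hT |B|
  refine ⟨K, hK, ?_⟩
  intro Ω _ P _ z v σ η ρ lr M u hz hu hσ hη hρ hρ1 hηρ hση hlr
  have := G.isMarkovKernel_noise σ hσ
  have hD := hz.perturbedDescent hσ
  have hη1 : η ≤ 1 := hηρ.trans (pow_le_one₀ hρ hρ1)
  have hb := (hR σ hσ).drift
  have hm := hB _ _ (hR σ hσ).noise hb.smooth.continuous hb.growth P z v σ η lr hD hη hη1 hση hlr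
    (by simp [hz.init]) (by simp [hz.init])
  refine h _ _ _ le_rfl (hR σ hσ) P z z (fun _ _ ↦ 0) v x₀ σ η ρ lr M u
    (by rwa [zero_mul]) hz.init hu hη hρ hρ1 hηρ hlr hση (fun k hk ↦ ⟨(hm k hk).1, by simp⟩)
    (fun k hk ↦ ⟨(hm k hk).2.trans (le_abs_self B), by simp⟩)

/-- SGD with momentum agrees weakly with the two-point scheme with averaged learning rates. -/
theorem exists_abs_integral_sgdm_sub_le {d : ℕ} {G : NGOS d} {L Λ l : ℝ} {q : ℕ} {A : ℕ → ℝ}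
    (hL : 0 ≤ L) (hΛ : 0 ≤ Λ) (hl : 0 < l) (hA : ∀ m, 0 ≤ A m)
    (hR : ∀ σ, 0 < σ → RegularDiffusion L q A (gradient G.loss) G.diffusion (G.noise σ))
    (N : ℕ) (hq : 6 * q ≤ N + 1) {T : ℝ} (hT : 0 ≤ T) (x₀ : EuclideanSpace ℝ (Fin d)) (C : ℝ) :
    ∃ K : ℝ, 0 ≤ K ∧ ∀ {Ω : Type*} [MeasurableSpace Ω] (P : Measure Ω) [IsProbabilityMeasure P]
      (m x v : ℕ → Ω → EuclideanSpace ℝ (Fin d)) (σ η ε ρ : ℝ) (lr β a : ℕ → ℝ) (M : ℝ)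
      (u : EuclideanSpace ℝ (Fin d) → ℝ),
      IsSGDM G σ lr β x₀ P m x v → JetBound N M u → 0 < σ → 0 ≤ η → 0 ≤ ε → ε ≤ 1 → 0 ≤ ρ →
      ρ ≤ 1 → ε * ρ ^ 2 = η → σ ^ 2 * η ≤ 1 →
      (∀ k, a k = lr k + β (k + 1) * a (k + 1)) → (∀ k, |a k| ≤ Λ * ρ ^ 2) →
      (∀ k, 0 ≤ β k) → (∀ k, l * ε ≤ 1 - β k) → (∀ k, 1 - β k ≤ ε) →
      Integrable (fun ω ↦ ‖m 0 ω‖ ^ (2 * (N + 3))) P →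
      ∫ ω, ‖m 0 ω‖ ^ (2 * (N + 3)) ∂P ≤ C → ∀ k : ℕ, k * η ≤ T →
        Integrable (fun ω ↦ u (x k ω)) P ∧
        |∫ ω, u (x k ω) ∂P - signedEvolution (gradient G.loss) G.diffusion
          (fun k ↦ a k * (1 - β k))
          (fun k ↦ a k * (1 - β k) * σ * √(Fintype.card (Option (Fin d)))) u k 0 x₀|
          ≤ K * M * ρ := by
  set p := 2 * (N + 3) with hp
  -- The index `N + 2` yields moments of order 2(N+3). The last argument bounds the initial moments
  -- of x₀ - β₀ a₀ m₀, where |β₀ a₀| ≤ Λ, and of ρ m₀.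
  obtain ⟨B, hB⟩ := exists_moment_bound_momentum (E := EuclideanSpace ℝ (Fin d)) L Λ l Λ hL hΛ hl hΛ
    A hA (N + 2) T (1 + 2 ^ p * (‖x₀‖ ^ p + Λ ^ p * C) + C)
  obtain ⟨K, hK, h⟩ := exists_abs_integral_sub_signedEvolution_le
    (E := EuclideanSpace ℝ (Fin d)) L Λ Λ hL hΛ hΛ A hA q N (Fintype.card (Option (Fin d))) hq T
    hT |B|
  refine ⟨K, hK, ?_⟩
  intro Ω _ P _ m x v σ η ε ρ lr β a M u hx hu hσ hη hε hε1 hρ hρ1 hερ hση ha haΛ hβ hβl hβε im hmC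
  have := G.isMarkovKernel_noise σ hσ
  have hβ1 : ∀ k, β k ≤ 1 := fun k ↦ by linarith [hβl k, mul_nonneg hl.le hε]
  have hβa : ∀ k, |β k * a k| ≤ Λ * ρ ^ 2 := fun k ↦ by
    rw [abs_mul, abs_of_nonneg (hβ k)]
    exact (mul_le_of_le_one_left (abs_nonneg _) (hβ1 k)).trans (haΛ k)
  have hD := hx.perturbedDescent hσ ha hρ hβa
  have hρ2 : ρ ^ 2 ≤ 1 := pow_le_one₀ hρ hρ1
  have hηρ : η ≤ ρ ^ 2 := by
    rw [← hερ]; exact mul_le_of_le_one_left (by positivity) hε1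
  have hη1 : η ≤ 1 := hηρ.trans hρ2
  have hlr : ∀ k, |a k * (1 - β k)| ≤ Λ * η := fun k ↦ by
    rw [abs_mul, abs_of_nonneg (by linarith [hβ1 k] : 0 ≤ 1 - β k)]
    calc _ ≤ Λ * ρ ^ 2 * ε := mul_le_mul (haΛ k) (hβε k) (by linarith [hβ1 k]) (by positivity)
      _ = Λ * (ε * ρ ^ 2) := by ring
      _ = _ := by rw [hερ]
  have hb := (hR σ hσ).drift
  have hN0 : ∀ ω, ‖ρ • m 0 ω‖ ^ p ≤ ‖m 0 ω‖ ^ p := fun ω ↦ by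
    rw [norm_smul, Real.norm_of_nonneg hρ]
    exact pow_le_pow_left₀ (by positivity) (mul_le_of_le_one_left (norm_nonneg _) hρ1) _
  have hy0 : ∀ ω, ‖x 0 ω - (β 0 * a 0) • m 0 ω‖ ^ p
      ≤ 2 ^ p * (‖x₀‖ ^ p + Λ ^ p * ‖m 0 ω‖ ^ p) := fun ω ↦ by
    rw [hx.init, ← mul_pow]
    refine (pow_le_pow_left₀ (norm_nonneg _) ?_ p).trans
      (add_pow_le_two_pow (norm_nonneg x₀) (by positivity) p)
    refine (norm_sub_le _ _).trans ?_
    rw [norm_smul, Real.norm_eq_abs]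
    have := (hβa 0).trans (mul_le_of_le_one_right hΛ hρ2)
    gcongr
  have iN : Integrable (fun ω ↦ ‖ρ • m 0 ω‖ ^ p) P :=
    im.mono' ((hD.aemeasurable 0).2.2.norm.pow_const p).aestronglyMeasurable
      (.of_forall fun ω ↦ by
        rw [Real.norm_of_nonneg (by positivity)]; exact hN0 ω)
  have iy' : Integrable (fun ω ↦ 2 ^ p * (‖x₀‖ ^ p + Λ ^ p * ‖m 0 ω‖ ^ p)) P :=
    ((integrable_const _).add (im.const_mul _)).const_mul _
  have iy : Integrable (fun ω ↦ ‖x 0 ω - (β 0 * a 0) • m 0 ω‖ ^ p) P :=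
    iy'.mono' ((hD.aemeasurable 0).2.1.norm.pow_const p).aestronglyMeasurable
      (.of_forall fun ω ↦ by
        rw [Real.norm_of_nonneg (by positivity)]; exact hy0 ω)
  have eN : ∫ ω, ‖ρ • m 0 ω‖ ^ p ∂P ≤ C := (integral_mono iN im hN0).trans hmC
  have ey : ∫ ω, ‖x 0 ω - (β 0 * a 0) • m 0 ω‖ ^ p ∂P ≤ 2 ^ p * (‖x₀‖ ^ p + Λ ^ p * C) := by
    refine (integral_mono iy iy' hy0).trans ?_
    rw [integral_const_mul, integral_add (integrable_const _) (im.const_mul _), integral_const_mul]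
    simp only [integral_const, probReal_univ, one_smul]
    gcongr
  have hm := hB _ _ (hR σ hσ).noise hb.smooth.continuous hb.growth P x _ _ v σ η ε ρ _ β hD
    (fun k ω ↦ by
      rw [hx.step_momentum, NGOS.stochGrad]
      module) hη hη1 hε hε1 hρ hρ1 hερ hση hlr hβ hβl hβε iy iN
    (add_le_add (add_le_add le_rfl ey) eN)
  exact h _ _ _ le_rfl (hR σ hσ) P x _ _ v x₀ σ η ρ _ M u hD hx.init hu hη hρ hρ1 hηρ hlr hση
    (fun k hk ↦ (hm k hk).1) (fun k hk ↦ ⟨(hm k hk).2.1.trans (le_abs_self B),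
      (hm k hk).2.2.trans (le_abs_self B)⟩)

/-- Pointwise consequences, for one scale `η`, of the scaling condition on schedules. -/
theorem IsScaledSchedule.exists_bounds {S : Set ℝ} (hS : ∀ η ∈ S, 0 < η) {α : ℝ}
    {lr β : ℝ → ℕ → ℝ} (h : IsScaledSchedule S α lr β) :
    ∃ Λ l : ℝ, 0 ≤ Λ ∧ 0 < l ∧ ∀ η ∈ S,
      (∀ k, 0 ≤ β η k) ∧ (∀ k, l * η ^ α ≤ 1 - β η k) ∧ (∀ k, 1 - β η k ≤ η ^ α) ∧
      (∀ k, Summable (averagedLRTerm (lr η) (β η) k)) ∧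
      (∀ k, tailLR (lr η) (β η) k = lr η k + β η (k + 1) * tailLR (lr η) (β η) (k + 1)) ∧
      (∀ k, |tailLR (lr η) (β η) k| ≤ Λ * η ^ (1 - α)) := by
  obtain ⟨hβ, H, l, l', hl, hl', h⟩ := h
  -- A geometric series with ratio at most 1 - l η^α and first term at most |H| η sums to at most
  -- (|H| / l) η^(1-α).
  refine ⟨|H| / l, l, by positivity, hl, fun η hη ↦ ?_⟩
  have hη0 := hS η hη
  have hp : 0 < η ^ α := Real.rpow_pos_of_pos hη0 α
  have h1 : ∀ k, 0 ≤ lr η k := fun k ↦ by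
    have := mul_nonneg (h η hη k).1.1 hη0.le
    rwa [div_mul_cancel₀ _ hη0.ne'] at this
  have h2 : ∀ k, lr η k ≤ |H| * η := fun k ↦ by
    rw [← div_le_iff₀ hη0]
    exact (h η hη k).1.2.le.trans (le_abs_self H)
  have h3 : ∀ k, 0 ≤ β η k := fun k ↦ (hβ η hη k).1.le
  have h4 : ∀ k, l * η ^ α ≤ 1 - β η k := fun k ↦ by
    rw [← le_div_iff₀ hp]; exact (h η hη k).2.1
  have h5 : ∀ k, 1 - β η k ≤ η ^ α := fun k ↦ by
    have := (h η hη k).2.2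
    rw [div_le_iff₀ hp] at this
    exact this.trans (mul_le_of_le_one_left hp.le hl'.le)
  have h6 : ∀ k, β η k ≤ 1 - l * η ^ α := fun k ↦ by linarith [h4 k]
  have h7 : 1 - l * η ^ α < 1 := by linarith [mul_pos hl hp]
  refine ⟨h3, h4, h5, summable_averagedLRTerm h1 h2 h3 h6 h7, tailLR_eq h1 h2 h3 h6 h7,
    fun k ↦ ?_⟩
  obtain ⟨h8, h9⟩ := tailLR_mem_Icc h1 h2 h3 h6 h7 k
  rw [abs_of_nonneg h8]
  refine h9.trans_eq ?_
  rw [sub_sub_cancel, Real.rpow_sub hη0, Real.rpow_one]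
  field_simp

theorem theorem3p1 {d : ℕ} (x₀ : EuclideanSpace ℝ (Fin d))
    (α : ℝ) (hα₀ : 0 ≤ α) (hα₁ : α < 1)
    (G : NGOS d) (hG : G.IsRegular)
    (S : Set ℝ) (hS : ∀ η ∈ S, 0 < η)
    (lr β : ℝ → ℕ → ℝ) (hsched : IsScaledSchedule S α lr β)
    (σ : ℝ → ℝ) (hσ : ∀ η ∈ S, 0 < σ η ∧ σ η ≤ η ^ (-(1 / 2) : ℝ))
    {Ω : ℝ → Type*} [∀ η, MeasurableSpace (Ω η)]
    (P : ∀ η, Measure (Ω η)) [∀ η, IsProbabilityMeasure (P η)]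
    (m x v : ∀ η, ℕ → Ω η → EuclideanSpace ℝ (Fin d))
    (hx : ∀ η ∈ S, IsSGDM G (σ η) (lr η) (β η) x₀ (P η) (m η) (x η) (v η))
    (hm : HasBoundedMoments S P (fun η ↦ m η 0))
    {Ω' : ℝ → Type*} [∀ η, MeasurableSpace (Ω' η)]
    (P' : ∀ η, Measure (Ω' η)) [∀ η, IsProbabilityMeasure (P' η)]
    (z v' : ∀ η, ℕ → Ω' η → EuclideanSpace ℝ (Fin d))
    (hz : ∀ η ∈ S, IsSGD G (σ η) (averagedLR (lr η) (β η)) x₀ (P' η) (z η) (v' η)) :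
    (∀ η ∈ S, ∀ k, Summable (averagedLRTerm (lr η) (β η) k)) ∧
    IsWeakApprox ((1 - α) / 2) S P x P' z ∧
    (∀ b : ℝ → ℝ, (∀ η ∈ S, ∀ k, lr η k = η ∧ β η k = b η) →
      (∀ η ∈ S, ∀ k, averagedLR (lr η) (β η) k = η) ∧
      IsWeakApproxAtRate (fun η ↦ Real.sqrt (η / (1 - b η))) S P x P' z) := by
  obtain ⟨Λ, l, hΛ, hl, hs⟩ := hsched.exists_bounds hS
  -- `0 ≤ C` is recorded because the claim on constant schedules enlarges the rate while keeping
  -- `C`.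
  have main : ∀ T : ℝ, 0 < T → ∀ h : EuclideanSpace ℝ (Fin d) → ℝ, HasAllOrderPolynomialGrowth h →
      ∃ C : ℝ, 0 ≤ C ∧ ∀ η ∈ S, η ≤ 1 → ∀ k : ℕ, k ≤ ⌊T / η⌋₊ →
        Integrable (fun ω ↦ h (x η k ω)) (P η) ∧ Integrable (fun ω ↦ h (z η k ω)) (P' η) ∧
        |∫ ω, h (x η k ω) ∂(P η) - ∫ ω, h (z η k ω) ∂(P' η)| ≤ C * η ^ ((1 - α) / 2) := by
    intro T hT h hh
    obtain ⟨L, q, A, hL, hA, hR⟩ := hG.exists_regularDiffusion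
    -- One `N` must be large enough both for the growth of `h` and for propagation, which asks for
    -- 6q ≤ N + 1.
    obtain ⟨N, M, hN, hu⟩ := hh.exists_jetBound (6 * q)
    obtain ⟨C₀, -, hC₀⟩ := hm (2 * (N + 3)) (by omega)
    obtain ⟨K₁, hK₁, h₁⟩ := exists_abs_integral_sgdm_sub_le hL hΛ hl hA hR N (by omega) hT.le x₀ C₀
    obtain ⟨K₂, hK₂, h₂⟩ := exists_abs_integral_sgd_sub_le hL hΛ hA hR N (by omega) hT.le x₀
    have hM := hu.nonneg
    refine ⟨(K₁ + K₂) * M, by positivity, fun η hη hη1 k hk ↦ ?_⟩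
    have hη0 := hS η hη
    obtain ⟨hβ, hβl, hβε, -, ha, haΛ⟩ := hs η hη
    have hkT : (k : ℝ) * η ≤ T := by
      rw [← le_div_iff₀ hη0]
      exact (Nat.cast_le.2 hk).trans (Nat.floor_le (by positivity))
    -- The parameters are ρ = η^((1-α)/2) and ε = η^α, so that ε ρ² = η; η ≤ 1 makes both at most 1.
    have hρ0 : 0 ≤ η ^ ((1 - α) / 2) := Real.rpow_nonneg hη0.le _
    have hρ1 : η ^ ((1 - α) / 2) ≤ 1 := Real.rpow_le_one hη0.le hη1 (by linarith)
    have hε0 : 0 ≤ η ^ α := Real.rpow_nonneg hη0.le _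
    have hε1 : η ^ α ≤ 1 := Real.rpow_le_one hη0.le hη1 hα₀
    have hρ2 : (η ^ ((1 - α) / 2)) ^ 2 = η ^ (1 - α) := by
      rw [← Real.rpow_natCast, ← Real.rpow_mul hη0.le]
      norm_num
    have hερ : η ^ α * (η ^ ((1 - α) / 2)) ^ 2 = η := by
      rw [hρ2, ← Real.rpow_add hη0]
      simp
    have hηρ : η ≤ (η ^ ((1 - α) / 2)) ^ 2 := by
      conv_lhs => rw [← hερ]
      exact mul_le_of_le_one_left (by positivity) hε1
    have hση := sq_mul_le_one_of_le_rpow hη0 (hσ η hη).1 (hσ η hη).2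
    obtain ⟨i₁, e₁⟩ := h₁ (P η) (m η) (x η) (v η) (σ η) η (η ^ α) (η ^ ((1 - α) / 2)) (lr η) (β η)
      (tailLR (lr η) (β η)) M h (hx η hη) hu (hσ η hη).1 hη0.le hε0 hε1 hρ0 hρ1 hερ hση ha
      (by rwa [hρ2]) hβ hβl hβε (hC₀ η hη).1 (hC₀ η hη).2 k hkT
    have hlr : averagedLR (lr η) (β η) = fun k ↦ tailLR (lr η) (β η) k * (1 - β η k) :=
      funext (averagedLR_eq _ _)
    have hz' := hz η hη
    rw [hlr] at hz'
    have hlr' : ∀ k, |tailLR (lr η) (β η) k * (1 - β η k)| ≤ Λ * η := fun k ↦ by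
      have h0 : 0 ≤ 1 - β η k := (mul_nonneg hl.le hε0).trans (hβl k)
      rw [abs_mul, abs_of_nonneg h0]
      calc _ ≤ Λ * η ^ (1 - α) * η ^ α :=
            mul_le_mul (haΛ k) (hβε k) h0 (mul_nonneg hΛ (Real.rpow_nonneg hη0.le _))
        _ = Λ * (η ^ α * (η ^ ((1 - α) / 2)) ^ 2) := by rw [hρ2]; ring
        _ = _ := by rw [hερ]
    obtain ⟨i₂, e₂⟩ := h₂ (P' η) (z η) (v' η) (σ η) η (η ^ ((1 - α) / 2)) _ M h hz' hu
      (hσ η hη).1 hη0.le hρ0 hρ1 hηρ hση hlr' k hkT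
    refine ⟨i₁, i₂, ?_⟩
    rw [abs_sub_comm] at e₂
    calc _ ≤ _ := abs_sub_le _ _ _
      _ ≤ _ := add_le_add e₁ e₂
      _ = _ := by ring
  refine ⟨fun η hη ↦ (hs η hη).2.2.2.1, ⟨1, one_pos, fun T hT h hh ↦ ?_⟩, fun b hb ↦
    ⟨fun η hη k ↦ ?_, 1, one_pos, fun T hT h hh ↦ ?_⟩⟩
  · obtain ⟨C, -, hC⟩ := main T hT h hh
    exact ⟨C, hC⟩
  · have hβ := hsched.1 η hη 0
    rw [(hb η hη 0).2] at hβ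
    exact averagedLR_const (fun k ↦ (hb η hη k).1) (fun k ↦ (hb η hη k).2) hβ.1.le hβ.2 k
  · obtain ⟨C, hC0, hC⟩ := main T hT h hh
    refine ⟨C, fun η hη hη1 k hk ↦ ?_⟩
    obtain ⟨i₁, i₂, e⟩ := hC η hη hη1 k hk
    refine ⟨i₁, i₂, e.trans (mul_le_mul_of_nonneg_left ?_ hC0)⟩
    have hη0 := hS η hη
    have hβ := (hsched.1 η hη 0).2
    have hβε := (hs η hη).2.2.1 0
    rw [(hb η hη 0).2] at hβ hβε
    -- Since λ_max < 1 gives 1 - β ≤ η^α, the rate √(η / (1 - β)) is no smaller than η^((1-α)/2).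
    refine Real.le_sqrt_of_sq_le ?_
    calc (η ^ ((1 - α) / 2)) ^ 2 = η / η ^ α := by
          rw [← Real.rpow_natCast, ← Real.rpow_mul hη0.le, Nat.cast_ofNat,
            div_mul_cancel₀ _ two_ne_zero, Real.rpow_sub hη0, Real.rpow_one]
      _ ≤ η / (1 - b η) := div_le_div_of_nonneg_left hη0.le (by linarith) hβε
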